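/- Let $N>n\ge 1$ be integers, $r>0$, $\Lambda\ge 0$, and $$r_\Lambda=\big((3n+2)(\Lambda+1)^{1/2}\big)^{-1}.$$ Write $B^n_\rho=\{z\in\mathbb C^n : |z|<\rho\}$. Let $f:B^n_r\to\mathbb C^{N-n}$ be a holomorphic map with $f(0)=0$ and $Df(0)=0$, and let $$\omega_f=\tfrac{\sqrt{-1}}{2}\,\partial\bar\partial\log(1+|z|^2+|f|^2)=\tfrac{\sqrt{-1}}{2}\sum_{i,j=1}^n g_{i\bar j}\,dz^i\wedge d\bar z^j .$$ Let $R(\omega_f)=-4\sum_{i,j}g^{i\bar j}\,\frac{\partial^2}{\partial z^i\partial\bar z^j}\log\det(g_{k\bar l})$ be its scalar curvature, where $\sum_j g^{i\bar j}g_{k\bar j}=\delta^i_k$. Suppose that there is a Hermitian $(N+1)\times(N+1)$ matrix $A$ with $A\le\Lambda I_{N+1}$ such that on $B^n_r$ $$n(n+1)-\tfrac14 R(\omega_f)=\frac{(1,z,f)^*A\,(1,z,f)}{1+|z|^2+|f|^2}.$$ Then, with $|Df|^2=\sum_{i=1}^n|\partial f/\partial z^i|^2$, $$1+|z|^2+|f|^2+|Df|^2\le\big(1-r_\Lambda^{-1}|z|\big)^{-\frac{2}{3n+2}}\qquad\text{for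 all } z\in B^n_r \text{ with } |z|<r_\Lambda .$$ Moreover, if $r<r_\Lambda$, then $f$ extends to a holomorphic map on $B^n_{r_\Lambda}$. -/

import Mathlib

open scoped ComplexOrder

noncomputable section

namespace KahlerGraph

/-- The Wirtinger derivative `∂u/∂zⁱ = (∂u/∂xⁱ - √-1 ∂u/∂yⁱ) / 2`, where `zⁱ = xⁱ + √-1 yⁱ`. -/
def dz {n : ℕ} (i : Fin n) (u : EuclideanSpace ℂ (Fin n) → ℂ)
    (z : EuclideanSpace ℂ (Fin n)) : ℂ :=
  (fderiv ℝ u z (EuclideanSpace.single i 1)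
    - Complex.I * fderiv ℝ u z (EuclideanSpace.single i Complex.I)) / 2

/-- The Wirtinger derivative `∂u/∂z̄ⁱ = (∂u/∂xⁱ + √-1 ∂u/∂yⁱ) / 2`. -/
def dzbar {n : ℕ} (i : Fin n) (u : EuclideanSpace ℂ (Fin n) → ℂ)
    (z : EuclideanSpace ℂ (Fin n)) : ℂ :=
  (fderiv ℝ u z (EuclideanSpace.single i 1)
    + Complex.I * fderiv ℝ u z (EuclideanSpace.single i Complex.I)) / 2

/-- The complex Hessian `(∂²u/∂zⁱ∂z̄ʲ)`: the coefficients of `∂∂̄u = ∑ uᵢⱼ dzⁱ ∧ dz̄ʲ`. -/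
def complexHessian {n : ℕ} (u : EuclideanSpace ℂ (Fin n) → ℂ)
    (z : EuclideanSpace ℂ (Fin n)) : Matrix (Fin n) (Fin n) ℂ :=
  Matrix.of fun i j => dz i (dzbar j u) z

/-- The Ricci tensor `Ricᵢⱼ = -∂²(log det g)/∂zⁱ∂z̄ʲ` of the Kähler metric
`ω = (√-1/2) ∑ gᵢⱼ dzⁱ ∧ dz̄ʲ`. (For a metric, `det g` is a positive real number, so that
`Complex.log` is its real logarithm.) -/
def ricci {n : ℕ} (g : EuclideanSpace ℂ (Fin n) → Matrix (Fin n) (Fin n) ℂ)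
    (z : EuclideanSpace ℂ (Fin n)) : Matrix (Fin n) (Fin n) ℂ :=
  -complexHessian (fun x => Complex.log (g x).det) z

/-- The (Riemannian) scalar curvature `R(ω)` of the Kähler metric
`ω = (√-1/2) ∑ gᵢⱼ dzⁱ ∧ dz̄ʲ`: four times the contraction of the Ricci tensor with the inverse
of `(gᵢⱼ)`. The factor `4` comes from the normalization of `ω`: the underlying Riemannian metric
pairs `∂/∂zⁱ` with `∂/∂z̄ʲ` to `gᵢⱼ / 2`, and the full real trace is twice the trace over the
`(1,0)` indices. So the Fubini-Study metric `(√-1/2) ∂∂̄ log (1 + |z|²)` has `R = 4 n (n + 1)`. -/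
def scalarCurvature {n : ℕ} (g : EuclideanSpace ℂ (Fin n) → Matrix (Fin n) (Fin n) ℂ)
    (z : EuclideanSpace ℂ (Fin n)) : ℂ :=
  4 * ((g z)⁻¹ * ricci g z).trace

/-- The coefficients `gᵢⱼ` of `ω_f = (√-1/2) ∂∂̄ log (1 + |z|² + |f|²)`. -/
def graphMetric {n k : ℕ} (f : EuclideanSpace ℂ (Fin n) → EuclideanSpace ℂ (Fin k))
    (z : EuclideanSpace ℂ (Fin n)) : Matrix (Fin n) (Fin n) ℂ :=
  complexHessian (fun x => ((Real.log (1 + ‖x‖ ^ 2 + ‖f x‖ ^ 2) : ℝ) : ℂ)) z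

/-- The vector `(1, z, f(z)) ∈ ℂ^(N + 1)`, where `N = n + k`. -/
def graphVec {n k : ℕ} (f : EuclideanSpace ℂ (Fin n) → EuclideanSpace ℂ (Fin k))
    (z : EuclideanSpace ℂ (Fin n)) : Fin (n + k + 1) → ℂ :=
  Fin.cons 1 (Fin.append (fun i => z i) (fun a => f z a))

/-- `|Df|² = ∑ᵢ |∂f/∂zⁱ|²`, the sum of the squared moduli of all first partial derivatives. -/
def gradNormSq {n k : ℕ} (f : EuclideanSpace ℂ (Fin n) → EuclideanSpace ℂ (Fin k))
    (z : EuclideanSpace ℂ (Fin n)) : ℝ :=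
  ∑ i : Fin n, ‖fderiv ℂ f z (EuclideanSpace.single i 1)‖ ^ 2

/-- The radius `r_Λ = ((3n + 2) (Λ + 1)^(1/2))⁻¹`. -/
def extRadius (n : ℕ) (Λ : ℝ) : ℝ := ((3 * n + 2) * Real.sqrt (Λ + 1))⁻¹

end KahlerGraph

end

/-! Once its denominators are cleared, the curvature equation is an equality between norms of
holomorphic vectors. Let `F = (1, z, f)` and let `G` be the vector of maximal minors of the matrix
with rows `F` and `∂ᵢF`. Up to a constant, `det g = |G|² / |F|^(2(n+1))`, so `Ric = (n+1) g - ∂∂̄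
log |G|²`, and `n(n+1) - R/4` is the `g`-trace of `∂∂̄ log |G|²`. Lagrange's identity writes `∂∂̄
log |G|²` as a sum of squares of the components of `G ∧ ∂G`. The matrix determinant lemma and
Cauchy-Binet do the same for `g⁻¹`. The result is `|F|² S / (2 |G|⁶)`, where `S` is a sum of squared
moduli of holomorphic functions (`scalarCurvature_graphMetric`). With `Λ - A = B* B` the hypothesis
becomes `|F|⁴ S + 2 |G|⁶ |BF|² = 2 Λ |G|⁶ |F|²`.

By Calabi's rigidity, holomorphic vectors of equal norm are related by a constant linear contraction
(`exists_linear_contraction`). So the vector behind `|F|⁴ S` is a linear contraction of `√(2Λ) G ⊗ G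
⊗ G ⊗ F` (`exists_linear_sffVec`). Its components include all second derivatives of `f`, because the
entries of `Df` and the constant `1` are among the minors in `G`. Hence `D²f` is a fixed polynomial
in `(z, f, Df)`. Moreover `|D²f|² ≤ Λ J^(3n+3)` for `J = 1 + |z|² + |f|² + |Df|²`, since `|G|² ≤
(n+1)! J^(n+1)`. Cauchy-Schwarz along the ray `s ↦ s z` gives `J' ≤ 2 |z| (Λ+1)^(1/2) J^((3n+4)/2)`,
and integrating this from `J(0) = 1` is the estimate (`jetNormSq_le`).

For the extension, the linear relation survives analytic continuation by the identity theorem, and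
the estimate survives with it. Along a ray the first jet solves a holomorphic differential equation
with polynomial right-hand side. As long as the jet stays bounded, the `j`-th derivatives are at
most a constant times `j! D^j`. So the ball of convergence of the Taylor series at `0` can be
enlarged by an amount that depends only on the bound (`exists_taylorBound_add`), and finitely many
enlargements reach any radius below `r_Λ`. -/

noncomputable section

namespace KahlerGraph

open Metric Set Filter Topology

/-! ### Holomorphic maps in several variables: Cauchy estimates, smoothness, identity theorem. -/

section SeveralVariables

universe u

variable {E F : Type*} [NormedAddCommGroup E] [NormedSpace ℂ E]
  [NormedAddCommGroup F] [NormedSpace ℂ F]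

/-- Cauchy's estimate for the directional derivative of a holomorphic map. -/
theorem norm_fderiv_apply_le {f : E → F} {w : E} {R C : ℝ} (hR : 0 < R)
    (hf : ∀ x ∈ closedBall w R, DifferentiableAt ℂ f x) (hC : ∀ x ∈ closedBall w R, ‖f x‖ ≤ C)
    (v : E) : ‖fderiv ℂ f w v‖ ≤ C / R * ‖v‖ := by
  rcases eq_or_ne v 0 with rfl | hv
  · simp
  have hv' : 0 < ‖v‖ := norm_pos_iff.2 hv
  have hmem : ∀ t ∈ closedBall (0 : ℂ) (R / ‖v‖), w + t • v ∈ closedBall w R := by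
    intro t ht
    rw [mem_closedBall_zero_iff, le_div_iff₀ hv'] at ht
    simpa [norm_smul] using ht
  have hline : ∀ t : ℂ, HasDerivAt (fun t : ℂ => w + t • v) v t := fun t => by
    simpa using ((hasDerivAt_id t).smul_const v).const_add w
  have hd : DifferentiableOn ℂ (fun t : ℂ => f (w + t • v)) (closedBall 0 (R / ‖v‖)) :=
    fun t ht => ((hf _ (hmem t ht)).hasFDerivAt.comp_hasDerivAt t
      (hline t)).differentiableAt.differentiableWithinAt
  have h0 : HasDerivAt (fun t : ℂ => f (w + t • v)) (fderiv ℂ f w v) 0 := by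
    have h := (hf w (mem_closedBall_self hR.le)).hasFDerivAt
    rw [show w = w + (0 : ℂ) • v by simp] at h
    simpa [Function.comp_def] using h.comp_hasDerivAt (0 : ℂ) (hline 0)
  have hb := Complex.norm_deriv_le_of_forall_mem_sphere_norm_le (div_pos hR hv')
    (hd.mono closure_ball_subset_closedBall).diffContOnCl
    (fun t ht => hC _ (hmem t (sphere_subset_closedBall ht)))
  rw [h0.deriv] at hb
  calc _ ≤ _ := hb
    _ = _ := by field_simp

theorem norm_fderiv_le_div {f : E → F} {w : E} {R C : ℝ} (hR : 0 < R)
    (hf : ∀ x ∈ closedBall w R, DifferentiableAt ℂ f x) (hC : ∀ x ∈ closedBall w R, ‖f x‖ ≤ C) :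
    ‖fderiv ℂ f w‖ ≤ C / R := by
  have hC0 : 0 ≤ C := (norm_nonneg _).trans (hC w (mem_closedBall_self hR.le))
  exact ContinuousLinearMap.opNorm_le_bound _ (by positivity) (norm_fderiv_apply_le hR hf hC)

/-- Directional derivatives of holomorphic maps are holomorphic. -/
theorem differentiableOn_fderiv_apply [FiniteDimensional ℂ E] [FiniteDimensional ℂ F]
    {f : E → F} {U : Set E} (hU : IsOpen U) (hf : DifferentiableOn ℂ f U) (v : E) :
    DifferentiableOn ℂ (fun z => fderiv ℂ f z v) U := by
  intro z₀ hz₀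
  apply DifferentiableAt.differentiableWithinAt
  have : CompleteSpace F := FiniteDimensional.complete ℂ F
  have hfU : ∀ x ∈ U, DifferentiableAt ℂ f x := fun x hx => hf.differentiableAt (hU.mem_nhds hx)
  obtain ⟨δ, hδ, hball⟩ : ∃ δ > 0, closedBall z₀ δ ⊆ U ∩ {x | ‖f x‖ < ‖f z₀‖ + 1} := by
    refine Metric.nhds_basis_closedBall.mem_iff.1 (inter_mem (hU.mem_nhds hz₀) ?_)
    exact (hfU z₀ hz₀).continuousAt.norm.eventually_lt continuousAt_const (by simp)
  set C := ‖f z₀‖ + 1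
  have hbound : ∀ x ∈ closedBall z₀ (δ / 2), ‖fderiv ℂ f x‖ ≤ C / (δ / 2) := by
    intro x hx
    have hsub : closedBall x (δ / 2) ⊆ closedBall z₀ δ :=
      closedBall_subset_closedBall' (by rw [mem_closedBall] at hx; linarith)
    exact norm_fderiv_le_div (by positivity) (fun y hy => hfU y (hball (hsub hy)).1)
      (fun y hy => (hball (hsub hy)).2.le)
  -- The circle radius keeps `x + t • v` within `δ / 2` of `z₀` for all `x` within `δ / 4`; there
  -- the Cauchy estimate bounds the derivative. The `+ 1` covers `v = 0`.
  set ε := δ / (4 * (‖v‖ + 1)) with hε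
  have hε0 : 0 < ε := by positivity
  have hεv : ε * ‖v‖ ≤ δ / 4 := by
    rw [hε, div_mul_eq_mul_div, div_le_iff₀ (by positivity)]
    nlinarith [norm_nonneg v]
  have hmem : ∀ x ∈ closedBall z₀ (δ / 4), ∀ t ∈ closedBall (0 : ℂ) ε,
      x + t • v ∈ closedBall z₀ (δ / 2) := by
    intro x hx t ht
    rw [mem_closedBall_zero_iff] at ht
    rw [mem_closedBall_iff_norm] at hx ⊢
    calc ‖x + t • v - z₀‖ = ‖(x - z₀) + t • v‖ := by congr 1; abel
      _ ≤ ‖x - z₀‖ + ‖t‖ * ‖v‖ := (norm_add_le _ _).trans (by rw [norm_smul])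
      _ ≤ δ / 4 + ε * ‖v‖ := by gcongr
      _ ≤ _ := by linarith
  have hsub2 : closedBall z₀ (δ / 2) ⊆ closedBall z₀ δ := closedBall_subset_closedBall (by linarith)
  -- The kernel of Cauchy's formula for the derivative in the direction `v`. It turns `fderiv ℂ f x
  -- v` into an integral of values of `f`, which may be differentiated in `x` under the integral
  -- sign.
  let κ : ℝ → ℂ := fun θ => deriv (circleMap 0 ε) θ * (1 / (circleMap 0 ε θ - 0) ^ 2)
  have hκ : Continuous κ := by
    have h1 : Continuous fun θ => (1 / (circleMap 0 ε θ - 0) ^ 2 : ℂ) :=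
      continuous_const.div (((continuous_circleMap 0 ε).sub continuous_const).pow 2)
        fun θ => by simp [hε0.ne']
    simp only [κ, deriv_circleMap]
    exact ((continuous_circleMap 0 ε).mul continuous_const).mul h1
  have hcm : ∀ θ, circleMap (0 : ℂ) ε θ ∈ closedBall (0 : ℂ) ε := fun θ =>
    circleMap_mem_closedBall 0 hε0.le θ
  let G : E → ℝ → F := fun x θ => κ θ • f (x + circleMap 0 ε θ • v)
  let G' : E → ℝ → E →L[ℂ] F := fun x θ => κ θ • fderiv ℂ f (x + circleMap 0 ε θ • v)
  have hcurve : ∀ x, Continuous fun θ => x + circleMap (0 : ℂ) ε θ • v := fun x =>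
    continuous_const.add ((continuous_circleMap 0 ε).smul continuous_const)
  have hGc : ∀ x ∈ closedBall z₀ (δ / 4), Continuous (G x) := by
    intro x hx
    refine hκ.smul (continuous_iff_continuousAt.2 fun θ => ?_)
    exact ContinuousAt.comp (f := fun θ => x + circleMap (0 : ℂ) ε θ • v) (g := f)
      (hfU _ (hball (hsub2 (hmem x hx _ (hcm θ)))).1).continuousAt (hcurve x).continuousAt
  have hz₀mem : z₀ ∈ closedBall z₀ (δ / 4) := mem_closedBall_self (by positivity)
  have key : HasFDerivAt (fun x => ∫ θ in (0 : ℝ)..2 * Real.pi, G x θ)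
      (∫ θ in (0 : ℝ)..2 * Real.pi, G' z₀ θ) z₀ := by
    refine intervalIntegral.hasFDerivAt_integral_of_dominated_of_fderiv_le
      (μ := MeasureTheory.volume) (bound := fun θ => ‖κ θ‖ * (C / (δ / 2)))
      (closedBall_mem_nhds z₀ (show 0 < δ / 4 by positivity)) ?_ ?_ ?_ ?_ ?_ ?_
    · filter_upwards [closedBall_mem_nhds z₀ (show 0 < δ / 4 by positivity)] with x hx
      exact (hGc x hx).aestronglyMeasurable
    · exact (hGc z₀ hz₀mem).intervalIntegrable _ _
    -- Continuity of `fderiv ℂ f` is not yet known, but measurability holds for every function.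
    · borelize E
      borelize (E →L[ℂ] F)
      have : ProperSpace (E →L[ℂ] F) := FiniteDimensional.proper ℂ _
      exact (hκ.aestronglyMeasurable).smul
        ((measurable_fderiv ℂ f).comp (hcurve z₀).measurable).aestronglyMeasurable
    · refine Filter.Eventually.of_forall fun θ _ x hx => ?_
      simp only [G', norm_smul]
      exact mul_le_mul_of_nonneg_left (hbound _ (hmem x hx _ (hcm θ))) (norm_nonneg _)
    · exact (hκ.norm.mul continuous_const).intervalIntegrable _ _
    · refine Filter.Eventually.of_forall fun θ _ x hx => ?_
      have h1 := (hfU _ (hball (hsub2 (hmem x hx _ (hcm θ)))).1).hasFDerivAt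
      exact (h1.comp x ((hasFDerivAt_id x).add_const _)).const_smul (κ θ)
  have heq : (fun z => fderiv ℂ f z v) =ᶠ[𝓝 z₀]
      fun x => (2 * Real.pi * Complex.I : ℂ)⁻¹ • ∫ θ in (0 : ℝ)..2 * Real.pi, G x θ := by
    filter_upwards [closedBall_mem_nhds z₀ (show 0 < δ / 4 by positivity)] with x hx
    have hline : ∀ t : ℂ, HasDerivAt (fun t : ℂ => x + t • v) v t := fun t => by
      simpa using ((hasDerivAt_id t).smul_const v).const_add x
    have hd : DifferentiableOn ℂ (fun t : ℂ => f (x + t • v)) (closedBall 0 ε) := fun t ht =>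
      ((hfU _ (hball (hsub2 (hmem x hx _ ht))).1).hasFDerivAt.comp_hasDerivAt t
        (hline t)).differentiableAt.differentiableWithinAt
    have h0 : HasDerivAt (fun t : ℂ => f (x + t • v)) (fderiv ℂ f x v) 0 := by
      have hx0 := hmem x hx 0 (mem_closedBall_self hε0.le)
      have h := (hfU _ (hball (hsub2 hx0)).1).hasFDerivAt
      simpa [Function.comp_def] using h.comp_hasDerivAt (0 : ℂ) (hline 0)
    have := hd.deriv_eq_smul_circleIntegral hε0
    rw [h0.deriv, circleIntegral] at this
    rw [eq_inv_smul_iff₀ Complex.two_pi_I_ne_zero, ← this]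
    simp only [G, κ, smul_smul]
  exact (heq.differentiableAt_iff).2 (key.differentiableAt.const_smul _)

/-- Evaluation on a basis of `E` is injective, so it has a linear left inverse, and the derivative
is recovered holomorphically from finitely many directional derivatives. -/
theorem differentiableOn_fderiv [FiniteDimensional ℂ E] [FiniteDimensional ℂ F]
    {f : E → F} {U : Set E} (hU : IsOpen U) (hf : DifferentiableOn ℂ f U) :
    DifferentiableOn ℂ (fderiv ℂ f) U := by
  let b := Module.finBasis ℂ E
  let L : (E →L[ℂ] F) →ₗ[ℂ] (Fin (Module.finrank ℂ E) → F) :=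
    LinearMap.pi fun i => (ContinuousLinearMap.apply ℂ F (b i)).toLinearMap
  have hL : LinearMap.ker L = ⊥ := by
    rw [LinearMap.ker_eq_bot']
    intro m hm
    ext x
    have : (m : E →ₗ[ℂ] F) = 0 := b.ext fun i => by simpa [L] using congrFun hm i
    exact LinearMap.congr_fun this x
  obtain ⟨P, hP⟩ := L.exists_leftInverse_of_injective hL
  have heq : fderiv ℂ f = fun z => LinearMap.toContinuousLinearMap P (fun i => fderiv ℂ f z (b i)) := by
    funext z
    exact (LinearMap.congr_fun hP (fderiv ℂ f z)).symm
  rw [heq]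
  refine (LinearMap.toContinuousLinearMap P).differentiable.comp_differentiableOn ?_
  exact differentiableOn_pi.2 fun i => differentiableOn_fderiv_apply hU hf (b i)

/-- Holomorphic maps are smooth. -/
theorem contDiffOn_of_differentiableOn {E F : Type u} [NormedAddCommGroup E] [NormedSpace ℂ E]
    [NormedAddCommGroup F] [NormedSpace ℂ F] [FiniteDimensional ℂ E] [FiniteDimensional ℂ F]
    {f : E → F} {U : Set E} (hU : IsOpen U) (hf : DifferentiableOn ℂ f U) (N : ℕ) :
    ContDiffOn ℂ N f U := by
  -- The target becomes `E →L[ℂ] F` at each step, which is why `E` and `F` share a universe.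
  induction N generalizing f F with
  | zero => exact contDiffOn_zero.2 hf.continuousOn
  | succ N ih =>
    rw [Nat.cast_succ]
    refine (contDiffOn_succ_iff_fderiv_of_isOpen hU).2 ⟨hf, fun h => by simp at h, ?_⟩
    exact ih (differentiableOn_fderiv hU hf)

/-- The identity theorem on concentric balls. -/
theorem eqOn_zero_of_eqOn_zero_ball [CompleteSpace F] {f : E → F} {r ρ : ℝ} (hr : 0 < r)
    (hf : DifferentiableOn ℂ f (ball 0 ρ)) (h0 : ∀ z ∈ ball (0 : E) r, f z = 0) :
    ∀ z ∈ ball (0 : E) ρ, f z = 0 := by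
  intro z hz
  -- Restriction to the complex line through `z` reduces the claim to the one-variable identity
  -- theorem.
  let S : Set ℂ := (fun t : ℂ => t • z) ⁻¹' ball (0 : E) ρ
  have hlin : Continuous fun t : ℂ => t • z := continuous_id.smul continuous_const
  have hS : IsOpen S := isOpen_ball.preimage hlin
  have hρ : 0 < ρ := pos_of_mem_ball hz
  have hSc : Convex ℝ S := (convex_ball (0 : E) ρ).linear_preimage
    ((LinearMap.toSpanSingleton ℂ E z).restrictScalars ℝ)
  have hg : DifferentiableOn ℂ (fun t : ℂ => f (t • z)) S := fun t ht =>
    (DifferentiableAt.comp t (hf.differentiableAt (isOpen_ball.mem_nhds ht))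
      (differentiableAt_id.smul_const z)).differentiableWithinAt
  have h0S : (0 : ℂ) ∈ S := by simp [S, hρ]
  have hev : (fun t : ℂ => f (t • z)) =ᶠ[𝓝 0] 0 := by
    have : (fun t : ℂ => t • z) ⁻¹' ball (0 : E) r ∈ 𝓝 (0 : ℂ) :=
      hlin.continuousAt.preimage_mem_nhds (by simpa using ball_mem_nhds (0 : E) hr)
    filter_upwards [this] with t ht using h0 _ ht
  have := (hg.analyticOnNhd hS).eqOn_zero_of_preconnected_of_eventuallyEq_zero
    hSc.isPreconnected h0S hev (show (1 : ℂ) ∈ S by simpa [S] using hz)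
  simpa using this

end SeveralVariables

end KahlerGraph

end

noncomputable section

namespace KahlerGraph

open Metric Set Filter Topology

/-! ### Calabi's rigidity. -/

section Rigidity

variable {E : Type*} [NormedAddCommGroup E] [NormedSpace ℂ E] {ι κ : Type*} [Fintype ι] [Fintype κ]

/-- The inner product is antilinear in its first slot, and the conjugate parameter there restores
holomorphy in `s`. -/
theorem differentiableOn_inner_conj {a : E → EuclideanSpace ℂ ι} {U : Set E} (hU : IsOpen U)
    (ha : DifferentiableOn ℂ a U) (m d : E) :
    DifferentiableOn ℂ (fun s : ℂ => inner ℂ (a (m + (starRingEnd ℂ s) • d)) (a (m + s • d)))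
      {s : ℂ | m + s • d ∈ U ∧ m + (starRingEnd ℂ s) • d ∈ U} := by
  rintro s ⟨hs, hs'⟩
  have hcoord : ∀ i, ∀ x ∈ U, DifferentiableAt ℂ (fun x => a x i) x := fun i x hx =>
    (EuclideanSpace.proj (𝕜 := ℂ) i).differentiableAt.comp x
      (ha.differentiableAt (hU.mem_nhds hx))
  have hline : ∀ (s : ℂ), DifferentiableAt ℂ (fun s : ℂ => m + s • d) s := fun s =>
    (differentiableAt_id.smul_const d).const_add m
  have h1 : ∀ i, DifferentiableAt ℂ (fun s : ℂ => a (m + s • d) i) s := fun i =>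
    DifferentiableAt.comp (g := fun x => a x i) (f := fun s : ℂ => m + s • d) s (hcoord i _ hs)
      (hline s)
  have h2 : ∀ i, DifferentiableAt ℂ
      (fun s : ℂ => starRingEnd ℂ (a (m + (starRingEnd ℂ s) • d) i)) s := fun i => by
    have h := (DifferentiableAt.comp (g := fun x => a x i) (f := fun s : ℂ => m + s • d)
      (starRingEnd ℂ s) (hcoord i _ hs') (hline _)).conj_conj
    simpa [Function.comp_def] using h
  simp only [PiLp.inner_apply, RCLike.inner_apply]
  exact (DifferentiableAt.fun_sum fun i _ => (h1 i).mul (h2 i)).differentiableWithinAt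

/-- Polarization: holomorphic maps with equal norms on a ball have equal inner products. -/
theorem inner_eq_inner_of_norm_eq {a : E → EuclideanSpace ℂ ι} {b : E → EuclideanSpace ℂ κ}
    {r : ℝ} (ha : DifferentiableOn ℂ a (ball 0 r)) (hb : DifferentiableOn ℂ b (ball 0 r))
    (hab : ∀ z ∈ ball (0 : E) r, ‖a z‖ = ‖b z‖) {z w : E} (hz : z ∈ ball (0 : E) r)
    (hw : w ∈ ball (0 : E) r) : inner ℂ (a w) (a z) = inner ℂ (b w) (b z) := by
  -- The choice makes `s = I` give the pair `(z, w)`, while for real `s` the two arguments coincide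
  -- and only norms occur. Vanishing on real `s` near `0` then propagates to `s = I`.
  set m : E := (2⁻¹ : ℂ) • (z + w) with hm
  set d : E := (2⁻¹ * -Complex.I : ℂ) • (z - w) with hd
  have hzmd : m + Complex.I • d = z := by
    simp only [hm, hd, smul_smul]
    rw [show Complex.I * (2⁻¹ * -Complex.I) = (2⁻¹ : ℂ) by
      linear_combination (-(1 / 2) : ℂ) * Complex.I_mul_I, ← smul_add]
    rw [show z + w + (z - w) = (2 : ℂ) • z by rw [two_smul]; abel, smul_smul]
    norm_num
  have hwmd : m + (starRingEnd ℂ Complex.I) • d = w := by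
    simp only [hm, hd, smul_smul, Complex.conj_I]
    rw [show -Complex.I * (2⁻¹ * -Complex.I) = -(2⁻¹ : ℂ) by
      linear_combination (1 / 2 : ℂ) * Complex.I_mul_I, neg_smul,
      ← sub_eq_add_neg, ← smul_sub]
    rw [show z + w - (z - w) = (2 : ℂ) • w by rw [two_smul]; abel, smul_smul]
    norm_num
  set S : Set ℂ := {s : ℂ | m + s • d ∈ ball (0 : E) r ∧ m + (starRingEnd ℂ s) • d ∈ ball (0 : E) r}
  have hc1 : Continuous fun s : ℂ => m + s • d :=
    continuous_const.add (continuous_id.smul continuous_const)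
  have hc2 : Continuous fun s : ℂ => m + (starRingEnd ℂ s) • d :=
    hc1.comp Complex.continuous_conj
  have hSo : IsOpen S := (isOpen_ball.preimage hc1).inter (isOpen_ball.preimage hc2)
  have hSc : Convex ℝ S := by
    have hconv := convex_ball (0 : E) r
    intro s hs t ht α β hα hβ hαβ
    have key : ∀ x y : ℂ, m + (α • x + β • y) • d = α • (m + x • d) + β • (m + y • d) := by
      intro x y
      have : m = (α + β) • m := by rw [hαβ, one_smul]
      conv_lhs => rw [this]
      simp only [add_smul, smul_add, smul_assoc]
      abel
    refine ⟨?_, ?_⟩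
    · change m + (α • s + β • t) • d ∈ _
      rw [key]
      exact hconv hs.1 ht.1 hα hβ hαβ
    · change m + (starRingEnd ℂ (α • s + β • t)) • d ∈ _
      rw [show starRingEnd ℂ (α • s + β • t) = α • starRingEnd ℂ s + β • starRingEnd ℂ t by simp, key]
      exact hconv hs.2 ht.2 hα hβ hαβ
  have hmz : m ∈ ball (0 : E) r := by
    have := convex_ball (0 : E) r hz hw (show (0 : ℝ) ≤ 2⁻¹ by norm_num)
      (show (0 : ℝ) ≤ 2⁻¹ by norm_num) (by norm_num)
    have e : m = (2⁻¹ : ℝ) • z + (2⁻¹ : ℝ) • w := by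
      rw [hm, smul_add]
      congr 1 <;> rw [← Complex.coe_smul] <;> norm_num
    rwa [e]
  have h0S : (0 : ℂ) ∈ S := by simpa [S] using hmz
  have hdiff := ((differentiableOn_inner_conj isOpen_ball ha m d).sub
    (differentiableOn_inner_conj isOpen_ball hb m d)).analyticOnNhd hSo
  have hfreq : ∃ᶠ s in 𝓝[≠] (0 : ℂ),
      ((fun s : ℂ => inner ℂ (a (m + (starRingEnd ℂ s) • d)) (a (m + s • d))) -
        fun s : ℂ => inner ℂ (b (m + (starRingEnd ℂ s) • d)) (b (m + s • d))) s = 0 := by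
    have htend : Tendsto (fun x : ℝ => (x : ℂ)) (𝓝[≠] 0) (𝓝[≠] 0) := by
      refine tendsto_nhdsWithin_iff.2 ⟨?_, ?_⟩
      · exact (Complex.continuous_ofReal.tendsto' 0 0 (by simp)).mono_left nhdsWithin_le_nhds
      · filter_upwards [self_mem_nhdsWithin] with x hx
        simpa using hx
    refine htend.frequently (Filter.Eventually.frequently ?_)
    have hev : ∀ᶠ s in 𝓝[≠] (0 : ℂ), s ∈ S := nhdsWithin_le_nhds (hSo.mem_nhds h0S)
    filter_upwards [htend.eventually hev] with x hx
    simp only [Pi.sub_apply, Complex.conj_ofReal, inner_self_eq_norm_sq_to_K]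
    rw [hab _ hx.1, sub_self]
  have hfin := hdiff.eqOn_zero_of_preconnected_of_frequently_eq_zero hSc.isPreconnected h0S hfreq
    (show Complex.I ∈ S from ⟨by rwa [hzmd], by rwa [hwmd]⟩)
  simp only [Pi.sub_apply, hzmd, hwmd, Pi.zero_apply, sub_eq_zero] at hfin
  exact hfin

/-- Calabi's rigidity: holomorphic maps with equal norms differ by a linear contraction. -/
theorem exists_linear_contraction {a : E → EuclideanSpace ℂ ι} {b : E → EuclideanSpace ℂ κ}
    {r : ℝ} (ha : DifferentiableOn ℂ a (ball 0 r)) (hb : DifferentiableOn ℂ b (ball 0 r))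
    (hab : ∀ z ∈ ball (0 : E) r, ‖a z‖ = ‖b z‖) :
    ∃ L : EuclideanSpace ℂ κ →ₗ[ℂ] EuclideanSpace ℂ ι,
      (∀ z ∈ ball (0 : E) r, a z = L (b z)) ∧ ∀ v, ‖L v‖ ≤ ‖v‖ := by
  -- Formal combinations of points of the ball: equal Gram matrices give `‖Ta x‖ = ‖Tb x‖`, so `Tb x
  -- ↦ Ta x` is a well-defined isometry on the span of the `b z`. It is extended by zero on the
  -- orthogonal complement.
  let Ta := Finsupp.linearCombination ℂ (fun z : ball (0 : E) r => a z)
  let Tb := Finsupp.linearCombination ℂ (fun z : ball (0 : E) r => b z)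
  have hnorm : ∀ x, ‖Ta x‖ = ‖Tb x‖ := by
    intro x
    have h : inner ℂ (Ta x) (Ta x) = inner ℂ (Tb x) (Tb x) := by
      simp only [Ta, Tb, Finsupp.linearCombination_apply, Finsupp.sum, sum_inner, inner_sum,
        inner_smul_left, inner_smul_right]
      refine Finset.sum_congr rfl fun z _ => ?_
      refine congrArg _ (Finset.sum_congr rfl fun w _ => ?_)
      rw [inner_eq_inner_of_norm_eq ha hb hab z.2 w.2]
    rw [inner_self_eq_norm_sq_to_K, inner_self_eq_norm_sq_to_K] at h
    have h2 : ‖Ta x‖ ^ 2 = ‖Tb x‖ ^ 2 := by exact_mod_cast h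
    exact (sq_eq_sq₀ (norm_nonneg _) (norm_nonneg _)).1 h2
  obtain ⟨s, hs⟩ := Tb.rangeRestrict.exists_rightInverse_of_surjective
    (LinearMap.range_rangeRestrict Tb)
  have hs' : ∀ y : LinearMap.range Tb, Tb (s y) = y := fun y =>
    congrArg Subtype.val (LinearMap.congr_fun hs y)
  let P := (LinearMap.range Tb).orthogonalProjectionOnto
  refine ⟨Ta ∘ₗ s ∘ₗ P.toLinearMap, fun z hz => ?_, fun v => ?_⟩
  · have hbz : Tb (Finsupp.single ⟨z, hz⟩ 1) = b z := by simp [Tb]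
    have haz : Ta (Finsupp.single ⟨z, hz⟩ 1) = a z := by simp [Ta]
    have hP : (P (b z) : EuclideanSpace ℂ κ) = b z := by
      have hm : b z ∈ LinearMap.range Tb := ⟨_, hbz⟩
      exact congrArg Subtype.val (Submodule.orthogonalProjectionOnto_mem_subspace_eq_self
        (⟨b z, hm⟩ : LinearMap.range Tb))
    have h := hnorm (s (P (b z)) - Finsupp.single ⟨z, hz⟩ 1)
    rw [map_sub, map_sub, hs', hP, hbz, sub_self, norm_zero, norm_eq_zero, sub_eq_zero, haz] at h
    exact h.symm
  · change ‖Ta (s (P v))‖ ≤ _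
    rw [hnorm, hs']
    exact (LinearMap.range Tb).norm_orthogonalProjectionOnto_apply_le v

end Rigidity

end KahlerGraph

end

noncomputable section

namespace KahlerGraph

open Matrix

/-! ### Cauchy-Binet, and inequalities and identities for determinants. -/

section LinearAlgebra

variable {m κ : Type*} [Fintype m] [DecidableEq m] [Fintype κ]

/-- Multilinearity of the determinant in the columns of `A * B`. -/
theorem det_mul_eq_sum_functions {R : Type*} [CommRing R] (A : Matrix m κ R) (B : Matrix κ m R) :
    (A * B).det = ∑ p : m → κ, (A.submatrix id p).det * ∏ i, B (p i) i := by
  classical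
  simp only [det_apply, mul_apply, Finset.prod_univ_sum, Fintype.piFinset_univ,
    Finset.prod_mul_distrib, Finset.smul_sum, submatrix_apply, id_eq, Finset.sum_mul]
  rw [Finset.sum_comm]
  simp only [smul_mul_assoc]

/-- The Cauchy-Binet formula, summed over all functions instead of all subsets. -/
theorem card_factorial_mul_det_mul {R : Type*} [CommRing R] (A : Matrix m κ R)
    (B : Matrix κ m R) :
    ((Fintype.card m).factorial : R) * (A * B).det =
      ∑ p : m → κ, (A.submatrix id p).det * (B.submatrix p id).det := by
  classical
  -- Reindexing the sum by a permutation moves a sign onto the product of entries of `B`. Summing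
  -- over all permutations assembles these products into a minor of `B`.
  have hperm : ∀ τ : Equiv.Perm m, (A * B).det =
      ∑ p : m → κ, (A.submatrix id p).det * (Equiv.Perm.sign τ • ∏ i, B (p (τ i)) i) := by
    intro τ
    rw [det_mul_eq_sum_functions, ← (Equiv.arrowCongr τ (Equiv.refl κ)).symm.sum_comp]
    refine Finset.sum_congr rfl fun p _ => ?_
    have h1 : A.submatrix id ((Equiv.arrowCongr τ (Equiv.refl κ)).symm p) =
        (A.submatrix id p).submatrix id τ := by
      ext i j
      simp [Equiv.arrowCongr]
    rw [h1, det_permute']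
    simp only [Equiv.arrowCongr, Equiv.coe_fn_symm_mk, Function.comp_apply, Equiv.refl_symm,
      Equiv.coe_refl, id_eq, Units.smul_def, zsmul_eq_mul]
    ring
  calc ((Fintype.card m).factorial : R) * (A * B).det
      = ∑ τ : Equiv.Perm m, (A * B).det := by simp [Fintype.card_perm]
    _ = ∑ τ : Equiv.Perm m, ∑ p : m → κ,
          (A.submatrix id p).det * (Equiv.Perm.sign τ • ∏ i, B (p (τ i)) i) :=
        Finset.sum_congr rfl fun τ _ => hperm τ
    _ = _ := by
        rw [Finset.sum_comm]
        refine Finset.sum_congr rfl fun p _ => ?_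
        rw [← Finset.mul_sum, det_apply (B.submatrix p id)]
        rfl

theorem card_factorial_mul_det_mul_conjTranspose (A : Matrix m κ ℂ) :
    ((Fintype.card m).factorial : ℂ) * (A * Aᴴ).det =
      ((∑ p : m → κ, ‖(A.submatrix id p).det‖ ^ 2 : ℝ) : ℂ) := by
  rw [card_factorial_mul_det_mul]
  push_cast
  refine Finset.sum_congr rfl fun p _ => ?_
  rw [← conjTranspose_submatrix, det_conjTranspose, ← Complex.mul_conj']
  rfl

theorem comp_perm_injective {m κ J : Type*} (P : J → m → κ) (hinj : ∀ j, Function.Injective (P j))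
    (hrange : Function.Injective fun j => Set.range (P j)) :
    Function.Injective fun x : J × Equiv.Perm m => P x.1 ∘ x.2 := by
  rintro ⟨j, σ⟩ ⟨j', σ'⟩ h
  simp only at h
  have hj : j = j' := hrange (by
    simp only
    rw [← σ.surjective.range_comp (P j), ← σ'.surjective.range_comp (P j'), h])
  subst hj
  congr 1
  ext x
  exact hinj j (congrFun h x)

/-- A permutation-invariant sum over all functions counts each of several injections with
distinct ranges at least `(card m)!` times. -/
theorem card_factorial_mul_sum_le {J : Type*} [Fintype J] (P : J → m → κ)
    (hinj : ∀ j, Function.Injective (P j))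
    (hrange : Function.Injective fun j => Set.range (P j)) (h : (m → κ) → ℝ)
    (h0 : ∀ p, 0 ≤ h p) (hσ : ∀ p (σ : Equiv.Perm m), h (p ∘ σ) = h p) :
    ((Fintype.card m).factorial : ℝ) * ∑ j, h (P j) ≤ ∑ p, h p := by
  classical
  calc ((Fintype.card m).factorial : ℝ) * ∑ j, h (P j)
      = ∑ x : J × Equiv.Perm m, h (P x.1 ∘ x.2) := by
        simp only [hσ, Fintype.sum_prod_type, Finset.sum_const, Finset.card_univ,
          Fintype.card_perm, nsmul_eq_mul, Finset.mul_sum]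
    _ = ∑ p ∈ Finset.univ.map ⟨_, comp_perm_injective P hinj hrange⟩, h p := by
        rw [Finset.sum_map]
        rfl
    _ ≤ _ := Finset.sum_le_sum_of_subset_of_nonneg (Finset.subset_univ _) fun p _ _ => h0 p

/-- Cramer's rule for the identity matrix. It shows that the entries of `Q` are themselves maximal
minors of `(1 | Q)`. -/
theorem det_one_fromCols_submatrix_update {κ : Type*} (Q : Matrix m κ ℂ) (l : m) (a : κ) :
    ((fromCols 1 Q).submatrix id (Function.update Sum.inl l (Sum.inr a))).det = Q l a := by
  have h : (fromCols 1 Q).submatrix id (Function.update Sum.inl l (Sum.inr a)) =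
      (1 : Matrix m m ℂ).updateCol l (fun i => Q i a) := by
    ext i j
    rcases eq_or_ne j l with rfl | hj
    · simp
    · simp [hj]
  rw [h, ← cramer_apply, cramer_one]
  rfl

/-- The arithmetic-geometric mean inequality for the eigenvalues. -/
theorem det_re_le_trace_pow [Nonempty m] {M : Matrix m m ℂ} (hM : M.PosSemidef) :
    M.det.re ≤ (M.trace.re / Fintype.card m) ^ Fintype.card m := by
  have hcard : (0 : ℝ) < Fintype.card m := by exact_mod_cast Fintype.card_pos
  have hdet : M.det.re = ∏ i, hM.1.eigenvalues i := by
    rw [hM.1.det_eq_prod_eigenvalues]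
    exact_mod_cast Complex.ofReal_re _
  have htr : M.trace.re = ∑ i, hM.1.eigenvalues i := by
    rw [hM.1.trace_eq_sum_eigenvalues]
    exact_mod_cast Complex.ofReal_re _
  have h := Real.geom_mean_le_arith_mean Finset.univ (fun _ => (1 : ℝ)) hM.1.eigenvalues
    (by simp) (by simpa using hcard) (fun i _ => hM.eigenvalues_nonneg i)
  simp only [Real.rpow_one, one_mul, Finset.sum_const, Finset.card_univ, nsmul_eq_mul, mul_one]
    at h
  rw [hdet, htr]
  have hp : 0 ≤ ∏ i, hM.1.eigenvalues i := Finset.prod_nonneg fun i _ => hM.eigenvalues_nonneg i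
  calc ∏ i, hM.1.eigenvalues i
      = ((∏ i, hM.1.eigenvalues i) ^ ((Fintype.card m : ℝ)⁻¹)) ^ Fintype.card m := by
        rw [← Real.rpow_natCast, ← Real.rpow_mul hp, inv_mul_cancel₀ hcard.ne', Real.rpow_one]
    _ ≤ _ := pow_le_pow_left₀ (Real.rpow_nonneg hp _) h _

/-- The matrix determinant lemma; it lets the quadratic form of an inverse be read off from
determinants. -/
theorem det_add_vecMulVec_star {X : Matrix m m ℂ} (hX : X.det ≠ 0) (w : m → ℂ) :
    (X + vecMulVec w (star w)).det = X.det * (1 + star w ⬝ᵥ (X⁻¹ *ᵥ w)) := by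
  have h := det_add_replicateCol_mul_replicateRow (ι := Unit) (isUnit_iff_ne_zero.2 hX) w (star w)
  rw [← vecMulVec_eq] at h
  rw [h, det_unique (n := Unit)]
  simp [Matrix.mul_assoc, mul_apply, dotProduct, mulVec]

end LinearAlgebra

end KahlerGraph

end

noncomputable section

namespace KahlerGraph

open Matrix Metric Set Filter Topology

/-! ### Wirtinger calculus. -/

section Wirtinger

variable {n : ℕ}

/-- The holomorphic partial derivative `∂h/∂zⁱ`. -/
def pderiv {F : Type*} [NormedAddCommGroup F] [NormedSpace ℂ F] (i : Fin n)
    (h : EuclideanSpace ℂ (Fin n) → F) (z : EuclideanSpace ℂ (Fin n)) : F :=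
  fderiv ℂ h z (EuclideanSpace.single i 1)

theorem single_I (i : Fin n) :
    EuclideanSpace.single i Complex.I = Complex.I • EuclideanSpace.single i (1 : ℂ) := by
  ext j
  by_cases h : j = i <;> simp [h]

theorem differentiableOn_pderiv {F : Type*} [NormedAddCommGroup F] [NormedSpace ℂ F]
    [FiniteDimensional ℂ F] {h : EuclideanSpace ℂ (Fin n) → F}
    {U : Set (EuclideanSpace ℂ (Fin n))} (hU : IsOpen U) (hh : DifferentiableOn ℂ h U)
    (i : Fin n) : DifferentiableOn ℂ (pderiv i h) U :=
  differentiableOn_fderiv_apply hU hh _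

variable {u v : EuclideanSpace ℂ (Fin n) → ℂ} {z : EuclideanSpace ℂ (Fin n)}

theorem dz_congr (h : u =ᶠ[𝓝 z] v) (i : Fin n) : dz i u z = dz i v z := by
  simp only [dz, h.fderiv_eq]

theorem dzbar_congr (h : u =ᶠ[𝓝 z] v) (i : Fin n) : dzbar i u z = dzbar i v z := by
  simp only [dzbar, h.fderiv_eq]

theorem dz_mul (hu : DifferentiableAt ℝ u z) (hv : DifferentiableAt ℝ v z) (i : Fin n) :
    dz i (fun x => u x * v x) z = dz i u z * v z + u z * dz i v z := by
  simp only [dz, fderiv_fun_mul hu hv, _root_.add_apply,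
    _root_.smul_apply, smul_eq_mul]
  ring

theorem dzbar_mul (hu : DifferentiableAt ℝ u z) (hv : DifferentiableAt ℝ v z) (i : Fin n) :
    dzbar i (fun x => u x * v x) z = dzbar i u z * v z + u z * dzbar i v z := by
  simp only [dzbar, fderiv_fun_mul hu hv, _root_.add_apply,
    _root_.smul_apply, smul_eq_mul]
  ring

theorem dz_sum {ι : Type*} [Fintype ι] {u : ι → EuclideanSpace ℂ (Fin n) → ℂ}
    (hu : ∀ p, DifferentiableAt ℝ (u p) z) (i : Fin n) :
    dz i (fun x => ∑ p, u p x) z = ∑ p, dz i (u p) z := by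
  simp only [dz, fderiv_fun_sum fun p _ => hu p, _root_.sum_apply, Finset.mul_sum,
    ← Finset.sum_sub_distrib, Finset.sum_div]

theorem dzbar_sum {ι : Type*} [Fintype ι] {u : ι → EuclideanSpace ℂ (Fin n) → ℂ}
    (hu : ∀ p, DifferentiableAt ℝ (u p) z) (i : Fin n) :
    dzbar i (fun x => ∑ p, u p x) z = ∑ p, dzbar i (u p) z := by
  simp only [dzbar, fderiv_fun_sum fun p _ => hu p, _root_.sum_apply, Finset.mul_sum,
    ← Finset.sum_add_distrib, Finset.sum_div]

theorem dz_sub_const_mul (hu : DifferentiableAt ℝ u z) (hv : DifferentiableAt ℝ v z) (k : ℂ)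
    (i : Fin n) : dz i (fun x => u x - k * v x) z = dz i u z - k * dz i v z := by
  simp only [dz, fderiv_fun_sub hu (hv.const_mul k), fderiv_const_mul hv,
    _root_.sub_apply, _root_.smul_apply, smul_eq_mul]
  ring

theorem dzbar_sub_const_mul (hu : DifferentiableAt ℝ u z) (hv : DifferentiableAt ℝ v z) (c k : ℂ)
    (i : Fin n) : dzbar i (fun x => u x - c - k * v x) z = dzbar i u z - k * dzbar i v z := by
  simp only [dzbar, fderiv_fun_sub (hu.sub_const c) (hv.const_mul k), fderiv_const_mul hv,
    fderiv_sub_const, _root_.sub_apply, _root_.smul_apply, smul_eq_mul]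
  ring

theorem dz_div (hu : DifferentiableAt ℝ u z) (hv : DifferentiableAt ℝ v z) (h0 : v z ≠ 0)
    (i : Fin n) :
    dz i (fun x => u x / v x) z = dz i u z / v z - u z * dz i v z / v z ^ 2 := by
  have hq : DifferentiableAt ℝ (fun x => u x / v x) z := by
    simp only [div_eq_mul_inv]
    exact hu.mul (hv.inv h0)
  have hev : u =ᶠ[𝓝 z] fun x => u x / v x * v x := by
    filter_upwards [hv.continuousAt.eventually_ne h0] with x hx
    rw [div_mul_cancel₀ _ hx]
  have h := dz_mul hq hv i
  rw [← dz_congr hev] at h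
  rw [h]
  field_simp
  ring

theorem fderiv_real_apply {h : EuclideanSpace ℂ (Fin n) → ℂ} (hh : DifferentiableAt ℂ h z)
    (w : EuclideanSpace ℂ (Fin n)) : fderiv ℝ h z w = fderiv ℂ h z w := by
  rw [(hh.hasFDerivAt.restrictScalars ℝ).fderiv]
  rfl

theorem dz_of_differentiableAt {h : EuclideanSpace ℂ (Fin n) → ℂ} (hh : DifferentiableAt ℂ h z)
    (i : Fin n) : dz i h z = pderiv i h z := by
  simp only [dz, pderiv, fderiv_real_apply hh, single_I, map_smul, smul_eq_mul]
  linear_combination (-(1 / 2) * (fderiv ℂ h z) (EuclideanSpace.single i 1)) * Complex.I_mul_I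

theorem dzbar_of_differentiableAt {h : EuclideanSpace ℂ (Fin n) → ℂ}
    (hh : DifferentiableAt ℂ h z) (i : Fin n) : dzbar i h z = 0 := by
  simp only [dzbar, fderiv_real_apply hh, single_I, map_smul, smul_eq_mul]
  linear_combination ((1 / 2) * (fderiv ℂ h z) (EuclideanSpace.single i 1)) * Complex.I_mul_I

theorem differentiableAt_conj {h : EuclideanSpace ℂ (Fin n) → ℂ} (hh : DifferentiableAt ℂ h z) :
    DifferentiableAt ℝ (fun x => starRingEnd ℂ (h x)) z :=
  Complex.conjCLE.differentiableAt.comp z (hh.restrictScalars ℝ)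

theorem fderiv_conj_apply {h : EuclideanSpace ℂ (Fin n) → ℂ} (hh : DifferentiableAt ℂ h z)
    (w : EuclideanSpace ℂ (Fin n)) :
    fderiv ℝ (fun x => starRingEnd ℂ (h x)) z w = starRingEnd ℂ (fderiv ℂ h z w) := by
  have := (Complex.conjCLE.toContinuousLinearMap.hasFDerivAt (x := h z)).comp z
    (hh.hasFDerivAt.restrictScalars ℝ)
  rw [show (fun x => starRingEnd ℂ (h x)) = ⇑(Complex.conjCLE.toContinuousLinearMap) ∘ h from rfl,
    this.fderiv]
  rfl

theorem dz_conj {h : EuclideanSpace ℂ (Fin n) → ℂ} (hh : DifferentiableAt ℂ h z)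
    (i : Fin n) : dz i (fun x => starRingEnd ℂ (h x)) z = 0 := by
  simp only [dz, fderiv_conj_apply hh, single_I, map_smul, smul_eq_mul, map_mul, Complex.conj_I]
  linear_combination ((1 / 2) * starRingEnd ℂ ((fderiv ℂ h z) (EuclideanSpace.single i 1))) *
    Complex.I_mul_I

theorem dzbar_conj {h : EuclideanSpace ℂ (Fin n) → ℂ} (hh : DifferentiableAt ℂ h z)
    (i : Fin n) : dzbar i (fun x => starRingEnd ℂ (h x)) z = starRingEnd ℂ (pderiv i h z) := by
  simp only [dzbar, pderiv, fderiv_conj_apply hh, single_I, map_smul, smul_eq_mul, map_mul,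
    Complex.conj_I]
  linear_combination (-(1 / 2) * starRingEnd ℂ ((fderiv ℂ h z) (EuclideanSpace.single i 1))) *
    Complex.I_mul_I

end Wirtinger

/-! ### The complex Hessian of the logarithm of a sum of squares. -/

section LogNormSq

variable {n : ℕ} {ι : Type*} [Fintype ι] {H : ι → EuclideanSpace ℂ (Fin n) → ℂ}
  {z : EuclideanSpace ℂ (Fin n)} {U : Set (EuclideanSpace ℂ (Fin n))}

theorem ofReal_sum_norm_sq (a : ι → ℂ) :
    ((∑ p, ‖a p‖ ^ 2 : ℝ) : ℂ) = ∑ p, a p * starRingEnd ℂ (a p) := by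
  push_cast
  exact Finset.sum_congr rfl fun p _ => (Complex.mul_conj' _).symm

theorem differentiableAt_sum_mul_conj {G : ι → EuclideanSpace ℂ (Fin n) → ℂ}
    (hH : ∀ p, DifferentiableAt ℂ (H p) z) (hG : ∀ p, DifferentiableAt ℂ (G p) z) :
    DifferentiableAt ℝ (fun x => ∑ p, H p x * starRingEnd ℂ (G p x)) z :=
  DifferentiableAt.fun_sum fun p _ =>
    ((hH p).restrictScalars ℝ).mul (differentiableAt_conj (hG p))

theorem dz_sum_mul_conj {G : ι → EuclideanSpace ℂ (Fin n) → ℂ}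
    (hH : ∀ p, DifferentiableAt ℂ (H p) z) (hG : ∀ p, DifferentiableAt ℂ (G p) z) (i : Fin n) :
    dz i (fun x => ∑ p, H p x * starRingEnd ℂ (G p x)) z =
      ∑ p, pderiv i (H p) z * starRingEnd ℂ (G p z) := by
  rw [dz_sum fun p => ((hH p).restrictScalars ℝ).fun_mul (differentiableAt_conj (hG p))]
  refine Finset.sum_congr rfl fun p _ => ?_
  rw [dz_mul ((hH p).restrictScalars ℝ) (differentiableAt_conj (hG p)), dz_conj (hG p),
    dz_of_differentiableAt (hH p), mul_zero, add_zero]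

theorem dzbar_sum_mul_conj {G : ι → EuclideanSpace ℂ (Fin n) → ℂ}
    (hH : ∀ p, DifferentiableAt ℂ (H p) z) (hG : ∀ p, DifferentiableAt ℂ (G p) z) (i : Fin n) :
    dzbar i (fun x => ∑ p, H p x * starRingEnd ℂ (G p x)) z =
      ∑ p, H p z * starRingEnd ℂ (pderiv i (G p) z) := by
  rw [dzbar_sum fun p => ((hH p).restrictScalars ℝ).fun_mul (differentiableAt_conj (hG p))]
  refine Finset.sum_congr rfl fun p _ => ?_
  rw [dzbar_mul ((hH p).restrictScalars ℝ) (differentiableAt_conj (hG p)), dzbar_conj (hG p),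
    dzbar_of_differentiableAt (hH p), zero_mul, zero_add]

theorem differentiableAt_sum_norm_sq (hH : ∀ p, DifferentiableAt ℂ (H p) z) :
    DifferentiableAt ℝ (fun x => ∑ p, ‖H p x‖ ^ 2) z :=
  DifferentiableAt.fun_sum fun p _ => ((hH p).restrictScalars ℝ).norm_sq ℂ

theorem differentiableAt_log_sum (hH : ∀ p, DifferentiableAt ℂ (H p) z)
    (h0 : 0 < ∑ p, ‖H p z‖ ^ 2) :
    DifferentiableAt ℝ (fun x => ((Real.log (∑ p, ‖H p x‖ ^ 2) : ℝ) : ℂ)) z :=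
  Complex.ofRealCLM.differentiableAt.comp z
    ((differentiableAt_sum_norm_sq hH).log h0.ne')

theorem dzbar_log_sum (hH : ∀ p, DifferentiableAt ℂ (H p) z)
    (h0 : 0 < ∑ p, ‖H p z‖ ^ 2) (i : Fin n) :
    dzbar i (fun x => ((Real.log (∑ p, ‖H p x‖ ^ 2) : ℝ) : ℂ)) z =
      (∑ p, H p z * starRingEnd ℂ (pderiv i (H p) z)) /
        ∑ p, H p z * starRingEnd ℂ (H p z) := by
  have hN := (differentiableAt_sum_norm_sq hH).hasFDerivAt
  have h1 := Complex.ofRealCLM.hasFDerivAt.comp z hN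
  have h2 := Complex.ofRealCLM.hasFDerivAt.comp z (hN.log h0.ne')
  rw [← dzbar_sum_mul_conj hH hH i, ← ofReal_sum_norm_sq]
  have e : (fun x => ∑ p, H p x * starRingEnd ℂ (H p x)) =
      ⇑Complex.ofRealCLM ∘ fun x => ∑ p, ‖H p x‖ ^ 2 := by
    funext x
    exact (ofReal_sum_norm_sq _).symm
  rw [e]
  have e2 : (fun x => ((Real.log (∑ p, ‖H p x‖ ^ 2) : ℝ) : ℂ)) =
      ⇑Complex.ofRealCLM ∘ fun x => Real.log (∑ p, ‖H p x‖ ^ 2) := rfl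
  rw [e2]
  simp only [dzbar, h1.fderiv, h2.fderiv, ContinuousLinearMap.comp_apply,
    _root_.smul_apply, Complex.ofRealCLM_apply, smul_eq_mul]
  push_cast
  ring

theorem dzbar_log_sum_eventuallyEq (hU : IsOpen U) (hH : ∀ p, DifferentiableOn ℂ (H p) U)
    (h0 : ∀ x ∈ U, 0 < ∑ p, ‖H p x‖ ^ 2) (hz : z ∈ U) (i : Fin n) :
    dzbar i (fun x => ((Real.log (∑ p, ‖H p x‖ ^ 2) : ℝ) : ℂ)) =ᶠ[𝓝 z]
      fun x => (∑ p, H p x * starRingEnd ℂ (pderiv i (H p) x)) /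
        ∑ p, H p x * starRingEnd ℂ (H p x) := by
  filter_upwards [hU.mem_nhds hz] with x hx
  exact dzbar_log_sum (fun p => (hH p).differentiableAt (hU.mem_nhds hx)) (h0 x hx) i

theorem differentiableAt_dzbar_log_sum (hU : IsOpen U) (hH : ∀ p, DifferentiableOn ℂ (H p) U)
    (h0 : ∀ x ∈ U, 0 < ∑ p, ‖H p x‖ ^ 2) (hz : z ∈ U) (i : Fin n) :
    DifferentiableAt ℝ (dzbar i (fun x => ((Real.log (∑ p, ‖H p x‖ ^ 2) : ℝ) : ℂ))) z := by
  rw [(dzbar_log_sum_eventuallyEq hU hH h0 hz i).differentiableAt_iff]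
  have hd := fun p => (hH p).differentiableAt (hU.mem_nhds hz)
  have hpd := fun p => (differentiableOn_pderiv hU (hH p) i).differentiableAt (hU.mem_nhds hz)
  simp only [div_eq_mul_inv]
  refine (differentiableAt_sum_mul_conj hd hpd).mul ((differentiableAt_sum_mul_conj hd hd).inv ?_)
  rw [← ofReal_sum_norm_sq]
  exact_mod_cast (h0 z hz).ne'

theorem complexHessian_log_sum (hU : IsOpen U) (hH : ∀ p, DifferentiableOn ℂ (H p) U)
    (h0 : ∀ x ∈ U, 0 < ∑ p, ‖H p x‖ ^ 2) (hz : z ∈ U) (i j : Fin n) :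
    complexHessian (fun x => ((Real.log (∑ p, ‖H p x‖ ^ 2) : ℝ) : ℂ)) z i j =
      (∑ p, pderiv i (H p) z * starRingEnd ℂ (pderiv j (H p) z)) /
        (∑ p, H p z * starRingEnd ℂ (H p z)) -
      (∑ p, H p z * starRingEnd ℂ (pderiv j (H p) z)) *
        (∑ p, pderiv i (H p) z * starRingEnd ℂ (H p z)) /
        (∑ p, H p z * starRingEnd ℂ (H p z)) ^ 2 := by
  have hd := fun p => (hH p).differentiableAt (hU.mem_nhds hz)
  have hpd := fun p => (differentiableOn_pderiv hU (hH p) j).differentiableAt (hU.mem_nhds hz)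
  simp only [complexHessian, of_apply]
  rw [dz_congr (dzbar_log_sum_eventuallyEq hU hH h0 hz j), dz_div
    (differentiableAt_sum_mul_conj hd hpd) (differentiableAt_sum_mul_conj hd hd) ?_,
    dz_sum_mul_conj hd hpd, dz_sum_mul_conj hd hd]
  rw [← ofReal_sum_norm_sq]
  exact_mod_cast (h0 z hz).ne'

/-- The sum of squares form of the complex Hessian of `log ∑ |Hₚ|²`, from Lagrange's identity. -/
theorem complexHessian_log_sum_eq_sum_sq (hU : IsOpen U) (hH : ∀ p, DifferentiableOn ℂ (H p) U)
    (h0 : ∀ x ∈ U, 0 < ∑ p, ‖H p x‖ ^ 2) (hz : z ∈ U) :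
    complexHessian (fun x => ((Real.log (∑ p, ‖H p x‖ ^ 2) : ℝ) : ℂ)) z =
      (2 * ((∑ p, ‖H p z‖ ^ 2 : ℝ) : ℂ) ^ 2)⁻¹ • ∑ p, ∑ q,
        vecMulVec (fun i => H p z * pderiv i (H q) z - H q z * pderiv i (H p) z)
          (star fun i => H p z * pderiv i (H q) z - H q z * pderiv i (H p) z) := by
  ext i j
  rw [complexHessian_log_sum hU hH h0 hz, ofReal_sum_norm_sq]
  have hT : (∑ p, H p z * starRingEnd ℂ (H p z)) ≠ 0 := by
    rw [← ofReal_sum_norm_sq]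
    exact_mod_cast (h0 z hz).ne'
  simp only [Matrix.smul_apply, Matrix.sum_apply, vecMulVec_apply, Pi.star_apply, smul_eq_mul,
    RCLike.star_def, map_sub, map_mul]
  -- Lagrange's identity, polarized in the directions `i` and `j`. The factor `2` arises because
  -- ordered pairs `(p, q)` are summed.
  have key : ∑ p, ∑ q, (H p z * pderiv i (H q) z - H q z * pderiv i (H p) z) *
      (starRingEnd ℂ (H p z) * starRingEnd ℂ (pderiv j (H q) z) -
        starRingEnd ℂ (H q z) * starRingEnd ℂ (pderiv j (H p) z)) =
      2 * ((∑ p, H p z * starRingEnd ℂ (H p z)) *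
          (∑ p, pderiv i (H p) z * starRingEnd ℂ (pderiv j (H p) z)) -
        (∑ p, H p z * starRingEnd ℂ (pderiv j (H p) z)) *
        (∑ p, pderiv i (H p) z * starRingEnd ℂ (H p z))) := by
    have expand : ∀ p q, (H p z * pderiv i (H q) z - H q z * pderiv i (H p) z) *
      (starRingEnd ℂ (H p z) * starRingEnd ℂ (pderiv j (H q) z) -
        starRingEnd ℂ (H q z) * starRingEnd ℂ (pderiv j (H p) z)) =
        (H p z * starRingEnd ℂ (H p z)) * (pderiv i (H q) z * starRingEnd ℂ (pderiv j (H q) z)) +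
        (pderiv i (H p) z * starRingEnd ℂ (pderiv j (H p) z)) * (H q z * starRingEnd ℂ (H q z)) -
        (H p z * starRingEnd ℂ (pderiv j (H p) z)) * (pderiv i (H q) z * starRingEnd ℂ (H q z)) -
        (pderiv i (H p) z * starRingEnd ℂ (H p z)) *
          (H q z * starRingEnd ℂ (pderiv j (H q) z)) := fun p q => by ring
    simp only [expand, Finset.sum_sub_distrib, Finset.sum_add_distrib, ← Finset.sum_mul_sum]
    ring
  rw [key]
  field_simp

end LogNormSq

end KahlerGraph

end

noncomputable section

namespace KahlerGraph

open Matrix Metric Set Filter Topology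

/-! ### Plücker coordinates of the Gauss map, and the determinant and inverse of the metric. -/

section Graph

variable {n k : ℕ}

/-- The coordinates of `(1, z, f(z))`, indexed by a sum type. -/
def graphCoord (f : EuclideanSpace ℂ (Fin n) → EuclideanSpace ℂ (Fin k))
    (α : (Unit ⊕ Fin n) ⊕ Fin k) (z : EuclideanSpace ℂ (Fin n)) : ℂ :=
  Sum.elim (Sum.elim (fun _ => 1) (fun j => z j)) (fun a => f z a) α

/-- The matrix with rows `F = (1, z, f)` and `∂F/∂zⁱ`. -/
def frameMatrix (f : EuclideanSpace ℂ (Fin n) → EuclideanSpace ℂ (Fin k))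
    (z : EuclideanSpace ℂ (Fin n)) : Matrix (Unit ⊕ Fin n) ((Unit ⊕ Fin n) ⊕ Fin k) ℂ :=
  of fun i α => Sum.elim (fun _ => graphCoord f α z) (fun l => pderiv l (graphCoord f α) z) i

/-- The matrix with rows `f - ∑ zʲ ∂f/∂zʲ` and `∂f/∂zⁱ`. -/
def jetMatrix (f : EuclideanSpace ℂ (Fin n) → EuclideanSpace ℂ (Fin k))
    (z : EuclideanSpace ℂ (Fin n)) : Matrix (Unit ⊕ Fin n) (Fin k) ℂ :=
  of fun i a => Sum.elim (fun _ => f z a - ∑ j, z j * pderiv j f z a) (fun l => pderiv l f z a) i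

/-- The unipotent matrix with first row `(1, z)`. -/
def shearMatrix (z : EuclideanSpace ℂ (Fin n)) : Matrix (Unit ⊕ Fin n) (Unit ⊕ Fin n) ℂ :=
  fromBlocks 1 (of fun _ j => z j) 0 1

/-- The preimage of `(0, w)` under `shearMatrix z`. -/
def shearVec (z : EuclideanSpace ℂ (Fin n)) (w : Fin n → ℂ) : Unit ⊕ Fin n → ℂ :=
  Sum.elim (fun _ => -∑ j, z j * w j) w

/-- The maximal minors of `(1 | jetMatrix f)`: the Plücker coordinates of the Gauss map. -/
def plucker (f : EuclideanSpace ℂ (Fin n) → EuclideanSpace ℂ (Fin k))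
    (p : Unit ⊕ Fin n → (Unit ⊕ Fin n) ⊕ Fin k) (z : EuclideanSpace ℂ (Fin n)) : ℂ :=
  ((fromCols 1 (jetMatrix f z)).submatrix id p).det

/-- The components `Gₚ ∂G_q/∂zⁱ - G_q ∂Gₚ/∂zⁱ` of `G ∧ ∂G/∂zⁱ`. -/
def pluckerWedge (f : EuclideanSpace ℂ (Fin n) → EuclideanSpace ℂ (Fin k))
    (p q : Unit ⊕ Fin n → (Unit ⊕ Fin n) ⊕ Fin k) (z : EuclideanSpace ℂ (Fin n)) : Fin n → ℂ :=
  fun i => plucker f p z * pderiv i (plucker f q) z - plucker f q z * pderiv i (plucker f p) z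

/-- The matrix `(1 | jetMatrix f)` augmented by a column. -/
def augmented (f : EuclideanSpace ℂ (Fin n) → EuclideanSpace ℂ (Fin k))
    (w : Fin n → ℂ) (z : EuclideanSpace ℂ (Fin n)) :
    Matrix (Unit ⊕ Fin n) (((Unit ⊕ Fin n) ⊕ Fin k) ⊕ Unit) ℂ :=
  fromCols (fromCols 1 (jetMatrix f z)) (replicateCol Unit (shearVec z w))

/-- The maximal minors of the augmented matrix which involve the last column. -/
def augMinor (f : EuclideanSpace ℂ (Fin n) → EuclideanSpace ℂ (Fin k))
    (c : Unit ⊕ Fin n → ((Unit ⊕ Fin n) ⊕ Fin k) ⊕ Unit) (w : Fin n → ℂ)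
    (z : EuclideanSpace ℂ (Fin n)) : ℂ :=
  if ∃ x, c x = Sum.inr () then ((augmented f w z).submatrix id c).det else 0

/-- `|F|²` for `F = (1, z, f)`. -/
def graphNormSq (f : EuclideanSpace ℂ (Fin n) → EuclideanSpace ℂ (Fin k))
    (z : EuclideanSpace ℂ (Fin n)) : ℝ := ∑ α, ‖graphCoord f α z‖ ^ 2

/-- The squared norm of the vector of Plücker coordinates. -/
def pluckerNormSq (f : EuclideanSpace ℂ (Fin n) → EuclideanSpace ℂ (Fin k))
    (z : EuclideanSpace ℂ (Fin n)) : ℝ := ∑ p, ‖plucker f p z‖ ^ 2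

variable {f : EuclideanSpace ℂ (Fin n) → EuclideanSpace ℂ (Fin k)}
  {U : Set (EuclideanSpace ℂ (Fin n))} {z : EuclideanSpace ℂ (Fin n)}

theorem graphNormSq_eq (f : EuclideanSpace ℂ (Fin n) → EuclideanSpace ℂ (Fin k))
    (z : EuclideanSpace ℂ (Fin n)) : graphNormSq f z = 1 + ‖z‖ ^ 2 + ‖f z‖ ^ 2 := by
  simp [graphNormSq, graphCoord, Fintype.sum_sum_type, EuclideanSpace.norm_sq_eq]

theorem one_le_graphNormSq (f : EuclideanSpace ℂ (Fin n) → EuclideanSpace ℂ (Fin k))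
    (z : EuclideanSpace ℂ (Fin n)) : 1 ≤ graphNormSq f z := by
  rw [graphNormSq_eq]
  nlinarith [sq_nonneg ‖z‖, sq_nonneg ‖f z‖]

theorem plucker_inl (f : EuclideanSpace ℂ (Fin n) → EuclideanSpace ℂ (Fin k))
    (z : EuclideanSpace ℂ (Fin n)) : plucker f Sum.inl z = 1 := by
  have : (fromCols (1 : Matrix (Unit ⊕ Fin n) (Unit ⊕ Fin n) ℂ) (jetMatrix f z)).submatrix id
      Sum.inl = 1 := by
    ext i j
    simp
  rw [plucker, this, det_one]

theorem one_le_pluckerNormSq (f : EuclideanSpace ℂ (Fin n) → EuclideanSpace ℂ (Fin k))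
    (z : EuclideanSpace ℂ (Fin n)) : 1 ≤ pluckerNormSq f z := by
  have h := Finset.single_le_sum (f := fun p => ‖plucker f p z‖ ^ 2)
    (fun p _ => sq_nonneg _) (Finset.mem_univ Sum.inl)
  simpa [plucker_inl, pluckerNormSq] using h

theorem hasFDerivAt_coord (hf : DifferentiableAt ℂ f z) (a : Fin k) :
    HasFDerivAt (fun x => f x a) ((EuclideanSpace.proj (𝕜 := ℂ) a).comp (fderiv ℂ f z)) z :=
  (EuclideanSpace.proj (𝕜 := ℂ) a).hasFDerivAt.comp z hf.hasFDerivAt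

theorem differentiableAt_graphCoord (hf : DifferentiableAt ℂ f z) (α) :
    DifferentiableAt ℂ (graphCoord f α) z := by
  rcases α with (u | j) | a
  · exact differentiableAt_const _
  · exact (EuclideanSpace.proj (𝕜 := ℂ) j).differentiableAt
  · exact (hasFDerivAt_coord hf a).differentiableAt

theorem differentiableOn_graphCoord (hf : DifferentiableOn ℂ f U) (hU : IsOpen U) (α) :
    DifferentiableOn ℂ (graphCoord f α) U := fun _ hz =>
  (differentiableAt_graphCoord (hf.differentiableAt (hU.mem_nhds hz)) α).differentiableWithinAt

theorem pderiv_graphCoord (hf : DifferentiableAt ℂ f z) (l : Fin n) (α) :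
    pderiv l (graphCoord f α) z = Sum.elim (Sum.elim (fun _ => 0) (fun j => if l = j then 1 else 0))
      (fun a => pderiv l f z a) α := by
  rcases α with (u | j) | a
  · exact congrArg (fun L => L (EuclideanSpace.single l (1 : ℂ)))
      (fderiv_const_apply (𝕜 := ℂ) (1 : ℂ) (x := z))
  · have : fderiv ℂ (graphCoord f (Sum.inl (Sum.inr j))) z = EuclideanSpace.proj (𝕜 := ℂ) j :=
      (EuclideanSpace.proj (𝕜 := ℂ) j).fderiv
    simp [pderiv, this, eq_comm]
  · have : fderiv ℂ (graphCoord f (Sum.inr a)) z = _ := (hasFDerivAt_coord hf a).fderiv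
    simp only [pderiv, this]
    rfl

/-- Row reduction: subtracting `∑ zʲ ∂F/∂zʲ` from the row `F` leaves an identity block. The shear
has determinant one, so the minors of `(1 | jetMatrix f)` are those of the frame. -/
theorem frameMatrix_eq (hf : DifferentiableAt ℂ f z) :
    frameMatrix f z = shearMatrix z * fromCols 1 (jetMatrix f z) := by
  have h1 : shearMatrix z * fromCols 1 (jetMatrix f z) =
      fromCols (shearMatrix z) (shearMatrix z * jetMatrix f z) := by
    rw [mul_fromCols, Matrix.mul_one]
  rw [h1]
  ext i α
  rcases i with u | l
  · rcases α with (v | j) | a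
    · simp [frameMatrix, graphCoord, shearMatrix]
    · simp [frameMatrix, graphCoord, shearMatrix]
    · simp [frameMatrix, graphCoord, shearMatrix, mul_apply, jetMatrix, Fintype.sum_sum_type]
  · simp only [frameMatrix, of_apply, Sum.elim_inr, pderiv_graphCoord hf]
    rcases α with (v | j) | a
    · simp [shearMatrix]
    · simp [shearMatrix, one_apply]
    · simp [shearMatrix, mul_apply, jetMatrix, Fintype.sum_sum_type, one_apply]

theorem det_shearMatrix (z : EuclideanSpace ℂ (Fin n)) : (shearMatrix z).det = 1 := by
  simp [shearMatrix]

theorem shearMatrix_mulVec_shearVec (z : EuclideanSpace ℂ (Fin n)) (w : Fin n → ℂ) :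
    shearMatrix z *ᵥ shearVec z w = Sum.elim (fun _ => 0) w := by
  funext i
  rcases i with u | l
  · simp [shearMatrix, shearVec, mulVec, dotProduct, Fintype.sum_sum_type]
  · simp [shearMatrix, shearVec, mulVec, dotProduct, Fintype.sum_sum_type, one_apply]

theorem frameMatrix_gram_inl (f : EuclideanSpace ℂ (Fin n) → EuclideanSpace ℂ (Fin k))
    (z : EuclideanSpace ℂ (Fin n)) (u v : Unit) :
    (frameMatrix f z * (frameMatrix f z)ᴴ) (Sum.inl u) (Sum.inl v) = (graphNormSq f z : ℂ) := by
  rw [graphNormSq, ofReal_sum_norm_sq]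
  simp [frameMatrix, mul_apply]

theorem graphMetric_eq (f : EuclideanSpace ℂ (Fin n) → EuclideanSpace ℂ (Fin k))
    (z : EuclideanSpace ℂ (Fin n)) : graphMetric f z =
      complexHessian (fun x => ((Real.log (∑ α, ‖graphCoord f α x‖ ^ 2) : ℝ) : ℂ)) z := by
  have h : ∀ x, ∑ α, ‖graphCoord f α x‖ ^ 2 = 1 + ‖x‖ ^ 2 + ‖f x‖ ^ 2 := graphNormSq_eq f
  simp only [h]
  rfl

theorem sum_graphCoord_pos (f : EuclideanSpace ℂ (Fin n) → EuclideanSpace ℂ (Fin k))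
    (z : EuclideanSpace ℂ (Fin n)) : 0 < ∑ α, ‖graphCoord f α z‖ ^ 2 :=
  zero_lt_one.trans_le (one_le_graphNormSq f z)

theorem graphMetric_apply (hU : IsOpen U) (hf : DifferentiableOn ℂ f U) (hz : z ∈ U)
    (i j : Fin n) :
    graphMetric f z i j =
      (frameMatrix f z * (frameMatrix f z)ᴴ) (Sum.inr i) (Sum.inr j) / (graphNormSq f z : ℂ) -
      (frameMatrix f z * (frameMatrix f z)ᴴ) (Sum.inl ()) (Sum.inr j) *
      (frameMatrix f z * (frameMatrix f z)ᴴ) (Sum.inr i) (Sum.inl ()) /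
        (graphNormSq f z : ℂ) ^ 2 := by
  rw [graphMetric_eq, complexHessian_log_sum hU (differentiableOn_graphCoord hf hU)
    (fun x _ => sum_graphCoord_pos f x) hz, graphNormSq, ofReal_sum_norm_sq]
  simp [frameMatrix, mul_apply]

/-- The metric is, up to a factor, the Schur complement of `|F|²` in the Gram matrix. -/
theorem det_gram_add (hU : IsOpen U) (hf : DifferentiableOn ℂ f U) (hz : z ∈ U)
    (X : Matrix (Fin n) (Fin n) ℂ) :
    (frameMatrix f z * (frameMatrix f z)ᴴ + fromBlocks 0 0 0 X).det =
      graphNormSq f z * ((graphNormSq f z : ℂ) • graphMetric f z + X).det := by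
  have hN : (graphNormSq f z : ℂ) ≠ 0 := by
    exact_mod_cast (zero_lt_one.trans_le (one_le_graphNormSq f z)).ne'
  set M := frameMatrix f z * (frameMatrix f z)ᴴ with hM
  have hA : M.toBlocks₁₁ = (graphNormSq f z : ℂ) • (1 : Matrix Unit Unit ℂ) := by
    ext u v
    simp [toBlocks₁₁, hM, frameMatrix_gram_inl]
  -- An explicit inverse, so that the Schur complement formula yields the entries of `|F|² g`
  -- directly.
  let inv : Invertible M.toBlocks₁₁ := ⟨(graphNormSq f z : ℂ)⁻¹ • 1, by
    rw [hA, smul_mul_smul_comm, inv_mul_cancel₀ hN, one_smul, Matrix.one_mul], by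
    rw [hA, smul_mul_smul_comm, mul_inv_cancel₀ hN, one_smul, Matrix.one_mul]⟩
  have hsum : M + fromBlocks 0 0 0 X =
      fromBlocks M.toBlocks₁₁ M.toBlocks₁₂ M.toBlocks₂₁ (M.toBlocks₂₂ + X) := by
    conv_lhs => rw [← fromBlocks_toBlocks M]
    rw [fromBlocks_add]
    simp
  rw [hsum, det_fromBlocks₁₁]
  have hinv : ⅟M.toBlocks₁₁ = (graphNormSq f z : ℂ)⁻¹ • 1 := rfl
  rw [hinv]
  congr 1
  · rw [hA]
    simp
  · congr 1
    ext i j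
    simp only [Matrix.sub_apply, Matrix.add_apply, Matrix.smul_apply, Matrix.mul_smul,
      Matrix.mul_one, Matrix.smul_mul, smul_eq_mul, graphMetric_apply hU hf hz, ← hM]
    simp only [toBlocks₂₂, toBlocks₂₁, toBlocks₁₂, of_apply, mul_apply, Fintype.univ_punit,
      Finset.sum_singleton]
    field_simp
    ring

/-- The maximal minors split according to whether they use the added column; those that do not are
Plücker coordinates. -/
theorem sum_norm_sq_augmented (f : EuclideanSpace ℂ (Fin n) → EuclideanSpace ℂ (Fin k))
    (w : Fin n → ℂ) (z : EuclideanSpace ℂ (Fin n)) :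
    ∑ c, ‖((augmented f w z).submatrix id c).det‖ ^ 2 =
      pluckerNormSq f z + ∑ c, ‖augMinor f c w z‖ ^ 2 := by
  have h : ∀ c, ‖((augmented f w z).submatrix id c).det‖ ^ 2 =
      (if ∃ x, c x = Sum.inr () then 0 else ‖((augmented f w z).submatrix id c).det‖ ^ 2) +
        ‖augMinor f c w z‖ ^ 2 := by
    intro c
    rw [augMinor]
    split_ifs <;> simp
  rw [Finset.sum_congr rfl fun c _ => h c, Finset.sum_add_distrib, pluckerNormSq]
  congr 1
  symm
  refine Fintype.sum_of_injective (fun p => Sum.inl ∘ p)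
    (fun p q hpq => funext fun x => Sum.inl_injective (congrFun hpq x)) _ _ ?_ ?_
  · intro c hc
    rw [if_pos]
    by_contra! hne
    refine hc ?_
    have : ∀ x, ∃ y, Sum.inl y = c x := by
      intro x
      rcases hcx : c x with y | u
      · exact ⟨y, rfl⟩
      · exact absurd hcx (hne x)
    choose p hp using this
    exact ⟨p, funext hp⟩
  · intro p
    rw [if_neg (by simp), plucker]
    rfl

theorem factorial_mul_det_gram_add (hf : DifferentiableAt ℂ f z) (w : Fin n → ℂ) :
    ((n + 1).factorial : ℂ) * (frameMatrix f z * (frameMatrix f z)ᴴ +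
      fromBlocks 0 0 0 (vecMulVec w (star w))).det =
      ((pluckerNormSq f z + ∑ c, ‖augMinor f c w z‖ ^ 2 : ℝ) : ℂ) := by
  have hcard : Fintype.card (Unit ⊕ Fin n) = n + 1 := by simp [add_comm]
  -- The added block is the outer square of `(0, w)`, the image of `shearVec z w` under the shear.
  -- It therefore acts as one more column of the row-reduced matrix.
  have hblocks : fromBlocks 0 0 0 (vecMulVec w (star w)) =
      vecMulVec (shearMatrix z *ᵥ shearVec z w) (star (shearMatrix z *ᵥ shearVec z w)) := by
    rw [shearMatrix_mulVec_shearVec]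
    ext i j
    rcases i with i | i <;> rcases j with j | j <;> simp [vecMulVec_apply]
  have hfac : frameMatrix f z * (frameMatrix f z)ᴴ + fromBlocks 0 0 0 (vecMulVec w (star w)) =
      shearMatrix z * (augmented f w z * (augmented f w z)ᴴ) * (shearMatrix z)ᴴ := by
    rw [hblocks, frameMatrix_eq hf, augmented, conjTranspose_fromCols_eq_fromRows_conjTranspose,
      fromCols_mul_fromRows, Matrix.mul_add, Matrix.add_mul, conjTranspose_mul]
    congr 1
    · simp only [Matrix.mul_assoc]
    · rw [vecMulVec_eq Unit, replicateCol_mulVec, Matrix.mul_assoc, Matrix.mul_assoc,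
        Matrix.mul_assoc, ← conjTranspose_mul, ← replicateCol_mulVec]
      rfl
  rw [hfac, det_mul, det_mul, det_conjTranspose, det_shearMatrix, star_one, mul_one, one_mul,
    ← hcard, card_factorial_mul_det_mul_conjTranspose, sum_norm_sq_augmented]

theorem augMinor_zero (f : EuclideanSpace ℂ (Fin n) → EuclideanSpace ℂ (Fin k))
    (c : Unit ⊕ Fin n → ((Unit ⊕ Fin n) ⊕ Fin k) ⊕ Unit)
    (z : EuclideanSpace ℂ (Fin n)) : augMinor f c 0 z = 0 := by
  rw [augMinor]
  split_ifs with h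
  · obtain ⟨x, hx⟩ := h
    refine det_eq_zero_of_column_eq_zero x fun i => ?_
    rcases i with i | i <;> simp [augmented, hx, shearVec]
  · rfl

theorem factorial_mul_det_gram (hf : DifferentiableAt ℂ f z) :
    ((n + 1).factorial : ℂ) * (frameMatrix f z * (frameMatrix f z)ᴴ).det =
      (pluckerNormSq f z : ℂ) := by
  have h := factorial_mul_det_gram_add hf 0
  simpa [augMinor_zero] using h

/-- The Gram determinant is computed twice: by the Schur complement, and by Cauchy-Binet, whose sum
over functions accounts for the factorial. -/
theorem det_graphMetric (hU : IsOpen U) (hf : DifferentiableOn ℂ f U) (hz : z ∈ U) :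
    (graphMetric f z).det =
      ((pluckerNormSq f z / ((n + 1).factorial * graphNormSq f z ^ (n + 1)) : ℝ) : ℂ) := by
  have h1 := factorial_mul_det_gram (hf.differentiableAt (hU.mem_nhds hz))
  have h2 := det_gram_add hU hf hz 0
  rw [fromBlocks_zero, add_zero, add_zero, det_smul, Fintype.card_fin] at h2
  have hN : (graphNormSq f z : ℂ) ≠ 0 := by
    exact_mod_cast (zero_lt_one.trans_le (one_le_graphNormSq f z)).ne'
  have hfac : ((n + 1).factorial : ℂ) ≠ 0 := by exact_mod_cast Nat.factorial_ne_zero _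
  push_cast
  rw [← h1, h2]
  field_simp
  ring

theorem det_graphMetric_ne_zero (hU : IsOpen U) (hf : DifferentiableOn ℂ f U) (hz : z ∈ U) :
    (graphMetric f z).det ≠ 0 := by
  rw [det_graphMetric hU hf hz]
  have h1 := zero_lt_one.trans_le (one_le_graphNormSq f z)
  have h2 := zero_lt_one.trans_le (one_le_pluckerNormSq f z)
  have : 0 < pluckerNormSq f z / ((n + 1).factorial * graphNormSq f z ^ (n + 1)) := by positivity
  exact_mod_cast this.ne'

/-- Perturb the Gram matrix by `w w*`. The matrix determinant lemma makes `w* g⁻¹ w` the relative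
change of the determinant, and Cauchy-Binet makes that change the sum over minors using the new
column. This replaces `g⁻¹` by squared moduli of polynomial expressions in the first jet and `w`. -/
theorem star_dotProduct_inv_graphMetric_mulVec (hU : IsOpen U) (hf : DifferentiableOn ℂ f U)
    (hz : z ∈ U) (w : Fin n → ℂ) :
    star w ⬝ᵥ ((graphMetric f z)⁻¹ *ᵥ w) =
      ((graphNormSq f z * (∑ c, ‖augMinor f c w z‖ ^ 2) / pluckerNormSq f z : ℝ) : ℂ) := by
  have hfz := hf.differentiableAt (hU.mem_nhds hz)
  have hN : (graphNormSq f z : ℂ) ≠ 0 := by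
    exact_mod_cast (zero_lt_one.trans_le (one_le_graphNormSq f z)).ne'
  have hT : (pluckerNormSq f z : ℂ) ≠ 0 := by
    exact_mod_cast (zero_lt_one.trans_le (one_le_pluckerNormSq f z)).ne'
  have hg := det_graphMetric_ne_zero hU hf hz
  have hNg : ((graphNormSq f z : ℂ) • graphMetric f z).det ≠ 0 := by
    rw [det_smul]
    exact mul_ne_zero (pow_ne_zero _ hN) hg
  have h1 := factorial_mul_det_gram_add hfz w
  have h0 := factorial_mul_det_gram hfz
  have h2 := det_gram_add hU hf hz 0
  rw [fromBlocks_zero, add_zero, add_zero] at h2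
  have hinv : ((graphNormSq f z : ℂ) • graphMetric f z)⁻¹ =
      (graphNormSq f z : ℂ)⁻¹ • (graphMetric f z)⁻¹ := by
    refine inv_eq_left_inv ?_
    rw [smul_mul_smul_comm, inv_mul_cancel₀ hN, one_smul,
      nonsing_inv_mul _ (isUnit_iff_ne_zero.2 hg)]
  rw [det_gram_add hU hf hz, det_add_vecMulVec_star hNg, hinv, smul_mulVec, dotProduct_smul,
    smul_eq_mul, Complex.ofReal_add] at h1
  rw [h2] at h0
  rw [Complex.ofReal_div, Complex.ofReal_mul, eq_div_iff hT]
  generalize star w ⬝ᵥ ((graphMetric f z)⁻¹ *ᵥ w) = s at h1 ⊢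
  generalize ((graphNormSq f z : ℂ) • graphMetric f z).det = D at h1 h0
  generalize ((∑ c, ‖augMinor f c w z‖ ^ 2 : ℝ) : ℂ) = S at h1 ⊢
  generalize (pluckerNormSq f z : ℂ) = T at *
  generalize (graphNormSq f z : ℂ) = N at *
  have h3 : T * (N⁻¹ * s) = S := by
    linear_combination h1 - (1 + N⁻¹ * s) * h0
  rw [← h3]
  field_simp

end Graph

end KahlerGraph

end

noncomputable section

namespace KahlerGraph

open Matrix Metric Set Filter Topology

/-! ### The scalar curvature as a quotient of sums of squares. -/

section ScalarCurvature

variable {n k : ℕ} {f : EuclideanSpace ℂ (Fin n) → EuclideanSpace ℂ (Fin k)}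
  {U : Set (EuclideanSpace ℂ (Fin n))} {z : EuclideanSpace ℂ (Fin n)}

theorem differentiableOn_det {E m : Type*} [NormedAddCommGroup E] [NormedSpace ℂ E] [Fintype m]
    [DecidableEq m] {M : E → Matrix m m ℂ} {U : Set E}
    (hM : ∀ i j, DifferentiableOn ℂ (fun x => M x i j) U) :
    DifferentiableOn ℂ (fun x => (M x).det) U := by
  simp only [det_apply, Units.smul_def, zsmul_eq_mul]
  refine DifferentiableOn.fun_sum fun σ _ => DifferentiableOn.const_mul (fun x hx => ?_) _
  exact (HasFDerivWithinAt.finsetProd fun i _ =>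
    (hM (σ i) i x hx).hasFDerivWithinAt).differentiableWithinAt

theorem differentiableOn_apply {g : EuclideanSpace ℂ (Fin n) → EuclideanSpace ℂ (Fin k)}
    (hg : DifferentiableOn ℂ g U) (a : Fin k) : DifferentiableOn ℂ (fun x => g x a) U :=
  (EuclideanSpace.proj (𝕜 := ℂ) a).differentiable.comp_differentiableOn hg

theorem differentiableOn_coord (j : Fin n) :
    DifferentiableOn ℂ (fun x : EuclideanSpace ℂ (Fin n) => x j) U :=
  (EuclideanSpace.proj (𝕜 := ℂ) j).differentiable.differentiableOn

theorem differentiableOn_jetMatrix (hU : IsOpen U) (hf : DifferentiableOn ℂ f U) (i a) :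
    DifferentiableOn ℂ (fun x => jetMatrix f x i a) U := by
  rcases i with u | l
  · exact (differentiableOn_apply hf a).sub (DifferentiableOn.fun_sum fun j _ =>
      (differentiableOn_coord j).mul (differentiableOn_apply (differentiableOn_pderiv hU hf j) a))
  · exact differentiableOn_apply (differentiableOn_pderiv hU hf l) a

theorem differentiableOn_fromCols_jetMatrix (hU : IsOpen U) (hf : DifferentiableOn ℂ f U)
    (i) (α : (Unit ⊕ Fin n) ⊕ Fin k) :
    DifferentiableOn ℂ (fun x => (fromCols (1 : Matrix (Unit ⊕ Fin n) (Unit ⊕ Fin n) ℂ)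
      (jetMatrix f x)) i α) U := by
  rcases α with α | a
  · exact differentiableOn_const _
  · exact differentiableOn_jetMatrix hU hf i a

theorem differentiableOn_plucker (hU : IsOpen U) (hf : DifferentiableOn ℂ f U) (p) :
    DifferentiableOn ℂ (plucker f p) U :=
  differentiableOn_det fun i j => differentiableOn_fromCols_jetMatrix hU hf i (p j)

theorem differentiableOn_pluckerWedge (hU : IsOpen U) (hf : DifferentiableOn ℂ f U) (p q)
    (i : Fin n) : DifferentiableOn ℂ (fun x => pluckerWedge f p q x i) U :=
  ((differentiableOn_plucker hU hf p).mul
    (differentiableOn_pderiv hU (differentiableOn_plucker hU hf q) i)).sub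
  ((differentiableOn_plucker hU hf q).mul
    (differentiableOn_pderiv hU (differentiableOn_plucker hU hf p) i))

theorem differentiableOn_augMinor (hU : IsOpen U) (hf : DifferentiableOn ℂ f U) (c)
    {w : EuclideanSpace ℂ (Fin n) → Fin n → ℂ} (hw : ∀ i, DifferentiableOn ℂ (fun x => w x i) U) :
    DifferentiableOn ℂ (fun x => augMinor f c (w x) x) U := by
  unfold augMinor
  split_ifs with h
  · refine differentiableOn_det fun i j => ?_
    change DifferentiableOn ℂ (fun x => augmented f (w x) x i (c j)) U
    rcases c j with α | u
    · exact differentiableOn_fromCols_jetMatrix hU hf i α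
    · rcases i with v | l
      · exact (DifferentiableOn.fun_sum fun j _ => (differentiableOn_coord j).mul (hw j)).neg
      · exact hw l
  · exact differentiableOn_const _

theorem sum_plucker_pos (f : EuclideanSpace ℂ (Fin n) → EuclideanSpace ℂ (Fin k))
    (z : EuclideanSpace ℂ (Fin n)) : 0 < ∑ p, ‖plucker f p z‖ ^ 2 :=
  zero_lt_one.trans_le (one_le_pluckerNormSq f z)

theorem log_det_graphMetric (hU : IsOpen U) (hf : DifferentiableOn ℂ f U) (hz : z ∈ U) :
    Complex.log (graphMetric f z).det =
      ((Real.log (∑ p, ‖plucker f p z‖ ^ 2) : ℝ) : ℂ) - (Real.log (n + 1).factorial : ℝ) -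
        (n + 1) * ((Real.log (∑ α, ‖graphCoord f α z‖ ^ 2) : ℝ) : ℂ) := by
  have hT := sum_plucker_pos f z
  have hN := sum_graphCoord_pos f z
  have hfac : (0 : ℝ) < (n + 1).factorial := by exact_mod_cast Nat.factorial_pos _
  rw [det_graphMetric hU hf hz, pluckerNormSq, graphNormSq, ← Complex.ofReal_log (by positivity),
    Real.log_div hT.ne' (by positivity), Real.log_mul hfac.ne' (by positivity), Real.log_pow]
  push_cast
  ring

/-- Since `det g = |G|² / ((n+1)! |F|^(2(n+1)))`, the constant drops out and `∂∂̄ log |F|²` is `g`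
itself. -/
theorem ricci_graphMetric (hU : IsOpen U) (hf : DifferentiableOn ℂ f U) (hz : z ∈ U) :
    ricci (graphMetric f) z = (n + 1 : ℂ) • graphMetric f z -
      complexHessian (fun x => ((Real.log (∑ p, ‖plucker f p x‖ ^ 2) : ℝ) : ℂ)) z := by
  have hF := differentiableOn_graphCoord hf hU
  have hG := differentiableOn_plucker hU hf
  -- The outer derivative sees a germ, so the first derivatives must agree near `z` and not only at
  -- `z`.
  have hev : ∀ j, dzbar j (fun x => Complex.log (graphMetric f x).det) =ᶠ[𝓝 z] fun x =>
      dzbar j (fun x => ((Real.log (∑ p, ‖plucker f p x‖ ^ 2) : ℝ) : ℂ)) x - (n + 1 : ℂ) *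
        dzbar j (fun x => ((Real.log (∑ α, ‖graphCoord f α x‖ ^ 2) : ℝ) : ℂ)) x := by
    intro j
    filter_upwards [hU.mem_nhds hz] with x hx
    have : (fun x => Complex.log (graphMetric f x).det) =ᶠ[𝓝 x] fun z =>
        ((Real.log (∑ p, ‖plucker f p z‖ ^ 2) : ℝ) : ℂ) - (Real.log (n + 1).factorial : ℝ) -
          (n + 1) * ((Real.log (∑ α, ‖graphCoord f α z‖ ^ 2) : ℝ) : ℂ) := by
      filter_upwards [hU.mem_nhds hx] with y hy using log_det_graphMetric hU hf hy
    rw [dzbar_congr this, dzbar_sub_const_mul]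
    · exact differentiableAt_log_sum (fun p => (hG p).differentiableAt (hU.mem_nhds hx))
        (sum_plucker_pos f x)
    · exact differentiableAt_log_sum (fun p => (hF p).differentiableAt (hU.mem_nhds hx))
        (sum_graphCoord_pos f x)
  ext i j
  rw [graphMetric_eq]
  simp only [ricci, complexHessian, Matrix.neg_apply, Matrix.sub_apply, Matrix.smul_apply,
    of_apply, smul_eq_mul]
  rw [dz_congr (hev j), dz_sub_const_mul
    (differentiableAt_dzbar_log_sum hU hG (fun x _ => sum_plucker_pos f x) hz j)
    (differentiableAt_dzbar_log_sum hU hF (fun x _ => sum_graphCoord_pos f x) hz j)]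
  ring

/-- The squared norm of the second fundamental form in terms of maximal minors. -/
theorem scalarCurvature_graphMetric (hU : IsOpen U) (hf : DifferentiableOn ℂ f U) (hz : z ∈ U) :
    (n : ℂ) * (n + 1) - 1 / 4 * scalarCurvature (graphMetric f) z =
      ((graphNormSq f z * (∑ p, ∑ q, ∑ c, ‖augMinor f c (pluckerWedge f p q z) z‖ ^ 2) /
        (2 * pluckerNormSq f z ^ 3) : ℝ) : ℂ) := by
  have hT : (pluckerNormSq f z : ℂ) ≠ 0 := by
    exact_mod_cast (zero_lt_one.trans_le (one_le_pluckerNormSq f z)).ne'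
  have htr : ∀ w : Fin n → ℂ, ((graphMetric f z)⁻¹ * vecMulVec w (star w)).trace =
      star w ⬝ᵥ ((graphMetric f z)⁻¹ *ᵥ w) := by
    intro w
    rw [mul_vecMulVec, trace_vecMulVec, dotProduct_comm]
  rw [scalarCurvature, ricci_graphMetric hU hf hz, complexHessian_log_sum_eq_sum_sq hU
    (differentiableOn_plucker hU hf) (fun x _ => sum_plucker_pos f x) hz, Matrix.mul_sub,
    Matrix.mul_smul, Matrix.mul_smul, nonsing_inv_mul _
      (isUnit_iff_ne_zero.2 (det_graphMetric_ne_zero hU hf hz)), trace_sub, trace_smul, trace_smul,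
    trace_one, Fintype.card_fin, Matrix.mul_sum, trace_sum]
  simp only [Matrix.mul_sum, trace_sum]
  have hterm : ∀ p q, ((graphMetric f z)⁻¹ * vecMulVec
      (fun i => plucker f p z * pderiv i (plucker f q) z - plucker f q z * pderiv i (plucker f p) z)
      (star fun i => plucker f p z * pderiv i (plucker f q) z -
        plucker f q z * pderiv i (plucker f p) z)).trace =
      ((graphNormSq f z * (∑ c, ‖augMinor f c (pluckerWedge f p q z) z‖ ^ 2) /
        pluckerNormSq f z : ℝ) : ℂ) := fun p q => by
    rw [htr, ← star_dotProduct_inv_graphMetric_mulVec hU hf hz]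
    rfl
  simp only [hterm, ← Complex.ofReal_sum, ← Finset.sum_div, ← Finset.mul_sum]
  rw [show ∑ p, ‖plucker f p z‖ ^ 2 = pluckerNormSq f z from rfl]
  generalize (∑ p, ∑ q, ∑ c, ‖augMinor f c (pluckerWedge f p q z) z‖ ^ 2) = S
  push_cast
  simp only [smul_eq_mul]
  field_simp
  ring

end ScalarCurvature

end KahlerGraph

end

noncomputable section

namespace KahlerGraph

open Matrix Metric Set Filter Topology

/-! ### The pointwise bound on second derivatives. -/

section Pointwise

variable {n k : ℕ} {f : EuclideanSpace ℂ (Fin n) → EuclideanSpace ℂ (Fin k)}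
  {U : Set (EuclideanSpace ℂ (Fin n))} {z : EuclideanSpace ℂ (Fin n)}

/-- `|D²f|²`. -/
def hessNormSq (f : EuclideanSpace ℂ (Fin n) → EuclideanSpace ℂ (Fin k))
    (z : EuclideanSpace ℂ (Fin n)) : ℝ := ∑ i, ∑ l, ‖pderiv i (pderiv l f) z‖ ^ 2

/-- `1 + |z|² + |f|² + |Df|²`. -/
def jetNormSq (f : EuclideanSpace ℂ (Fin n) → EuclideanSpace ℂ (Fin k))
    (z : EuclideanSpace ℂ (Fin n)) : ℝ := 1 + ‖z‖ ^ 2 + ‖f z‖ ^ 2 + gradNormSq f z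

theorem gradNormSq_nonneg (f : EuclideanSpace ℂ (Fin n) → EuclideanSpace ℂ (Fin k))
    (z : EuclideanSpace ℂ (Fin n)) : 0 ≤ gradNormSq f z :=
  Finset.sum_nonneg fun _ _ => sq_nonneg _

theorem one_le_jetNormSq (f : EuclideanSpace ℂ (Fin n) → EuclideanSpace ℂ (Fin k))
    (z : EuclideanSpace ℂ (Fin n)) : 1 ≤ jetNormSq f z := by
  have := gradNormSq_nonneg f z
  rw [jetNormSq]
  nlinarith [sq_nonneg ‖z‖, sq_nonneg ‖f z‖]

theorem hessNormSq_nonneg (f : EuclideanSpace ℂ (Fin n) → EuclideanSpace ℂ (Fin k))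
    (z : EuclideanSpace ℂ (Fin n)) : 0 ≤ hessNormSq f z :=
  Finset.sum_nonneg fun _ _ => Finset.sum_nonneg fun _ _ => sq_nonneg _

/-- Functions selecting the identity minor or an entry of the Jacobian matrix. -/
def selector (x : Option (Fin n × Fin k)) : Unit ⊕ Fin n → (Unit ⊕ Fin n) ⊕ Fin k :=
  x.elim Sum.inl fun la => Function.update Sum.inl (Sum.inr la.1) (Sum.inr la.2)

theorem update_inl_injective {m κ : Type*} [DecidableEq m] (l : m) (a : κ) :
    Function.Injective (Function.update (Sum.inl : m → m ⊕ κ) l (Sum.inr a)) := by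
  intro x y h
  by_cases hx : x = l <;> by_cases hy : y = l
  · rw [hx, hy]
  · simp [hx, hy] at h
  · simp [hx, hy] at h
  · simpa [hx, hy] using h

theorem inl_mem_range_update {m κ : Type*} [DecidableEq m] (l x : m) (a : κ) :
    Sum.inl x ∈ Set.range (Function.update (Sum.inl : m → m ⊕ κ) l (Sum.inr a)) ↔ x ≠ l := by
  constructor
  · rintro ⟨y, hy⟩ rfl
    by_cases h : y = x
    · simp [h] at hy
    · simp [h] at hy
  · exact fun h => ⟨x, by simp [h]⟩

theorem inr_mem_range_update {m κ : Type*} [DecidableEq m] (l : m) (a b : κ) :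
    Sum.inr b ∈ Set.range (Function.update (Sum.inl : m → m ⊕ κ) l (Sum.inr a)) ↔ b = a := by
  constructor
  · rintro ⟨y, hy⟩
    by_cases h : y = l
    · simpa [h, eq_comm] using hy
    · simp [h] at hy
  · rintro rfl
    exact ⟨l, by simp⟩

theorem selector_injective (x : Option (Fin n × Fin k)) : Function.Injective (selector x) := by
  rcases x with _ | la
  · exact Sum.inl_injective
  · exact update_inl_injective _ _

/-- Distinct column sets ensure that the selected minors lie in disjoint permutation orbits, so none
is counted twice. -/
theorem range_selector_injective :
    Function.Injective fun x : Option (Fin n × Fin k) => Set.range (selector x) := by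
  rintro (_ | ⟨l, a⟩) (_ | ⟨l', a'⟩) h
  · rfl
  · have h1 : Sum.inl (Sum.inr l') ∈ Set.range (selector (some (l', a'))) := by
      have : Set.range (selector (none : Option (Fin n × Fin k))) =
          Set.range (selector (some (l', a'))) := h
      rw [← this]
      exact ⟨_, rfl⟩
    exact absurd rfl ((inl_mem_range_update _ _ _).1 h1)
  · have h1 : Sum.inl (Sum.inr l) ∈ Set.range (selector (some (l, a))) := by
      have : Set.range (selector (some (l, a))) =
          Set.range (selector (none : Option (Fin n × Fin k))) := h
      rw [this]
      exact ⟨_, rfl⟩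
    exact absurd rfl ((inl_mem_range_update _ _ _).1 h1)
  · have h0 : Set.range (selector (some (l, a))) = Set.range (selector (some (l', a'))) := h
    have h1 : Sum.inr a ∈ Set.range (selector (some (l', a'))) :=
      h0 ▸ (inr_mem_range_update _ _ _).2 rfl
    have h2 : a = a' := (inr_mem_range_update _ _ _).1 h1
    have h3 : ¬ Sum.inl (Sum.inr l) ∈ Set.range (selector (some (l', a'))) := fun h3 =>
      (inl_mem_range_update _ _ _).1 (h0.symm ▸ h3 :
        Sum.inl (Sum.inr l) ∈ Set.range (selector (some (l, a)))) rfl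
    have h4 : l = l' := by
      by_contra hne
      exact h3 ((inl_mem_range_update _ _ _).2 (by simpa using hne))
    rw [h2, h4]

theorem plucker_selector_some (f : EuclideanSpace ℂ (Fin n) → EuclideanSpace ℂ (Fin k))
    (l : Fin n) (a : Fin k) :
    plucker f (selector (some (l, a))) = fun x => pderiv l f x a := by
  funext x
  exact det_one_fromCols_submatrix_update _ _ _

theorem plucker_selector_none (f : EuclideanSpace ℂ (Fin n) → EuclideanSpace ℂ (Fin k)) :
    plucker f (selector none) = fun _ => 1 :=
  funext fun x => plucker_inl f x

theorem pderiv_const (i : Fin n) (c : ℂ) : pderiv i (fun _ => c) z = 0 := by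
  simp [pderiv]

theorem pluckerWedge_none_some (f : EuclideanSpace ℂ (Fin n) → EuclideanSpace ℂ (Fin k))
    (l i : Fin n) (a : Fin k) :
    pluckerWedge f (selector none) (selector (some (l, a))) z i =
      pderiv i (fun x => pderiv l f x a) z := by
  simp [pluckerWedge, plucker_selector_none, plucker_selector_some, pderiv_const]

theorem pluckerWedge_comm (f : EuclideanSpace ℂ (Fin n) → EuclideanSpace ℂ (Fin k)) (p q)
    (i : Fin n) : pluckerWedge f q p z i = -pluckerWedge f p q z i := by
  simp [pluckerWedge]

theorem plucker_comp_perm (f : EuclideanSpace ℂ (Fin n) → EuclideanSpace ℂ (Fin k)) (p)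
    (σ : Equiv.Perm (Unit ⊕ Fin n)) :
    plucker f (p ∘ σ) = fun x => ((Equiv.Perm.sign σ : ℤ) : ℂ) * plucker f p x := by
  funext x
  rw [plucker, plucker, ← det_permute']
  rfl

theorem norm_sign (σ : Equiv.Perm (Unit ⊕ Fin n)) : ‖((Equiv.Perm.sign σ : ℤ) : ℂ)‖ = 1 := by
  rcases Int.units_eq_one_or (Equiv.Perm.sign σ) with h | h <;> simp [h]

theorem pluckerWedge_comp_perm (hU : IsOpen U) (hf : DifferentiableOn ℂ f U) (hz : z ∈ U) (p q)
    (σ : Equiv.Perm (Unit ⊕ Fin n)) (i : Fin n) :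
    ‖pluckerWedge f p (q ∘ σ) z i‖ = ‖pluckerWedge f p q z i‖ := by
  have hd : pderiv i (plucker f (q ∘ σ)) z =
      ((Equiv.Perm.sign σ : ℤ) : ℂ) * pderiv i (plucker f q) z := by
    rw [plucker_comp_perm, pderiv, fderiv_const_mul
      ((differentiableOn_plucker hU hf q).differentiableAt (hU.mem_nhds hz))]
    rfl
  have : pluckerWedge f p (q ∘ σ) z i =
      ((Equiv.Perm.sign σ : ℤ) : ℂ) * pluckerWedge f p q z i := by
    simp only [pluckerWedge]
    rw [hd, plucker_comp_perm]
    ring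
  rw [this, norm_mul, norm_sign, one_mul]

/-- Wedging the minor `1` with the minor `∂f/∂zˡ` leaves exactly a second derivative. Both orders of
the pair give the `2`, and permuting the columns of each minor gives the two factorials. All other
terms are discarded. -/
theorem sum_sq_pluckerWedge_ge (hU : IsOpen U) (hf : DifferentiableOn ℂ f U) (hz : z ∈ U) :
    2 * ((n + 1).factorial : ℝ) ^ 2 * hessNormSq f z ≤
      ∑ p, ∑ q, ∑ i, ‖pluckerWedge f p q z i‖ ^ 2 := by
  have hcard : Fintype.card (Unit ⊕ Fin n) = n + 1 := by simp [add_comm]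
  have hcomm : ∀ p q i, ‖pluckerWedge f q p z i‖ = ‖pluckerWedge f p q z i‖ := fun p q i => by
    rw [pluckerWedge_comm, norm_neg]
  have hperm' : ∀ p q (σ : Equiv.Perm (Unit ⊕ Fin n)) i,
      ‖pluckerWedge f (p ∘ σ) q z i‖ = ‖pluckerWedge f p q z i‖ := fun p q σ i => by
    rw [hcomm, pluckerWedge_comp_perm hU hf hz, hcomm]
  have hs : hessNormSq f z = ∑ x : Fin n × Fin k, ∑ i,
      ‖pluckerWedge f (selector none) (selector (some x)) z i‖ ^ 2 := by
    rw [Fintype.sum_prod_type]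
    simp only [hessNormSq]
    rw [Finset.sum_comm]
    refine Finset.sum_congr rfl fun l _ => ?_
    rw [Finset.sum_comm]
    refine Finset.sum_congr rfl fun i _ => ?_
    rw [EuclideanSpace.norm_sq_eq]
    refine Finset.sum_congr rfl fun a _ => ?_
    rw [pluckerWedge_none_some]
    have h := (hasFDerivAt_coord ((differentiableOn_pderiv hU hf l).differentiableAt
      (hU.mem_nhds hz)) a).fderiv
    simp only [pderiv] at h ⊢
    rw [h]
    rfl
  calc 2 * ((n + 1).factorial : ℝ) ^ 2 * hessNormSq f z
      ≤ ((n + 1).factorial : ℝ) ^ 2 * ∑ x : Option (Fin n × Fin k), ∑ y : Option (Fin n × Fin k),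
          ∑ i, ‖pluckerWedge f (selector x) (selector y) z i‖ ^ 2 := by
        rw [mul_comm (2 : ℝ), mul_assoc]
        refine mul_le_mul_of_nonneg_left ?_ (by positivity)
        simp only [Fintype.sum_option, Finset.sum_add_distrib]
        rw [← hs]
        have h1 : ∑ x : Fin n × Fin k, ∑ i,
            ‖pluckerWedge f (selector (some x)) (selector none) z i‖ ^ 2 = hessNormSq f z := by
          rw [hs]
          simp only [hcomm]
        rw [h1]
        have h2 : 0 ≤ ∑ i, ‖pluckerWedge f (selector none) (selector none) z i‖ ^ 2 :=
          Finset.sum_nonneg fun _ _ => sq_nonneg _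
        have h3 : 0 ≤ ∑ x : Fin n × Fin k, ∑ y : Fin n × Fin k, ∑ i,
            ‖pluckerWedge f (selector (some x)) (selector (some y)) z i‖ ^ 2 :=
          Finset.sum_nonneg fun _ _ => Finset.sum_nonneg fun _ _ =>
            Finset.sum_nonneg fun _ _ => sq_nonneg _
        linarith
    _ ≤ ((n + 1).factorial : ℝ) * ∑ x : Option (Fin n × Fin k), ∑ q,
          ∑ i, ‖pluckerWedge f (selector x) q z i‖ ^ 2 := by
        rw [pow_two, mul_assoc]
        refine mul_le_mul_of_nonneg_left ?_ (by positivity)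
        rw [Finset.mul_sum]
        refine Finset.sum_le_sum fun x _ => ?_
        rw [← hcard]
        exact card_factorial_mul_sum_le selector selector_injective range_selector_injective
          (fun q => ∑ i, ‖pluckerWedge f (selector x) q z i‖ ^ 2)
          (fun q => Finset.sum_nonneg fun _ _ => sq_nonneg _)
          (fun q σ => by simp only [pluckerWedge_comp_perm hU hf hz])
    _ ≤ _ := by
        rw [← hcard]
        exact card_factorial_mul_sum_le selector selector_injective range_selector_injective
          (fun p => ∑ q, ∑ i, ‖pluckerWedge f p q z i‖ ^ 2)
          (fun p => Finset.sum_nonneg fun _ _ => Finset.sum_nonneg fun _ _ => sq_nonneg _)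
          (fun p σ => by simp only [hperm'])

/-- Functions selecting an entry of the last column of the augmented matrix. -/
def augSelector (i : Fin n) : Unit ⊕ Fin n → ((Unit ⊕ Fin n) ⊕ Fin k) ⊕ Unit :=
  Function.update (Sum.inl ∘ Sum.inl) (Sum.inr i) (Sum.inr ())

theorem augMinor_augSelector (f : EuclideanSpace ℂ (Fin n) → EuclideanSpace ℂ (Fin k))
    (i : Fin n) (w : Fin n → ℂ) : augMinor f (augSelector i) w z = w i := by
  rw [augMinor, if_pos ⟨Sum.inr i, by simp [augSelector]⟩]
  have h : (augmented f w z).submatrix id (augSelector i) =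
      (1 : Matrix (Unit ⊕ Fin n) (Unit ⊕ Fin n) ℂ).updateCol (Sum.inr i) (shearVec z w) := by
    ext x y
    rcases eq_or_ne y (Sum.inr i) with rfl | hy
    · simp [augSelector, augmented]
    · simp [augSelector, augmented, hy]
  rw [h, ← cramer_apply, cramer_one]
  rfl

theorem augSelector_injective (i : Fin n) :
    Function.Injective (augSelector (k := k) i) := by
  intro x y h
  by_cases hx : x = Sum.inr i <;> by_cases hy : y = Sum.inr i
  · rw [hx, hy]
  · simp [augSelector, hx, hy] at h
  · simp [augSelector, hx, hy] at h
  · simpa [augSelector, hx, hy] using h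

theorem range_augSelector_injective :
    Function.Injective fun i : Fin n => Set.range (augSelector (k := k) i) := by
  intro i j h
  by_contra hne
  have h1 : Sum.inl (Sum.inl (Sum.inr j)) ∈ Set.range (augSelector (k := k) i) :=
    ⟨Sum.inr j, by simp [augSelector, Ne.symm hne]⟩
  have h0 : Set.range (augSelector (k := k) i) = Set.range (augSelector (k := k) j) := h
  rw [h0] at h1
  obtain ⟨y, hy⟩ := h1
  by_cases hyj : y = Sum.inr j
  · simp [augSelector, hyj] at hy
  · simp [augSelector, hyj] at hy

theorem norm_augMinor_comp_perm (f : EuclideanSpace ℂ (Fin n) → EuclideanSpace ℂ (Fin k)) (c)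
    (w : Fin n → ℂ) (σ : Equiv.Perm (Unit ⊕ Fin n)) :
    ‖augMinor f (c ∘ σ) w z‖ = ‖augMinor f c w z‖ := by
  have hex : (∃ x, (c ∘ σ) x = Sum.inr ()) ↔ ∃ x, c x = Sum.inr () :=
    σ.exists_congr_left.trans (by simp)
  simp only [augMinor, hex]
  split_ifs with h
  · have : (augmented f w z).submatrix id (c ∘ σ) =
        ((augmented f w z).submatrix id c).submatrix id σ := rfl
    rw [this, det_permute', norm_mul, norm_sign, one_mul]
  · rfl

/-- Replacing one column of the identity block by the added column gives a minor equal to an entry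
of `w`; permutations of its columns contribute the factorial. -/
theorem sum_sq_augMinor_ge (f : EuclideanSpace ℂ (Fin n) → EuclideanSpace ℂ (Fin k))
    (w : Fin n → ℂ) :
    ((n + 1).factorial : ℝ) * ∑ i, ‖w i‖ ^ 2 ≤ ∑ c, ‖augMinor f c w z‖ ^ 2 := by
  have hcard : Fintype.card (Unit ⊕ Fin n) = n + 1 := by simp [add_comm]
  have h := card_factorial_mul_sum_le (augSelector (k := k)) augSelector_injective
    range_augSelector_injective (fun c => ‖augMinor f c w z‖ ^ 2) (fun _ => sq_nonneg _)
    (fun c σ => by simp only [norm_augMinor_comp_perm])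
  simpa only [augMinor_augSelector, hcard] using h

theorem sum_sq_augMinor_wedge_ge (hU : IsOpen U) (hf : DifferentiableOn ℂ f U) (hz : z ∈ U) :
    2 * ((n + 1).factorial : ℝ) ^ 3 * hessNormSq f z ≤
      ∑ p, ∑ q, ∑ c, ‖augMinor f c (pluckerWedge f p q z) z‖ ^ 2 := by
  calc 2 * ((n + 1).factorial : ℝ) ^ 3 * hessNormSq f z
      = ((n + 1).factorial : ℝ) * (2 * ((n + 1).factorial : ℝ) ^ 2 * hessNormSq f z) := by ring
    _ ≤ ((n + 1).factorial : ℝ) * ∑ p, ∑ q, ∑ i, ‖pluckerWedge f p q z i‖ ^ 2 :=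
        mul_le_mul_of_nonneg_left (sum_sq_pluckerWedge_ge hU hf hz) (by positivity)
    _ ≤ _ := by
        simp only [Finset.mul_sum]
        refine Finset.sum_le_sum fun p _ => Finset.sum_le_sum fun q _ => ?_
        rw [← Finset.mul_sum]
        exact sum_sq_augMinor_ge f _

/-- The arithmetic-geometric mean inequality for the Gram matrix: its trace is `|F|² + n + |Df|²`,
which is at most `(n + 1)` times the jet norm because that is at least `1`. -/
theorem pluckerNormSq_le (hf : DifferentiableAt ℂ f z) :
    pluckerNormSq f z ≤ (n + 1).factorial * jetNormSq f z ^ (n + 1) := by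
  have hcard : Fintype.card (Unit ⊕ Fin n) = n + 1 := by simp [add_comm]
  have h := det_re_le_trace_pow (posSemidef_self_mul_conjTranspose (frameMatrix f z))
  have hdet := factorial_mul_det_gram hf
  have hdet' : ((n + 1).factorial : ℝ) * (frameMatrix f z * (frameMatrix f z)ᴴ).det.re =
      pluckerNormSq f z := by
    have := congrArg Complex.re hdet
    rwa [show ((n + 1).factorial : ℂ) = (((n + 1).factorial : ℝ) : ℂ) by simp,
      Complex.re_ofReal_mul, Complex.ofReal_re] at this
  have htr : (frameMatrix f z * (frameMatrix f z)ᴴ).trace.re =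
      graphNormSq f z + (n + gradNormSq f z) := by
    have hentry : ∀ i, ((frameMatrix f z * (frameMatrix f z)ᴴ) i i).re =
        ∑ α, ‖frameMatrix f z i α‖ ^ 2 := by
      intro i
      rw [← Complex.ofReal_re (∑ α, ‖frameMatrix f z i α‖ ^ 2), ofReal_sum_norm_sq]
      simp [mul_apply]
    rw [trace, Complex.re_sum, Fintype.sum_sum_type]
    congr 1
    · simp [diag, frameMatrix_gram_inl]
    · have hrow : ∀ l, frameMatrix f z (Sum.inr l) = Sum.elim
          (Sum.elim (fun _ => 0) (fun j => if l = j then 1 else 0)) (fun a => pderiv l f z a) :=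
        fun l => funext fun α => pderiv_graphCoord hf l α
      simp only [diag_apply, hentry, hrow]
      simp only [Fintype.sum_sum_type, Sum.elim_inl, Sum.elim_inr, Finset.sum_add_distrib,
        gradNormSq]
      congr 1
      · simp [apply_ite]
      · refine Finset.sum_congr rfl fun l _ => ?_
        rw [EuclideanSpace.norm_sq_eq]
        rfl
  rw [htr, hcard] at h
  have hj := one_le_jetNormSq f z
  have hle : (graphNormSq f z + (n + gradNormSq f z)) / ((n + 1 : ℕ) : ℝ) ≤ jetNormSq f z := by
    rw [div_le_iff₀ (by positivity)]
    have e : jetNormSq f z = graphNormSq f z + gradNormSq f z := by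
      rw [graphNormSq_eq, jetNormSq]
    push_cast
    nlinarith [(Nat.cast_nonneg n : (0 : ℝ) ≤ n)]
  have h0 : 0 ≤ (graphNormSq f z + (n + gradNormSq f z)) / ((n + 1 : ℕ) : ℝ) := by
    have := one_le_graphNormSq f z
    have := gradNormSq_nonneg f z
    positivity
  rw [← hdet']
  exact mul_le_mul_of_nonneg_left (h.trans (pow_le_pow_left₀ h0 hle _)) (by positivity)

/-- The pointwise bound on second derivatives given by a bound on the second fundamental form. -/
theorem hessNormSq_le (hU : IsOpen U) (hf : DifferentiableOn ℂ f U) (hz : z ∈ U) {Λ : ℝ}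
    (hΛ : 0 ≤ Λ) (h : graphNormSq f z ^ 2 *
      (∑ p, ∑ q, ∑ c, ‖augMinor f c (pluckerWedge f p q z) z‖ ^ 2) ≤
      2 * Λ * (pluckerNormSq f z ^ 3 * graphNormSq f z)) :
    hessNormSq f z ≤ Λ * jetNormSq f z ^ (3 * n + 3) := by
  have h1 := sum_sq_augMinor_wedge_ge hU hf hz
  have h2 := pluckerNormSq_le (hf.differentiableAt (hU.mem_nhds hz))
  have hN := one_le_graphNormSq f z
  have hT := one_le_pluckerNormSq f z
  have hH := hessNormSq_nonneg f z
  have hj := one_le_jetNormSq f z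
  have hfac : (0 : ℝ) < (n + 1).factorial := by exact_mod_cast Nat.factorial_pos _
  set S := ∑ p, ∑ q, ∑ c, ‖augMinor f c (pluckerWedge f p q z) z‖ ^ 2
  set N := graphNormSq f z
  set T := pluckerNormSq f z
  set m : ℝ := ((n + 1).factorial : ℝ)
  -- One factor `|F|²` cancels; the one that remains on the left is at least `1` and is dropped
  -- next.
  have hNS : N * S ≤ 2 * Λ * T ^ 3 := by
    have : N * (N * S) ≤ N * (2 * Λ * T ^ 3) := by nlinarith
    exact le_of_mul_le_mul_left this (by linarith)
  have hS : S ≤ N * S := by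
    have : 0 ≤ S := le_trans (by positivity) h1
    nlinarith
  have hT3 : T ^ 3 ≤ (m * jetNormSq f z ^ (n + 1)) ^ 3 := pow_le_pow_left₀ (by linarith) h2 3
  have : 2 * m ^ 3 * hessNormSq f z ≤ 2 * m ^ 3 * (Λ * jetNormSq f z ^ (3 * n + 3)) := by
    calc 2 * m ^ 3 * hessNormSq f z ≤ 2 * Λ * T ^ 3 := h1.trans (hS.trans hNS)
      _ ≤ 2 * Λ * (m * jetNormSq f z ^ (n + 1)) ^ 3 :=
          mul_le_mul_of_nonneg_left hT3 (by positivity)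
      _ = _ := by ring
  exact le_of_mul_le_mul_left this (by positivity)

end Pointwise

end KahlerGraph

end

noncomputable section

namespace KahlerGraph

open Matrix Metric Set Filter Topology

/-! ### The differential inequality along rays and its integration. -/

section Radial

variable {n k : ℕ} {f : EuclideanSpace ℂ (Fin n) → EuclideanSpace ℂ (Fin k)}
  {z : EuclideanSpace ℂ (Fin n)}

theorem norm_fderiv_apply_sq_le {F : Type*} [NormedAddCommGroup F] [NormedSpace ℂ F]
    (g : EuclideanSpace ℂ (Fin n) → F) (x z : EuclideanSpace ℂ (Fin n)) :
    ‖fderiv ℂ g x z‖ ^ 2 ≤ ‖z‖ ^ 2 * ∑ l, ‖pderiv l g x‖ ^ 2 := by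
  have hz : z = ∑ l, z l • EuclideanSpace.single l (1 : ℂ) := by
    ext j
    simp [Pi.single_apply]
  have h1 : ‖fderiv ℂ g x z‖ ≤ ∑ l, ‖z l‖ * ‖pderiv l g x‖ := by
    conv_lhs => rw [hz]
    rw [map_sum]
    refine (norm_sum_le _ _).trans (le_of_eq (Finset.sum_congr rfl fun l _ => ?_))
    rw [map_smul, norm_smul]
    rfl
  calc ‖fderiv ℂ g x z‖ ^ 2 ≤ (∑ l, ‖z l‖ * ‖pderiv l g x‖) ^ 2 :=
        pow_le_pow_left₀ (norm_nonneg _) h1 2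
    _ ≤ _ := by
        rw [EuclideanSpace.norm_sq_eq]
        exact Finset.sum_mul_sq_le_sq_mul_sq _ _ _

theorem hasDerivAt_smul_const (z : EuclideanSpace ℂ (Fin n)) (s : ℝ) :
    HasDerivAt (fun s : ℝ => s • z) z s := by
  simpa using (hasDerivAt_id s).smul_const z

theorem hasDerivAt_comp_ray {F : Type*} [NormedAddCommGroup F] [NormedSpace ℂ F]
    {g : EuclideanSpace ℂ (Fin n) → F} {s : ℝ} (hg : DifferentiableAt ℂ g (s • z)) :
    HasDerivAt (fun s : ℝ => g (s • z)) (fderiv ℂ g (s • z) z) s := by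
  simpa [Function.comp_def] using
    (hg.hasFDerivAt.restrictScalars ℝ).comp_hasDerivAt s (hasDerivAt_smul_const z s)

theorem norm_deriv_norm_sq_le {F : Type*} [NormedAddCommGroup F] [InnerProductSpace ℝ F]
    {g : ℝ → F} {g' : F} {s : ℝ} (hg : HasDerivAt g g' s) :
    ∃ d, HasDerivAt (fun s => ‖g s‖ ^ 2) d s ∧ d ≤ 2 * (‖g s‖ * ‖g'‖) := by
  refine ⟨_, hg.norm_sq, ?_⟩
  exact mul_le_mul_of_nonneg_left (real_inner_le_norm _ _) (by norm_num)

/-- The differential inequality for `1 + |z|² + |f|² + |Df|²` along rays. -/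
theorem exists_hasDerivAt_jetNormSq {ρ Λ : ℝ} (hΛ : 0 ≤ Λ)
    (hf : DifferentiableOn ℂ f (ball 0 ρ))
    (hH : ∀ x ∈ ball (0 : EuclideanSpace ℂ (Fin n)) ρ,
      hessNormSq f x ≤ Λ * jetNormSq f x ^ (3 * n + 3)) {s : ℝ} (hs : s • z ∈ ball 0 ρ) :
    ∃ d, HasDerivAt (fun s : ℝ => jetNormSq f (s • z)) d s ∧
      d ≤ 2 * ‖z‖ * Real.sqrt (Λ + 1) * jetNormSq f (s • z) ^ ((3 * (n : ℝ) + 4) / 2) := by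
  set x := s • z with hx
  have hnhds := isOpen_ball.mem_nhds hs
  obtain ⟨d₁, hd₁, hd₁'⟩ := norm_deriv_norm_sq_le (hasDerivAt_smul_const z s)
  obtain ⟨d₂, hd₂, hd₂'⟩ := norm_deriv_norm_sq_le
    (hasDerivAt_comp_ray (hf.differentiableAt hnhds))
  have h3 := fun i => norm_deriv_norm_sq_le (hasDerivAt_comp_ray
    ((differentiableOn_pderiv isOpen_ball hf i).differentiableAt hnhds))
  choose d₃ hd₃ hd₃' using h3
  have hderiv : HasDerivAt (fun s : ℝ => jetNormSq f (s • z)) (d₁ + d₂ + ∑ i, d₃ i) s := by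
    have := ((hd₁.const_add 1).add hd₂).add (HasDerivAt.fun_sum fun i (_ : i ∈ Finset.univ) => hd₃ i)
    exact this
  refine ⟨_, hderiv, ?_⟩
  rw [← hx] at hd₁' hd₂' hd₃'
  -- A single Cauchy-Schwarz over the position, the value and all first derivatives: `a` collects
  -- their norms and `b` the norms of their derivatives along the ray.
  let a : Option (Option (Fin n)) → ℝ := fun o =>
    o.elim ‖x‖ fun o => o.elim ‖f x‖ fun i => ‖pderiv i f x‖
  let b : Option (Option (Fin n)) → ℝ := fun o =>
    o.elim ‖z‖ fun o => o.elim ‖fderiv ℂ f x z‖ fun i => ‖fderiv ℂ (pderiv i f) x z‖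
  have hle : d₁ + d₂ + ∑ i, d₃ i ≤ 2 * ∑ o, a o * b o := by
    simp only [Fintype.sum_option, a, b, Option.elim, mul_add, Finset.mul_sum]
    have := Finset.sum_le_sum fun i (_ : i ∈ Finset.univ) => hd₃' i
    linarith
  have hcs := Finset.sum_mul_sq_le_sq_mul_sq Finset.univ a b
  have hj := one_le_jetNormSq f x
  have hgrad := gradNormSq_nonneg f x
  have ha : ∑ o, a o ^ 2 ≤ jetNormSq f x := by
    simp only [Fintype.sum_option, a, Option.elim, jetNormSq, gradNormSq, pderiv]
    linarith
  have hb : ∑ o, b o ^ 2 ≤ ‖z‖ ^ 2 * ((Λ + 1) * jetNormSq f x ^ (3 * n + 3)) := by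
    simp only [Fintype.sum_option, b, Option.elim]
    have h1 : ‖fderiv ℂ f x z‖ ^ 2 ≤ ‖z‖ ^ 2 * gradNormSq f x := norm_fderiv_apply_sq_le f x z
    have h2 : ∑ i, ‖fderiv ℂ (pderiv i f) x z‖ ^ 2 ≤ ‖z‖ ^ 2 * hessNormSq f x := by
      rw [hessNormSq, Finset.sum_comm, Finset.mul_sum]
      exact Finset.sum_le_sum fun i _ => norm_fderiv_apply_sq_le _ x z
    -- Position and value contribute `1 + |Df|²`, absorbed into the same power as the second
    -- derivatives; this is the `1` in `Λ + 1`.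
    have h3 : 1 + gradNormSq f x ≤ jetNormSq f x ^ (3 * n + 3) := by
      refine le_trans ?_ (le_self_pow₀ hj (by omega))
      rw [jetNormSq]
      nlinarith [sq_nonneg ‖x‖, sq_nonneg ‖f x‖]
    calc ‖z‖ ^ 2 + (‖fderiv ℂ f x z‖ ^ 2 + ∑ i, ‖fderiv ℂ (pderiv i f) x z‖ ^ 2)
        ≤ ‖z‖ ^ 2 * (1 + gradNormSq f x + hessNormSq f x) := by linarith
      _ ≤ _ := mul_le_mul_of_nonneg_left (by linarith [hH x hs]) (sq_nonneg _)
  have hjp : 0 < jetNormSq f x := by linarith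
  set J := jetNormSq f x
  have hrhs : (‖z‖ * Real.sqrt (Λ + 1) * J ^ ((3 * (n : ℝ) + 4) / 2)) ^ 2 =
      J * (‖z‖ ^ 2 * ((Λ + 1) * J ^ (3 * n + 3))) := by
    rw [mul_pow, mul_pow, Real.sq_sqrt (by linarith), ← Real.rpow_natCast (J ^ _) 2,
      ← Real.rpow_mul hjp.le]
    have : (3 * (n : ℝ) + 4) / 2 * (2 : ℕ) = ((3 * n + 4 : ℕ) : ℝ) := by
      push_cast
      ring
    rw [this, Real.rpow_natCast]
    ring
  have hfin : ∑ o, a o * b o ≤ ‖z‖ * Real.sqrt (Λ + 1) * J ^ ((3 * (n : ℝ) + 4) / 2) := by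
    refine le_of_sq_le_sq ?_ (by positivity)
    rw [hrhs]
    refine hcs.trans (mul_le_mul ha hb (Finset.sum_nonneg fun _ _ => sq_nonneg _) hjp.le)
  calc _ ≤ _ := hle
    _ ≤ 2 * (‖z‖ * Real.sqrt (Λ + 1) * J ^ ((3 * (n : ℝ) + 4) / 2)) :=
        mul_le_mul_of_nonneg_left hfin (by norm_num)
    _ = _ := by ring

theorem jetNormSq_zero (hf0 : f 0 = 0) (hDf0 : fderiv ℂ f 0 = 0) : jetNormSq f 0 = 1 := by
  simp [jetNormSq, gradNormSq, hf0, hDf0]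

theorem extRadius_inv (n : ℕ) (Λ : ℝ) : (extRadius n Λ)⁻¹ = (3 * n + 2) * Real.sqrt (Λ + 1) :=
  inv_inv _

theorem extRadius_pos (n : ℕ) {Λ : ℝ} (hΛ : 0 ≤ Λ) : 0 < extRadius n Λ := by
  rw [extRadius]
  have : 0 < Real.sqrt (Λ + 1) := Real.sqrt_pos.2 (by linarith)
  positivity

/-- Integration of the differential inequality along rays. -/
theorem jetNormSq_le {ρ Λ : ℝ} (hΛ : 0 ≤ Λ) (hf : DifferentiableOn ℂ f (ball 0 ρ))
    (hf0 : f 0 = 0) (hDf0 : fderiv ℂ f 0 = 0)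
    (hH : ∀ x ∈ ball (0 : EuclideanSpace ℂ (Fin n)) ρ,
      hessNormSq f x ≤ Λ * jetNormSq f x ^ (3 * n + 3)) (hz : z ∈ ball 0 ρ)
    (hzΛ : ‖z‖ < extRadius n Λ) :
    jetNormSq f z ≤ (1 - (extRadius n Λ)⁻¹ * ‖z‖) ^ (-(2 / (3 * (n : ℝ) + 2))) := by
  have hmem : ∀ s ∈ Icc (0 : ℝ) 1, s • z ∈ ball 0 ρ := by
    intro s hs
    rw [mem_ball_zero_iff] at hz ⊢
    rw [norm_smul, Real.norm_of_nonneg hs.1]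
    exact (mul_le_of_le_one_left (norm_nonneg _) hs.2).trans_lt hz
  -- With this exponent `e - 1` cancels the power in the differential inequality, so the derivative
  -- of `J ^ e` is at least `-‖z‖ / r_Λ`. The function `v` below is therefore monotone, and `v 0 ≤ v
  -- 1` is the estimate.
  set e : ℝ := -((3 * (n : ℝ) + 2) / 2) with he
  let v : ℝ → ℝ := fun s => jetNormSq f (s • z) ^ e + (extRadius n Λ)⁻¹ * ‖z‖ * s
  have hv : ∀ s ∈ Icc (0 : ℝ) 1, ∃ d, HasDerivAt v d s ∧ 0 ≤ d := by
    intro s hs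
    obtain ⟨d, hd, hd'⟩ := exists_hasDerivAt_jetNormSq hΛ hf hH (hmem s hs)
    have hJ : 0 < jetNormSq f (s • z) := zero_lt_one.trans_le (one_le_jetNormSq f _)
    refine ⟨_, (hd.rpow_const (p := e) (Or.inl hJ.ne')).add
      ((hasDerivAt_id s).const_mul ((extRadius n Λ)⁻¹ * ‖z‖)), ?_⟩
    rw [mul_one, extRadius_inv]
    set J := jetNormSq f (s • z)
    have h1 : d * J ^ (e - 1) ≤ 2 * ‖z‖ * Real.sqrt (Λ + 1) := by
      calc d * J ^ (e - 1) ≤ (2 * ‖z‖ * Real.sqrt (Λ + 1) * J ^ ((3 * (n : ℝ) + 4) / 2)) *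
            J ^ (e - 1) := mul_le_mul_of_nonneg_right hd' (Real.rpow_nonneg hJ.le _)
        _ = 2 * ‖z‖ * Real.sqrt (Λ + 1) := by
            rw [mul_assoc, ← Real.rpow_add hJ,
              show (3 * (n : ℝ) + 4) / 2 + (e - 1) = 0 by rw [he]; ring, Real.rpow_zero, mul_one]
    have h2 : (3 * (n : ℝ) + 2) / 2 * (d * J ^ (e - 1)) ≤
        (3 * (n : ℝ) + 2) / 2 * (2 * ‖z‖ * Real.sqrt (Λ + 1)) :=
      mul_le_mul_of_nonneg_left h1 (by positivity)
    rw [he] at h2 ⊢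
    nlinarith
  have hmono : MonotoneOn v (Icc 0 1) := by
    refine monotoneOn_of_deriv_nonneg (convex_Icc 0 1) ?_ ?_ ?_
    · exact fun s hs => (hv s hs).choose_spec.1.continuousAt.continuousWithinAt
    · exact fun s hs => (hv s (interior_subset hs)).choose_spec.1.differentiableAt.differentiableWithinAt
    · intro s hs
      obtain ⟨d, hd, hd0⟩ := hv s (interior_subset hs)
      rwa [hd.deriv]
  have h01 := hmono (left_mem_Icc.2 zero_le_one) (right_mem_Icc.2 zero_le_one) zero_le_one
  simp only [v, zero_smul, one_smul, jetNormSq_zero hf0 hDf0, Real.one_rpow, mul_zero, add_zero,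
    mul_one] at h01
  have hJ : 0 < jetNormSq f z := zero_lt_one.trans_le (one_le_jetNormSq f z)
  have hr := extRadius_pos n hΛ
  have hpos : 0 < 1 - (extRadius n Λ)⁻¹ * ‖z‖ := by
    rw [sub_pos, inv_mul_lt_iff₀ hr]
    linarith
  have h2 : 1 - (extRadius n Λ)⁻¹ * ‖z‖ ≤ jetNormSq f z ^ e := by linarith
  have hexp : e * (-(2 / (3 * (n : ℝ) + 2))) = 1 := by
    rw [he]
    have : (3 * (n : ℝ) + 2) ≠ 0 := by positivity
    field_simp
  calc jetNormSq f z = (jetNormSq f z ^ e) ^ (-(2 / (3 * (n : ℝ) + 2))) := by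
        rw [← Real.rpow_mul hJ.le, hexp, Real.rpow_one]
    _ ≤ _ := Real.rpow_le_rpow_of_nonpos hpos h2 (by
        rw [neg_nonpos]
        positivity)

end Radial

end KahlerGraph

end

noncomputable section

namespace KahlerGraph

open Metric Set Filter Topology

/-! ### Derivative bounds for solutions of holomorphic differential equations. -/

section HolomorphicODE

variable {W F : Type*} [NormedAddCommGroup W] [NormedSpace ℂ W]
  [NormedAddCommGroup F] [NormedSpace ℂ F]

/-- The iterated Lie derivatives of a linear map along a vector field. -/
def lieIter (X : W → W) (ℓ : W →L[ℂ] F) : ℕ → W → F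
  | 0 => ℓ
  | j + 1 => fun w => fderiv ℂ (lieIter X ℓ j) w (X w)

theorem contDiff_lieIter {X : W → W} (hX : ContDiff ℂ (⊤ : ℕ∞) X) (ℓ : W →L[ℂ] F) (j : ℕ) :
    ContDiff ℂ (⊤ : ℕ∞) (lieIter X ℓ j) := by
  induction j with
  | zero => exact ℓ.contDiff
  | succ j ih => exact (ih.fderiv_right (m := (⊤ : ℕ∞)) (by simp)).clm_apply hX

theorem differentiable_lieIter {X : W → W} (hX : ContDiff ℂ (⊤ : ℕ∞) X) (ℓ : W →L[ℂ] F) (j : ℕ) :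
    Differentiable ℂ (lieIter X ℓ j) :=
  (contDiff_lieIter hX ℓ j).differentiable (by simp)

/-- Each Lie derivative gives up `1 / K` of the radius. The Cauchy estimate then costs a factor `K`
and the field a factor `C`. -/
theorem norm_lieIter_le {X : W → W} (hX : ContDiff ℂ (⊤ : ℕ∞) X) {ℓ : W →L[ℂ] F}
    (hℓ : ∀ w, ‖ℓ w‖ ≤ ‖w‖) {M C : ℝ} (hC0 : 0 ≤ C)
    (hC : ∀ w, ‖w‖ ≤ M + 1 → ‖X w‖ ≤ C) {K : ℕ} (hK : 0 < K) (j : ℕ) :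
    ∀ w, ‖w‖ ≤ M + 1 - j / K → ‖lieIter X ℓ j w‖ ≤ (M + 1) * (K * C) ^ j := by
  have hK' : (0 : ℝ) < K := by exact_mod_cast hK
  induction j with
  | zero =>
    intro w hw
    simpa [lieIter] using (hℓ w).trans (by simpa using hw)
  | succ j ih =>
    intro w hw
    have hsub : ∀ x ∈ closedBall w (1 / (K : ℝ)), ‖lieIter X ℓ j x‖ ≤ (M + 1) * (K * C) ^ j := by
      intro x hx
      refine ih x ?_
      rw [mem_closedBall_iff_norm] at hx
      have h1 : ‖x‖ ≤ ‖w‖ + ‖x - w‖ := by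
        simpa using norm_add_le w (x - w)
      have h2 : ((j + 1 : ℕ) : ℝ) / K = j / K + 1 / K := by push_cast; ring
      linarith
    have hw' : ‖w‖ ≤ M + 1 := hw.trans (sub_le_self _ (by positivity))
    have hM : 0 ≤ M + 1 := (norm_nonneg w).trans hw'
    calc ‖lieIter X ℓ (j + 1) w‖ ≤ (M + 1) * (K * C) ^ j / (1 / (K : ℝ)) * ‖X w‖ :=
          norm_fderiv_apply_le (by positivity)
            (fun x _ => (differentiable_lieIter hX ℓ j).differentiableAt) hsub (X w)
      _ ≤ (M + 1) * (K * C) ^ j / (1 / (K : ℝ)) * C :=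
          mul_le_mul_of_nonneg_left (hC w hw') (by positivity)
      _ = _ := by
          field_simp
          ring

/-- Differentiating a function of `Y` in time is applying the Lie derivative along `X`. Time
derivatives are thus controlled by `X` on a ball in phase space, whatever the distance of `t` from
the boundary of the disc. -/
theorem iteratedDeriv_eq_lieIter {X : W → W} (hX : ContDiff ℂ (⊤ : ℕ∞) X) (ℓ : W →L[ℂ] F)
    {Y : ℂ → W} {ρ : ℝ} (hY : ∀ t ∈ ball (0 : ℂ) ρ, HasDerivAt Y (X (Y t)) t) (j : ℕ) :
    ∀ t ∈ ball (0 : ℂ) ρ, iteratedDeriv j (fun t => ℓ (Y t)) t = lieIter X ℓ j (Y t) := by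
  induction j with
  | zero => intro t _; rfl
  | succ j ih =>
    intro t ht
    have hev : iteratedDeriv j (fun t => ℓ (Y t)) =ᶠ[𝓝 t] fun t => lieIter X ℓ j (Y t) := by
      filter_upwards [isOpen_ball.mem_nhds ht] with s hs using ih s hs
    rw [iteratedDeriv_succ, hev.deriv_eq]
    exact ((differentiable_lieIter hX ℓ j (Y t)).hasFDerivAt.comp_hasDerivAt t (hY t ht)).deriv

/-- Bounded solutions of holomorphic differential equations have derivatives with factorial
bounds. -/
theorem norm_iteratedDeriv_le_of_ode {X : W → W} (hX : ContDiff ℂ (⊤ : ℕ∞) X) {ℓ : W →L[ℂ] F}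
    (hℓ : ∀ w, ‖ℓ w‖ ≤ ‖w‖) {M C : ℝ} (hC0 : 0 ≤ C)
    (hC : ∀ w, ‖w‖ ≤ M + 1 → ‖X w‖ ≤ C) {Y : ℂ → W} {ρ : ℝ}
    (hY : ∀ t ∈ ball (0 : ℂ) ρ, HasDerivAt Y (X (Y t)) t)
    (hM : ∀ t ∈ ball (0 : ℂ) ρ, ‖Y t‖ ≤ M) (j : ℕ) {t : ℂ} (ht : t ∈ ball (0 : ℂ) ρ) :
    ‖iteratedDeriv j (fun t => ℓ (Y t)) t‖ ≤
      (M + 1) * j.factorial * (Real.exp 1 * C) ^ j := by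
  have hM0 : 0 ≤ M := (norm_nonneg _).trans (hM t ht)
  rcases Nat.eq_zero_or_pos j with rfl | hj
  · simpa using ((hℓ _).trans (hM t ht)).trans (by linarith)
  rw [iteratedDeriv_eq_lieIter hX ℓ hY j t ht]
  have hj' : (0 : ℝ) < j := by exact_mod_cast hj
  -- Taking `K = j` spends the whole unit of room between `M + 1` and `M` in `j` equal steps, and `j
  -- ^ j ≤ e ^ j * j!` converts the result to a factorial bound.
  refine (norm_lieIter_le hX hℓ hC0 hC hj j _ ?_).trans ?_
  · rw [div_self hj'.ne']
    simpa using hM t ht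
  · have h := Real.pow_div_factorial_le_exp (j : ℝ) hj'.le j
    rw [div_le_iff₀ (by positivity)] at h
    have he : Real.exp 1 ^ j = Real.exp j := by rw [← Real.exp_nat_mul, mul_one]
    rw [mul_pow, mul_pow, he, mul_assoc]
    refine mul_le_mul_of_nonneg_left ?_ (by linarith)
    calc (j : ℝ) ^ j * C ^ j ≤ (Real.exp j * j.factorial) * C ^ j :=
          mul_le_mul_of_nonneg_right h (by positivity)
      _ = _ := by ring

end HolomorphicODE

/-! ### Taylor coefficients beyond the disc of definition. -/

section TaylorBound

variable {F : Type*} [NormedAddCommGroup F] [NormedSpace ℂ F] [CompleteSpace F]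

theorem differentiableOn_iteratedDeriv {h : ℂ → F} {U : Set ℂ} (hU : IsOpen U)
    (hh : DifferentiableOn ℂ h U) (j : ℕ) : DifferentiableOn ℂ (iteratedDeriv j h) U := by
  induction j with
  | zero => simpa using hh
  | succ j ih =>
    rw [iteratedDeriv_succ]
    exact ih.deriv hU

theorem norm_iteratedDeriv_zero_mul_pow_le {h : ℂ → F} {ρ B : ℝ} (hρ : 0 < ρ)
    (hh : DifferentiableOn ℂ h (ball 0 ρ)) (hB : ∀ t ∈ ball (0 : ℂ) ρ, ‖h t‖ ≤ B) (m : ℕ) :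
    ‖iteratedDeriv m h 0‖ * ρ ^ m ≤ m.factorial * B := by
  have htend : Tendsto (fun s : ℝ => ‖iteratedDeriv m h 0‖ * s ^ m) (𝓝[<] ρ)
      (𝓝 (‖iteratedDeriv m h 0‖ * ρ ^ m)) :=
    (continuous_const.mul (continuous_id.pow m)).continuousAt.tendsto.mono_left nhdsWithin_le_nhds
  refine le_of_tendsto htend ?_
  filter_upwards [Ioo_mem_nhdsLT hρ] with s hs
  have hsub : closedBall (0 : ℂ) s ⊆ ball 0 ρ := closedBall_subset_ball hs.2
  have := Complex.norm_iteratedDeriv_le_of_forall_mem_sphere_norm_le m hs.1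
    ((hh.mono hsub).mono closure_ball_subset_closedBall).diffContOnCl
    (fun t ht => hB t (hsub (sphere_subset_closedBall ht)))
  rwa [le_div_iff₀ (pow_pos hs.1 m)] at this

/-- Factorial bounds on all derivatives on a disc bound the Taylor coefficients as if the
function were bounded on a larger disc. -/
theorem norm_iteratedDeriv_mul_add_pow_le {h : ℂ → F} {ρ δ B : ℝ} (hρ : 0 < ρ) (hδ : 0 < δ)
    (hh : DifferentiableOn ℂ h (ball 0 ρ))
    (hB : ∀ j, ∀ t ∈ ball (0 : ℂ) ρ, ‖iteratedDeriv j h t‖ * δ ^ j ≤ B * j.factorial) (N : ℕ) :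
    ‖iteratedDeriv N h 0‖ * (ρ + δ) ^ N ≤ N.factorial * (B * (N + 1)) := by
  -- Cauchy's estimate at `0` for the derivative of order `N - m` bounds each term of the binomial
  -- expansion of `(ρ + δ) ^ N` by the same quantity. The `N + 1` terms produce the factor `N + 1`.
  have hterm : ∀ m ∈ Finset.range (N + 1),
      ‖iteratedDeriv N h 0‖ * (ρ ^ m * δ ^ (N - m) * (N.choose m : ℝ)) ≤ N.factorial * B := by
    intro m hm
    have hmN : m ≤ N := Nat.lt_succ_iff.1 (Finset.mem_range.1 hm)
    have h1 := norm_iteratedDeriv_zero_mul_pow_le hρ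
      (differentiableOn_iteratedDeriv isOpen_ball hh (N - m))
      (B := B * (N - m).factorial / δ ^ (N - m))
      (fun t ht => (le_div_iff₀ (by positivity)).2 (hB _ t ht)) m
    have h2 : iteratedDeriv m (iteratedDeriv (N - m) h) = iteratedDeriv N h := by
      rw [iteratedDeriv_eq_iterate, iteratedDeriv_eq_iterate, iteratedDeriv_eq_iterate,
        ← Function.iterate_add_apply, Nat.add_sub_cancel' hmN]
    rw [h2, mul_div_assoc', le_div_iff₀ (by positivity)] at h1
    have h3 : (N.choose m : ℝ) * m.factorial * (N - m).factorial = N.factorial := by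
      exact_mod_cast Nat.choose_mul_factorial_mul_factorial hmN
    calc ‖iteratedDeriv N h 0‖ * (ρ ^ m * δ ^ (N - m) * (N.choose m : ℝ))
        = (N.choose m : ℝ) * (‖iteratedDeriv N h 0‖ * ρ ^ m * δ ^ (N - m)) := by ring
      _ ≤ (N.choose m : ℝ) * (m.factorial * (B * (N - m).factorial)) :=
          mul_le_mul_of_nonneg_left h1 (by positivity)
      _ = (N.choose m : ℝ) * m.factorial * (N - m).factorial * B := by ring
      _ = _ := by rw [h3]
  rw [add_pow, Finset.mul_sum]
  refine (Finset.sum_le_sum hterm).trans (le_of_eq ?_)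
  simp
  ring

end TaylorBound

/-! ### Homogeneous Taylor expansions on balls. -/

section TaylorSeries

variable {E F : Type} [NormedAddCommGroup E] [NormedSpace ℂ E]
  [NormedAddCommGroup F] [NormedSpace ℂ F]

/-- The homogeneous Taylor polynomials at the origin. -/
def taylorTerm (f : E → F) (N : ℕ) (z : E) : F :=
  (N.factorial : ℂ)⁻¹ • iteratedFDeriv ℂ N f 0 (fun _ => z)

theorem differentiable_taylorTerm (f : E → F) (N : ℕ) : Differentiable ℂ (taylorTerm f N) := by
  refine Differentiable.const_smul (fun z => ?_) _
  have h1 : DifferentiableAt ℂ (fun v : Fin N → E => iteratedFDeriv ℂ N f 0 v) (fun _ => z) :=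
    ((iteratedFDeriv ℂ N f 0).hasFDerivAt _).differentiableAt
  exact h1.comp z (differentiableAt_pi.2 fun _ => differentiableAt_id)

theorem taylorTerm_smul (f : E → F) (N : ℕ) (c : ℂ) (z : E) :
    taylorTerm f N (c • z) = c ^ N • taylorTerm f N z := by
  simp only [taylorTerm]
  rw [(iteratedFDeriv ℂ N f 0).map_smul_univ (fun _ => c) (fun _ => z), smul_comm]
  simp

/-- The bound on Taylor polynomials which makes the Taylor series converge on a ball. -/
def TaylorBound (f : E → F) (ρ : ℝ) : Prop :=
  ∃ B : ℝ, ∀ N : ℕ, ∀ z : E, ‖z‖ ≤ 1 → ‖taylorTerm f N z‖ * ρ ^ N ≤ B * (N + 1)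

theorem TaylorBound.mono {f : E → F} {ρ ρ' : ℝ} (h : TaylorBound f ρ) (h0 : 0 ≤ ρ')
    (hle : ρ' ≤ ρ) : TaylorBound f ρ' := by
  obtain ⟨B, hB⟩ := h
  exact ⟨B, fun N z hz => (mul_le_mul_of_nonneg_left (pow_le_pow_left₀ h0 hle N)
    (norm_nonneg _)).trans (hB N z hz)⟩

/-- By homogeneity the terms are at most `B (N + 1) (‖z‖ / ρ) ^ N`. Cauchy's estimate between two
intermediate radii makes their derivatives summable too, so the series may be differentiated
termwise; the linear factor does not affect the radius. -/
theorem TaylorBound.differentiableOn [FiniteDimensional ℂ F] {f : E → F} {ρ : ℝ} (hρ : 0 < ρ) (h : TaylorBound f ρ) :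
    DifferentiableOn ℂ (fun z => ∑' N, taylorTerm f N z) (ball 0 ρ) := by
  obtain ⟨B, hB⟩ := h
  have : CompleteSpace F := FiniteDimensional.complete ℂ F
  have hB' : ∀ N : ℕ, ∀ z : E, ‖taylorTerm f N z‖ ≤ B * (N + 1) * (‖z‖ / ρ) ^ N := by
    intro N z
    rcases eq_or_ne z 0 with rfl | hz
    · have h0 : taylorTerm f N (0 : E) = (0 : ℂ) ^ N • taylorTerm f N 0 := by
        rw [← taylorTerm_smul, smul_zero]
      rcases Nat.eq_zero_or_pos N with rfl | hN
      · simpa using hB 0 0 (by simp)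
      · rw [h0]
        simp [hN.ne']
    · have hz' : 0 < ‖z‖ := norm_pos_iff.2 hz
      have hu : z = (‖z‖ : ℂ) • ((‖z‖ : ℂ)⁻¹ • z) := by
        rw [smul_inv_smul₀]
        exact_mod_cast hz'.ne'
      have hun : ‖(‖z‖ : ℂ)⁻¹ • z‖ ≤ 1 := by
        rw [norm_smul, norm_inv, Complex.norm_real, norm_norm, inv_mul_cancel₀ hz'.ne']
      have hb := hB N _ hun
      conv_lhs => rw [hu]
      rw [taylorTerm_smul, norm_smul, norm_pow, Complex.norm_real, norm_norm, div_pow,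
        mul_div_assoc', le_div_iff₀ (by positivity), mul_assoc, mul_comm]
      exact mul_le_mul_of_nonneg_right hb (by positivity)
  have hB0 : 0 ≤ B := by
    have := hB 0 0 (by simp)
    simp only [pow_zero, mul_one, Nat.cast_zero, zero_add] at this
    exact (norm_nonneg _).trans this
  have hsum : ∀ q : ℝ, 0 ≤ q → q < 1 → Summable fun N : ℕ => B * (N + 1) * q ^ N := by
    intro q hq0 hq1
    have hq : ‖q‖ < 1 := by rwa [Real.norm_of_nonneg hq0]
    have h1 := summable_pow_mul_geometric_of_norm_lt_one 1 hq
    have h2 := summable_geometric_of_norm_lt_one hq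
    have := (h1.add h2).mul_left B
    refine this.congr fun N => ?_
    simp only [pow_one]
    ring
  intro z hz
  rw [mem_ball_zero_iff] at hz
  obtain ⟨ρ₁, hzρ₁, hρ₁⟩ := exists_between hz
  obtain ⟨ρ₂, hρ₁₂, hρ₂⟩ := exists_between hρ₁
  have hρ₁0 : 0 < ρ₁ := (norm_nonneg z).trans_lt hzρ₁
  have hq0 : 0 ≤ ρ₂ / ρ := by
    have : 0 < ρ₂ := hρ₁0.trans hρ₁₂
    positivity
  have hq1 : ρ₂ / ρ < 1 := (div_lt_one hρ).2 hρ₂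
  refine (hasFDerivAt_tsum_of_isPreconnected
    (u := fun N : ℕ => B * (N + 1) * (ρ₂ / ρ) ^ N / (ρ₂ - ρ₁))
    ((hsum _ hq0 hq1).div_const _) (isOpen_ball (x := (0 : E)) (ε := ρ₁))
    ((convex_ball (0 : E) ρ₁).isPreconnected)
    (fun N x _ => (differentiable_taylorTerm f N x).hasFDerivAt) (fun N x hx => ?_)
    (mem_ball_self hρ₁0) ?_ (mem_ball_zero_iff.2 hzρ₁)).differentiableAt.differentiableWithinAt
  · refine norm_fderiv_le_div (by linarith) (fun y _ => differentiable_taylorTerm f N y)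
      fun y hy => (hB' N y).trans ?_
    rw [mem_ball_zero_iff] at hx
    rw [mem_closedBall_iff_norm] at hy
    have hy' : ‖y‖ ≤ ρ₂ := by
      have : ‖y‖ ≤ ‖x‖ + ‖y - x‖ := by simpa using norm_add_le x (y - x)
      linarith
    gcongr
  · refine Summable.of_norm_bounded (hsum 0 le_rfl one_pos) fun N => ?_
    simpa using hB' N 0

variable [FiniteDimensional ℂ E] [FiniteDimensional ℂ F]

theorem iteratedDeriv_line {f : E → F} {r : ℝ} (hr : 0 < r) (hf : DifferentiableOn ℂ f (ball 0 r))
    (N : ℕ) (z : E) :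
    iteratedDeriv N (fun t : ℂ => f (t • z)) 0 = (N.factorial : ℂ) • taylorTerm f N z := by
  let g : ℂ →L[ℂ] E := ContinuousLinearMap.toSpanSingleton ℂ z
  have hU : IsOpen (g ⁻¹' ball (0 : E) r) := isOpen_ball.preimage g.continuous
  have h0 : (0 : ℂ) ∈ g ⁻¹' ball (0 : E) r := by simp [hr]
  have h := g.iteratedFDerivWithin_comp_right (contDiffOn_of_differentiableOn isOpen_ball hf N)
    isOpen_ball.uniqueDiffOn hU.uniqueDiffOn h0 le_rfl
  rw [iteratedFDerivWithin_of_isOpen N hU h0, iteratedFDerivWithin_of_isOpen N isOpen_ball h0] at h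
  rw [iteratedDeriv_eq_iteratedFDeriv, taylorTerm, smul_inv_smul₀ (by exact_mod_cast
    N.factorial_ne_zero)]
  have h2 : (fun t : ℂ => f (t • z)) = f ∘ g := by
    funext t
    simp [g]
  rw [h2, h]
  simp [g]

theorem hasSum_taylorTerm {f : E → F} {r : ℝ} (hf : DifferentiableOn ℂ f (ball 0 r)) {z : E}
    (hz : z ∈ ball (0 : E) r) : HasSum (fun N => taylorTerm f N z) (f z) := by
  have hr := pos_of_mem_ball hz
  have : CompleteSpace F := FiniteDimensional.complete ℂ F
  rw [mem_ball_zero_iff] at hz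
  have hn := norm_nonneg z
  -- A radius with `1 < R` and `R * ‖z‖ < r` that is also meaningful for `z = 0`.
  set R := 2 * r / (‖z‖ + r) with hR
  have hd : DifferentiableOn ℂ (fun t : ℂ => f (t • z)) (ball 0 R) := by
    refine hf.comp (differentiable_id.smul_const z).differentiableOn fun t ht => ?_
    rw [mem_ball_zero_iff] at ht ⊢
    rw [hR, lt_div_iff₀ (by linarith)] at ht
    change ‖t • z‖ < r
    rw [norm_smul]
    nlinarith [norm_nonneg t]
  have h1 : (1 : ℂ) ∈ ball (0 : ℂ) R := by
    rw [mem_ball_zero_iff, norm_one, hR, lt_div_iff₀ (by linarith)]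
    linarith
  have h := Complex.hasSum_taylorSeries_on_ball hd h1
  simp only [sub_zero, one_pow, one_smul] at h
  convert h using 2 with N
  rw [iteratedDeriv_line hr hf, inv_smul_smul₀ (by exact_mod_cast N.factorial_ne_zero)]

theorem TaylorBound.of_norm_iteratedDeriv_le {f : E → F} {r ρ B : ℝ} (hr : 0 < r)
    (hf : DifferentiableOn ℂ f (ball 0 r))
    (h : ∀ N : ℕ, ∀ z : E, ‖z‖ ≤ 1 →
      ‖iteratedDeriv N (fun t : ℂ => f (t • z)) 0‖ * ρ ^ N ≤ N.factorial * (B * (N + 1))) :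
    TaylorBound f ρ := by
  refine ⟨B, fun N z hz => ?_⟩
  have := h N z hz
  rw [iteratedDeriv_line hr hf, norm_smul, Complex.norm_natCast, mul_assoc] at this
  exact le_of_mul_le_mul_left this (by exact_mod_cast N.factorial_pos)

/-- The starting point of the continuation: half the radius, so that compactness bounds `f`. -/
theorem exists_taylorBound {f : E → F} {r : ℝ} (hr : 0 < r)
    (hf : DifferentiableOn ℂ f (ball 0 r)) : TaylorBound f (r / 2) := by
  have : ProperSpace E := FiniteDimensional.proper ℂ E
  have : CompleteSpace F := FiniteDimensional.complete ℂ F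
  have hsub : closedBall (0 : E) (r / 2) ⊆ ball 0 r := closedBall_subset_ball (by linarith)
  obtain ⟨B, hB⟩ := (isCompact_closedBall (0 : E) (r / 2)).exists_bound_of_continuousOn
    (hf.continuousOn.mono hsub)
  refine TaylorBound.of_norm_iteratedDeriv_le (B := B) hr hf fun N z hz => ?_
  have hmem : ∀ t ∈ ball (0 : ℂ) (r / 2), t • z ∈ closedBall (0 : E) (r / 2) := by
    intro t ht
    rw [mem_ball_zero_iff] at ht
    rw [mem_closedBall_zero_iff, norm_smul]
    nlinarith [norm_nonneg t, norm_nonneg z]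
  have hB0 : 0 ≤ B := (norm_nonneg _).trans (hB 0 (mem_closedBall_self (by linarith)))
  refine (norm_iteratedDeriv_zero_mul_pow_le (by linarith) (hf.comp
    (differentiable_id.smul_const z).differentiableOn fun t ht => hsub (hmem t ht))
    (fun t ht => hB _ (hmem t ht)) N).trans ?_
  have : (0 : ℝ) ≤ N := N.cast_nonneg
  exact mul_le_mul_of_nonneg_left (by nlinarith) (by positivity)

end TaylorSeries

end KahlerGraph

end

noncomputable section

namespace KahlerGraph

open Matrix Metric Set Filter Topology

/-! ### Rigidity with a remainder. -/

section Contraction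

variable {E : Type*} [NormedAddCommGroup E] [NormedSpace ℂ E] {ι ι' κ : Type*} [Fintype ι]
  [Fintype ι'] [Fintype κ]

theorem differentiableOn_toLp {a : E → ι → ℂ} {U : Set E}
    (ha : ∀ i, DifferentiableOn ℂ (fun x => a x i) U) :
    DifferentiableOn ℂ (fun x => (WithLp.toLp 2 (a x) : EuclideanSpace ℂ ι)) U :=
  (EuclideanSpace.equiv ι ℂ).symm.differentiable.comp_differentiableOn (differentiableOn_pi.2 ha)

/-- Rigidity applied to the concatenation of `a` and `a'`, followed by projection to the first
block. The remainder `a'` accommodates an inequality whose defect is itself a holomorphic sum of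
squares. -/
theorem exists_linear_contraction_of_add {a : E → ι → ℂ} {a' : E → ι' → ℂ} {b : E → κ → ℂ}
    {r : ℝ} (ha : ∀ i, DifferentiableOn ℂ (fun x => a x i) (ball 0 r))
    (ha' : ∀ i, DifferentiableOn ℂ (fun x => a' x i) (ball 0 r))
    (hb : ∀ i, DifferentiableOn ℂ (fun x => b x i) (ball 0 r))
    (hab : ∀ z ∈ ball (0 : E) r, ∑ i, ‖a z i‖ ^ 2 + ∑ i, ‖a' z i‖ ^ 2 = ∑ i, ‖b z i‖ ^ 2) :
    ∃ L : (κ → ℂ) →ₗ[ℂ] (ι → ℂ), (∀ z ∈ ball (0 : E) r, a z = L (b z)) ∧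
      ∀ v, ∑ i, ‖L v i‖ ^ 2 ≤ ∑ i, ‖v i‖ ^ 2 := by
  have hs : ∀ i, DifferentiableOn ℂ (fun x => Sum.elim (a x) (a' x) i) (ball 0 r) := by
    rintro (i | i)
    · exact ha i
    · exact ha' i
  obtain ⟨L, hL, hL'⟩ := exists_linear_contraction (differentiableOn_toLp hs)
    (differentiableOn_toLp hb) (fun z hz => by
      rw [EuclideanSpace.norm_eq, EuclideanSpace.norm_eq]
      congr 1
      simpa [Fintype.sum_sum_type] using hab z hz)
  let pr : EuclideanSpace ℂ (ι ⊕ ι') →ₗ[ℂ] (ι → ℂ) :=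
    { toFun := fun v i => v (Sum.inl i)
      map_add' := fun _ _ => rfl
      map_smul' := fun _ _ => rfl }
  refine ⟨pr ∘ₗ L ∘ₗ (WithLp.linearEquiv 2 ℂ (κ → ℂ)).symm.toLinearMap, fun z hz => ?_, fun v => ?_⟩
  · funext i
    exact congrArg (fun v => v (Sum.inl i)) (hL z hz)
  · have h := hL' ((WithLp.linearEquiv 2 ℂ (κ → ℂ)).symm v)
    have h2 := pow_le_pow_left₀ (norm_nonneg _) h 2
    rw [EuclideanSpace.norm_sq_eq, EuclideanSpace.norm_sq_eq, Fintype.sum_sum_type] at h2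
    exact (le_add_of_nonneg_right (Finset.sum_nonneg fun _ _ => sq_nonneg _)).trans h2

end Contraction

/-! ### The curvature equation as an equality of norms. -/

section Vectors

variable {n k : ℕ} {f : EuclideanSpace ℂ (Fin n) → EuclideanSpace ℂ (Fin k)}
  {U : Set (EuclideanSpace ℂ (Fin n))} {z : EuclideanSpace ℂ (Fin n)}

/-- Indices of the components of the second fundamental form with denominators cleared. -/
abbrev SffIndex (n k : ℕ) : Type :=
  ((Unit ⊕ Fin n) ⊕ Fin k) × ((Unit ⊕ Fin n) ⊕ Fin k) ×
    (Unit ⊕ Fin n → (Unit ⊕ Fin n) ⊕ Fin k) × (Unit ⊕ Fin n → (Unit ⊕ Fin n) ⊕ Fin k) ×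
    (Unit ⊕ Fin n → ((Unit ⊕ Fin n) ⊕ Fin k) ⊕ Unit)

/-- Indices of the components of `G ⊗ G ⊗ G`. -/
abbrev CubeIndex (n k : ℕ) : Type :=
  (Unit ⊕ Fin n → (Unit ⊕ Fin n) ⊕ Fin k) × (Unit ⊕ Fin n → (Unit ⊕ Fin n) ⊕ Fin k) ×
    (Unit ⊕ Fin n → (Unit ⊕ Fin n) ⊕ Fin k)

/-- The second fundamental form with denominators cleared. -/
def sffVec (f : EuclideanSpace ℂ (Fin n) → EuclideanSpace ℂ (Fin k))
    (z : EuclideanSpace ℂ (Fin n)) (x : SffIndex n k) : ℂ :=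
  graphCoord f x.1 z * (graphCoord f x.2.1 z *
    augMinor f x.2.2.2.2 (pluckerWedge f x.2.2.1 x.2.2.2.1 z) z)

/-- The components of `G ⊗ G ⊗ G`. -/
def cubeVec (f : EuclideanSpace ℂ (Fin n) → EuclideanSpace ℂ (Fin k))
    (z : EuclideanSpace ℂ (Fin n)) (x : CubeIndex n k) : ℂ :=
  plucker f x.1 z * (plucker f x.2.1 z * plucker f x.2.2 z)

/-- The components of `√(2Λ) G ⊗ G ⊗ G ⊗ F`. -/
def polVec (Λ : ℝ) (f : EuclideanSpace ℂ (Fin n) → EuclideanSpace ℂ (Fin k))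
    (z : EuclideanSpace ℂ (Fin n)) (x : CubeIndex n k × ((Unit ⊕ Fin n) ⊕ Fin k)) : ℂ :=
  Real.sqrt (2 * Λ) * (cubeVec f z x.1 * graphCoord f x.2 z)

theorem sum_norm_sq_sffVec (f : EuclideanSpace ℂ (Fin n) → EuclideanSpace ℂ (Fin k))
    (z : EuclideanSpace ℂ (Fin n)) : ∑ x, ‖sffVec f z x‖ ^ 2 = graphNormSq f z ^ 2 *
      ∑ p, ∑ q, ∑ c, ‖augMinor f c (pluckerWedge f p q z) z‖ ^ 2 := by
  simp only [sffVec, norm_mul, mul_pow, Fintype.sum_prod_type, ← Finset.mul_sum, ← Finset.sum_mul]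
  rw [pow_two, mul_assoc]
  rfl

theorem sum_norm_sq_cubeVec (f : EuclideanSpace ℂ (Fin n) → EuclideanSpace ℂ (Fin k))
    (z : EuclideanSpace ℂ (Fin n)) : ∑ x, ‖cubeVec f z x‖ ^ 2 = pluckerNormSq f z ^ 3 := by
  simp only [cubeVec, norm_mul, mul_pow, Fintype.sum_prod_type, ← Finset.mul_sum,
    ← Finset.sum_mul]
  rw [pow_succ', pow_two]
  rfl

theorem sum_norm_sq_polVec {Λ : ℝ} (hΛ : 0 ≤ Λ)
    (f : EuclideanSpace ℂ (Fin n) → EuclideanSpace ℂ (Fin k)) (z : EuclideanSpace ℂ (Fin n)) :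
    ∑ x, ‖polVec Λ f z x‖ ^ 2 = 2 * Λ * (pluckerNormSq f z ^ 3 * graphNormSq f z) := by
  rw [Fintype.sum_prod_type]
  simp only [polVec, norm_mul, mul_pow, ← Finset.mul_sum, ← Finset.sum_mul]
  rw [sum_norm_sq_cubeVec, Complex.norm_real, Real.norm_of_nonneg (Real.sqrt_nonneg _),
    Real.sq_sqrt (by linarith)]
  rfl

theorem differentiableOn_sffVec (hU : IsOpen U) (hf : DifferentiableOn ℂ f U) (x) :
    DifferentiableOn ℂ (fun z => sffVec f z x) U :=
  (differentiableOn_graphCoord hf hU _).mul ((differentiableOn_graphCoord hf hU _).mul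
    (differentiableOn_augMinor hU hf _ fun i => differentiableOn_pluckerWedge hU hf _ _ i))

theorem differentiableOn_cubeVec (hU : IsOpen U) (hf : DifferentiableOn ℂ f U) (x) :
    DifferentiableOn ℂ (fun z => cubeVec f z x) U :=
  (differentiableOn_plucker hU hf _).mul
    ((differentiableOn_plucker hU hf _).mul (differentiableOn_plucker hU hf _))

theorem differentiableOn_polVec (Λ : ℝ) (hU : IsOpen U) (hf : DifferentiableOn ℂ f U) (x) :
    DifferentiableOn ℂ (fun z => polVec Λ f z x) U :=
  ((differentiableOn_cubeVec hU hf _).mul (differentiableOn_graphCoord hf hU _)).const_mul _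

theorem sum_norm_sq_graphVec (f : EuclideanSpace ℂ (Fin n) → EuclideanSpace ℂ (Fin k))
    (z : EuclideanSpace ℂ (Fin n)) : ∑ s, ‖graphVec f z s‖ ^ 2 = graphNormSq f z := by
  rw [Fin.sum_univ_succ, Fin.sum_univ_add, graphNormSq_eq, EuclideanSpace.norm_sq_eq,
    EuclideanSpace.norm_sq_eq]
  simp [graphVec, add_assoc]

theorem differentiableOn_graphVec (hf : DifferentiableOn ℂ f U) (s) :
    DifferentiableOn ℂ (fun z => graphVec f z s) U := by
  unfold graphVec
  refine Fin.cases ?_ (fun i => ?_) s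
  · exact differentiableOn_const _
  · refine Fin.addCases (fun j => ?_) (fun a => ?_) i
    · simpa using differentiableOn_coord j
    · simpa using differentiableOn_apply hf a

theorem star_dotProduct_self {ι : Type*} [Fintype ι] (v : ι → ℂ) :
    star v ⬝ᵥ v = ((∑ i, ‖v i‖ ^ 2 : ℝ) : ℂ) := by
  rw [ofReal_sum_norm_sq, dotProduct]
  exact Finset.sum_congr rfl fun i _ => mul_comm _ _

open scoped MatrixOrder Matrix.Norms.L2Operator in
theorem exists_eq_conjTranspose_mul_self {ι : Type*} [Fintype ι] [DecidableEq ι]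
    {M : Matrix ι ι ℂ} (hM : M.PosSemidef) : ∃ B : Matrix ι ι ℂ, M = Bᴴ * B :=
  CStarAlgebra.nonneg_iff_eq_star_mul_self.1 hM.nonneg

/-- The curvature equation, with denominators cleared, expresses the second fundamental form as
a linear contraction of polynomials in the first jet. -/
theorem exists_linear_sffVec {r Λ : ℝ} (hΛ : 0 ≤ Λ) (hf : DifferentiableOn ℂ f (ball 0 r))
    {A : Matrix (Fin (n + k + 1)) (Fin (n + k + 1)) ℂ}
    (hAΛ : ((Λ : ℂ) • (1 : Matrix (Fin (n + k + 1)) (Fin (n + k + 1)) ℂ) - A).PosSemidef)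
    (heq : ∀ z ∈ ball (0 : EuclideanSpace ℂ (Fin n)) r,
      (n : ℂ) * (n + 1) - 1 / 4 * scalarCurvature (graphMetric f) z
        = dotProduct (star (graphVec f z)) (mulVec A (graphVec f z))
          / ((1 + ‖z‖ ^ 2 + ‖f z‖ ^ 2 : ℝ) : ℂ)) :
    ∃ L : (CubeIndex n k × ((Unit ⊕ Fin n) ⊕ Fin k) → ℂ) →ₗ[ℂ] (SffIndex n k → ℂ),
      (∀ z ∈ ball (0 : EuclideanSpace ℂ (Fin n)) r, sffVec f z = L (polVec Λ f z)) ∧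
      ∀ v, ∑ i, ‖L v i‖ ^ 2 ≤ ∑ i, ‖v i‖ ^ 2 := by
  -- With `Λ - A = B* B`, the form `F* A F` equals `Λ |F|² - |B F|²`, so the defect is a holomorphic
  -- sum of squares.
  obtain ⟨B, hB⟩ := exists_eq_conjTranspose_mul_self hAΛ
  have hquad : ∀ z, star (graphVec f z) ⬝ᵥ (A *ᵥ graphVec f z) =
      ((Λ * graphNormSq f z - ∑ s, ‖(B *ᵥ graphVec f z) s‖ ^ 2 : ℝ) : ℂ) := by
    intro z
    have h1 : star (graphVec f z) ⬝ᵥ ((Bᴴ * B) *ᵥ graphVec f z) =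
        ((∑ s, ‖(B *ᵥ graphVec f z) s‖ ^ 2 : ℝ) : ℂ) := by
      rw [← star_dotProduct_self, ← mulVec_mulVec, dotProduct_mulVec, star_mulVec]
    rw [← hB, sub_mulVec, smul_mulVec, one_mulVec, dotProduct_sub, dotProduct_smul,
      star_dotProduct_self, sum_norm_sq_graphVec] at h1
    rw [Complex.ofReal_sub, ← h1]
    simp
  refine exists_linear_contraction_of_add (a := sffVec f) (b := polVec Λ f)
    -- The defect `√2 G ⊗ G ⊗ G ⊗ BF`, whose squared norm is the term moved to the left of the
    -- cleared equation.
    (a' := fun z (x : CubeIndex n k × Fin (n + k + 1)) =>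
      Real.sqrt 2 * (cubeVec f z x.1 * (B *ᵥ graphVec f z) x.2))
    (differentiableOn_sffVec isOpen_ball hf) (fun x => ?_)
    (differentiableOn_polVec Λ isOpen_ball hf) fun z hz => ?_
  · refine ((differentiableOn_cubeVec isOpen_ball hf _).mul ?_).const_mul _
    simp only [mulVec, dotProduct]
    exact DifferentiableOn.fun_sum fun s _ => (differentiableOn_graphVec hf s).const_mul _
  · have h := heq z hz
    rw [scalarCurvature_graphMetric isOpen_ball hf hz, hquad, ← graphNormSq_eq,
      ← Complex.ofReal_div] at h
    have h2 := Complex.ofReal_injective h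
    have hN := one_le_graphNormSq f z
    have hT := one_le_pluckerNormSq f z
    have hN0 : graphNormSq f z ≠ 0 := by linarith
    have hT0 : pluckerNormSq f z ≠ 0 := by linarith
    have hrem : ∑ x : CubeIndex n k × Fin (n + k + 1),
        ‖(Real.sqrt 2 * (cubeVec f z x.1 * (B *ᵥ graphVec f z) x.2) : ℂ)‖ ^ 2 =
        2 * (pluckerNormSq f z ^ 3 * ∑ s, ‖(B *ᵥ graphVec f z) s‖ ^ 2) := by
      rw [Fintype.sum_prod_type]
      simp only [norm_mul, mul_pow, ← Finset.mul_sum, ← Finset.sum_mul]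
      rw [sum_norm_sq_cubeVec, Complex.norm_real, Real.norm_of_nonneg (Real.sqrt_nonneg _),
        Real.sq_sqrt (by norm_num)]
    rw [hrem, sum_norm_sq_sffVec, sum_norm_sq_polVec hΛ]
    rw [div_eq_div_iff (by positivity) hN0] at h2
    linear_combination h2

/-- The pointwise estimate for maps satisfying the linear relation. -/
theorem hessNormSq_le_of_linear (hU : IsOpen U) (hf : DifferentiableOn ℂ f U) (hz : z ∈ U) {Λ : ℝ}
    (hΛ : 0 ≤ Λ)
    {L : (CubeIndex n k × ((Unit ⊕ Fin n) ⊕ Fin k) → ℂ) →ₗ[ℂ] (SffIndex n k → ℂ)}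
    (hL : ∀ v, ∑ i, ‖L v i‖ ^ 2 ≤ ∑ i, ‖v i‖ ^ 2) (h : sffVec f z = L (polVec Λ f z)) :
    hessNormSq f z ≤ Λ * jetNormSq f z ^ (3 * n + 3) := by
  refine hessNormSq_le hU hf hz hΛ ?_
  rw [← sum_norm_sq_sffVec, ← sum_norm_sq_polVec hΛ, h]
  exact hL _

/-- The index of a second derivative among the components of `sffVec`. -/
def hessIndex (i l : Fin n) (a : Fin k) : SffIndex n k :=
  (Sum.inl (Sum.inl ()), Sum.inl (Sum.inl ()), selector none, selector (some (l, a)),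
    augSelector i)

/-- Both factors of `F` are taken to be its first coordinate `1`. Through the linear relation,
second derivatives become polynomials in the first jet. -/
theorem sffVec_hessIndex (hU : IsOpen U) (hf : DifferentiableOn ℂ f U) (hz : z ∈ U)
    (i l : Fin n) (a : Fin k) :
    sffVec f z (hessIndex i l a) = pderiv i (pderiv l f) z a := by
  have h := (hasFDerivAt_coord ((differentiableOn_pderiv hU hf l).differentiableAt
    (hU.mem_nhds hz)) a).fderiv
  have h2 : pderiv i (fun x => pderiv l f x a) z = pderiv i (pderiv l f) z a := by
    simp only [pderiv] at h ⊢
    rw [h]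
    rfl
  rw [← h2, ← pluckerWedge_none_some]
  simp [sffVec, hessIndex, graphCoord, augMinor_augSelector]

end Vectors

end KahlerGraph

end

noncomputable section

namespace KahlerGraph

open Matrix Metric Set Filter Topology

/-! ### The differential equation of the first jet along rays. -/

section JetSpace

variable {n k : ℕ}

/-- The space of first jets of maps from `ℂⁿ` to `ℂᵏ`. -/
abbrev JetSpace (n k : ℕ) : Type :=
  EuclideanSpace ℂ (Fin n) × EuclideanSpace ℂ (Fin k) × (Fin n → EuclideanSpace ℂ (Fin k))

/-- The first jet of `f` at `z`. -/
def jet (f : EuclideanSpace ℂ (Fin n) → EuclideanSpace ℂ (Fin k))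
    (z : EuclideanSpace ℂ (Fin n)) : JetSpace n k := (z, f z, fun i => pderiv i f z)

/-- `graphCoord` as a function on the jet space. -/
def jetSpaceCoord (w : JetSpace n k) (α : (Unit ⊕ Fin n) ⊕ Fin k) : ℂ :=
  Sum.elim (Sum.elim (fun _ => 1) (fun j => w.1 j)) (fun a => w.2.1 a) α

/-- `jetMatrix` as a function on the jet space. -/
def jetSpaceMatrix (w : JetSpace n k) : Matrix (Unit ⊕ Fin n) (Fin k) ℂ :=
  of fun i a => Sum.elim (fun _ => w.2.1 a - ∑ j, w.1 j * w.2.2 j a) (fun l => w.2.2 l a) i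

/-- `plucker` as a function on the jet space. -/
def jetSpacePlucker (w : JetSpace n k) (p : Unit ⊕ Fin n → (Unit ⊕ Fin n) ⊕ Fin k) : ℂ :=
  ((fromCols 1 (jetSpaceMatrix w)).submatrix id p).det

/-- `polVec` as a function on the jet space. -/
def jetSpacePolVec (Λ : ℝ) (w : JetSpace n k)
    (x : CubeIndex n k × ((Unit ⊕ Fin n) ⊕ Fin k)) : ℂ :=
  Real.sqrt (2 * Λ) * ((jetSpacePlucker w x.1.1 * (jetSpacePlucker w x.1.2.1 *
    jetSpacePlucker w x.1.2.2)) * jetSpaceCoord w x.2)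

theorem jetSpacePolVec_jet (Λ : ℝ) (f : EuclideanSpace ℂ (Fin n) → EuclideanSpace ℂ (Fin k))
    (z : EuclideanSpace ℂ (Fin n)) : jetSpacePolVec Λ (jet f z) = polVec Λ f z := rfl

theorem contDiff_euclideanSpace_apply {E ι : Type*} [NormedAddCommGroup E] [NormedSpace ℂ E]
    [Fintype ι] {h : E → EuclideanSpace ℂ ι} {m : WithTop ℕ∞} (hh : ContDiff ℂ m h) (i : ι) :
    ContDiff ℂ m fun x => h x i := contDiff_euclidean.1 hh i

theorem contDiff_jetSpace_slope (j : Fin n) (a : Fin k) :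
    ContDiff ℂ (⊤ : ℕ∞) fun w : JetSpace n k => w.2.2 j a :=
  contDiff_euclideanSpace_apply
    ((contDiff_apply ℂ _ j).comp (contDiff_snd.comp contDiff_snd)) a

theorem contDiff_jetSpaceCoord (α : (Unit ⊕ Fin n) ⊕ Fin k) :
    ContDiff ℂ (⊤ : ℕ∞) fun w : JetSpace n k => jetSpaceCoord w α := by
  rcases α with (u | j) | a
  · exact contDiff_const
  · exact contDiff_euclideanSpace_apply contDiff_fst j
  · exact contDiff_euclideanSpace_apply (contDiff_fst.comp contDiff_snd) a

theorem contDiff_jetSpaceMatrix (i : Unit ⊕ Fin n) (a : Fin k) :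
    ContDiff ℂ (⊤ : ℕ∞) fun w : JetSpace n k => jetSpaceMatrix w i a := by
  rcases i with u | l
  · exact (contDiff_jetSpaceCoord (Sum.inr a)).sub (ContDiff.sum fun j _ =>
      (contDiff_jetSpaceCoord (Sum.inl (Sum.inr j))).mul (contDiff_jetSpace_slope j a))
  · exact contDiff_jetSpace_slope l a

theorem contDiff_jetSpacePlucker (p : Unit ⊕ Fin n → (Unit ⊕ Fin n) ⊕ Fin k) :
    ContDiff ℂ (⊤ : ℕ∞) fun w : JetSpace n k => jetSpacePlucker w p := by
  have h : ∀ i c, ContDiff ℂ (⊤ : ℕ∞) fun w : JetSpace n k =>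
      fromCols (1 : Matrix (Unit ⊕ Fin n) (Unit ⊕ Fin n) ℂ) (jetSpaceMatrix w) i c := by
    rintro i (c | a)
    · exact contDiff_const
    · exact contDiff_jetSpaceMatrix i a
  simp only [jetSpacePlucker, det_apply]
  exact ContDiff.sum fun σ _ => (contDiff_prod fun i _ => h _ _).const_smul _

theorem contDiff_jetSpacePolVec (Λ : ℝ) :
    ContDiff ℂ (⊤ : ℕ∞) (jetSpacePolVec Λ : JetSpace n k → _) :=
  contDiff_pi.2 fun _ => contDiff_const.mul (((contDiff_jetSpacePlucker _).mul
    ((contDiff_jetSpacePlucker _).mul (contDiff_jetSpacePlucker _))).mul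
      (contDiff_jetSpaceCoord _))

/-- The vector field on the jet space which the jets of a solution follow along rays. -/
def jetField (Λ : ℝ)
    (L : (CubeIndex n k × ((Unit ⊕ Fin n) ⊕ Fin k) → ℂ) →ₗ[ℂ] (SffIndex n k → ℂ))
    (ζ : EuclideanSpace ℂ (Fin n)) (w : JetSpace n k) : JetSpace n k :=
  (ζ, ∑ i, ζ i • w.2.2 i, fun l => WithLp.toLp 2 fun a =>
    ∑ i, ζ i * L (jetSpacePolVec Λ w) (hessIndex i l a))

variable (Λ : ℝ) (L : (CubeIndex n k × ((Unit ⊕ Fin n) ⊕ Fin k) → ℂ) →ₗ[ℂ] (SffIndex n k → ℂ))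

theorem contDiff_uncurry_jetField :
    ContDiff ℂ (⊤ : ℕ∞) fun p : EuclideanSpace ℂ (Fin n) × JetSpace n k =>
      jetField Λ L p.1 p.2 := by
  refine contDiff_fst.prodMk (ContDiff.prodMk (ContDiff.sum fun i _ => ?_) (contDiff_pi.2 fun l =>
    contDiff_euclidean.2 fun a => ?_))
  · exact (contDiff_euclideanSpace_apply contDiff_fst i).smul
      ((contDiff_apply ℂ _ i).comp ((contDiff_snd.comp contDiff_snd).comp contDiff_snd))
  · change ContDiff ℂ (⊤ : ℕ∞) fun p : EuclideanSpace ℂ (Fin n) × JetSpace n k =>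
      ∑ i, p.1 i * L (jetSpacePolVec Λ p.2) (hessIndex i l a)
    refine ContDiff.sum fun i _ => ?_
    exact (contDiff_euclideanSpace_apply contDiff_fst i).mul ((contDiff_apply ℂ ℂ _).comp
      (L.toContinuousLinearMap.contDiff.comp ((contDiff_jetSpacePolVec Λ).comp contDiff_snd)))

theorem contDiff_jetField (ζ : EuclideanSpace ℂ (Fin n)) :
    ContDiff ℂ (⊤ : ℕ∞) (jetField Λ L ζ) :=
  (contDiff_uncurry_jetField Λ L).comp (contDiff_const.prodMk contDiff_id)

/-- Compactness in the direction and the jet jointly: the gain in radius must not depend on the ray.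
-/
theorem exists_norm_jetField_le (M : ℝ) :
    ∃ C : ℝ, 0 ≤ C ∧ ∀ ζ : EuclideanSpace ℂ (Fin n), ‖ζ‖ ≤ 1 →
      ∀ w : JetSpace n k, ‖w‖ ≤ M → ‖jetField Λ L ζ w‖ ≤ C := by
  obtain ⟨C, hC⟩ := ((isCompact_closedBall (0 : EuclideanSpace ℂ (Fin n)) 1).prod
    (isCompact_closedBall (0 : JetSpace n k) M)).exists_bound_of_continuousOn
    (contDiff_uncurry_jetField Λ L).continuous.continuousOn
  exact ⟨max C 0, le_max_right _ _, fun ζ hζ w hw => (hC (ζ, w)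
    ⟨mem_closedBall_zero_iff.2 hζ, mem_closedBall_zero_iff.2 hw⟩).trans (le_max_left _ _)⟩

theorem fderiv_eq_sum_pderiv {F : Type*} [NormedAddCommGroup F] [NormedSpace ℂ F]
    (g : EuclideanSpace ℂ (Fin n) → F) (z ζ : EuclideanSpace ℂ (Fin n)) :
    fderiv ℂ g z ζ = ∑ i, ζ i • pderiv i g z := by
  conv_lhs => rw [← (EuclideanSpace.basisFun (Fin n) ℂ).sum_repr ζ]
  simp [pderiv]

variable {Λ L}

/-- The system closes at first order because the linear relation expresses the derivatives of the
slopes through the jet itself. -/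
theorem hasDerivAt_jet {g : EuclideanSpace ℂ (Fin n) → EuclideanSpace ℂ (Fin k)}
    {U : Set (EuclideanSpace ℂ (Fin n))} (hU : IsOpen U) (hg : DifferentiableOn ℂ g U)
    (hL : ∀ z ∈ U, sffVec g z = L (polVec Λ g z)) {ζ : EuclideanSpace ℂ (Fin n)} {t : ℂ}
    (ht : t • ζ ∈ U) :
    HasDerivAt (fun t : ℂ => jet g (t • ζ)) (jetField Λ L ζ (jet g (t • ζ))) t := by
  have hray : HasDerivAt (fun t : ℂ => t • ζ) ζ t := by
    simpa using (hasDerivAt_id t).smul_const ζ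
  have hcomp : ∀ {h : EuclideanSpace ℂ (Fin n) → EuclideanSpace ℂ (Fin k)},
      DifferentiableOn ℂ h U → HasDerivAt (fun t : ℂ => h (t • ζ))
        (∑ i, ζ i • pderiv i h (t • ζ)) t := by
    intro h hh
    rw [← fderiv_eq_sum_pderiv]
    exact (hh.differentiableAt (hU.mem_nhds ht)).hasFDerivAt.comp_hasDerivAt t hray
  refine hray.prodMk ((hcomp hg).prodMk (hasDerivAt_pi.2 fun l => ?_))
  have hl : (jetField Λ L ζ (jet g (t • ζ))).2.2 l =
      ∑ i, ζ i • pderiv i (pderiv l g) (t • ζ) := by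
    ext a
    simp [jetField, jetSpacePolVec_jet, ← hL _ ht, sffVec_hessIndex hU hg ht]
  exact (hcomp (differentiableOn_pderiv hU hg l)).congr_deriv hl.symm

theorem norm_jet_le (g : EuclideanSpace ℂ (Fin n) → EuclideanSpace ℂ (Fin k))
    {z : EuclideanSpace ℂ (Fin n)} {M : ℝ} (hM : jetNormSq g z ≤ M) : ‖jet g z‖ ≤ M := by
  have h1 := (one_le_jetNormSq g z).trans hM
  have key : ∀ {x : ℝ}, 0 ≤ x → x ^ 2 ≤ jetNormSq g z → x ≤ M := fun hx h => by
    nlinarith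
  have hG := gradNormSq_nonneg g z
  have hg := sq_nonneg ‖g z‖
  have hz := sq_nonneg ‖z‖
  refine norm_prod_le_iff.2 ⟨key (norm_nonneg _) ?_, norm_prod_le_iff.2
    ⟨key (norm_nonneg _) ?_, (pi_norm_le_iff_of_nonneg (by linarith)).2 fun i =>
      key (norm_nonneg _) ?_⟩⟩
  · change ‖z‖ ^ 2 ≤ _
    rw [jetNormSq]
    linarith
  · change ‖g z‖ ^ 2 ≤ _
    rw [jetNormSq]
    linarith
  · have : ‖pderiv i g z‖ ^ 2 ≤ gradNormSq g z :=
      Finset.single_le_sum (f := fun i => ‖pderiv i g z‖ ^ 2) (fun _ _ => sq_nonneg _)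
        (Finset.mem_univ i)
    change ‖pderiv i g z‖ ^ 2 ≤ _
    rw [jetNormSq]
    linarith

end JetSpace

/-! ### Analytic continuation to the full ball. -/

section Extension

variable {n k : ℕ} {f : EuclideanSpace ℂ (Fin n) → EuclideanSpace ℂ (Fin k)} {r Λ : ℝ}
  {L : (CubeIndex n k × ((Unit ⊕ Fin n) ⊕ Fin k) → ℂ) →ₗ[ℂ] (SffIndex n k → ℂ)}

theorem jet_eq_of_eventuallyEq {g : EuclideanSpace ℂ (Fin n) → EuclideanSpace ℂ (Fin k)}
    {z : EuclideanSpace ℂ (Fin n)} (h : f =ᶠ[𝓝 z] g) : jet f z = jet g z := by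
  simp only [jet, h.eq_of_nhds, pderiv, h.fderiv_eq]

theorem polVec_eq_of_eventuallyEq {g : EuclideanSpace ℂ (Fin n) → EuclideanSpace ℂ (Fin k)}
    {z : EuclideanSpace ℂ (Fin n)} (h : f =ᶠ[𝓝 z] g) : polVec Λ f z = polVec Λ g z := by
  rw [← jetSpacePolVec_jet, ← jetSpacePolVec_jet, jet_eq_of_eventuallyEq h]

theorem sffVec_eq_of_eventuallyEq {g : EuclideanSpace ℂ (Fin n) → EuclideanSpace ℂ (Fin k)}
    {z : EuclideanSpace ℂ (Fin n)} (h : f =ᶠ[𝓝 z] g) : sffVec f z = sffVec g z := by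
  have hj := jet_eq_of_eventuallyEq h
  have hp : ∀ p, plucker f p =ᶠ[𝓝 z] plucker g p := fun p =>
    h.eventuallyEq_nhds.mono fun x hx =>
      congrArg (fun w => jetSpacePlucker w p) (jet_eq_of_eventuallyEq hx)
  have hw : ∀ p q, pluckerWedge f p q z = pluckerWedge g p q z := fun p q => by
    funext i
    simp only [pluckerWedge, pderiv, (hp p).eq_of_nhds, (hp q).eq_of_nhds, (hp p).fderiv_eq,
      (hp q).fderiv_eq]
  have hc : ∀ α, graphCoord f α z = graphCoord g α z := fun α =>
    congrArg (fun w => jetSpaceCoord w α) hj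
  have hm : jetMatrix f z = jetMatrix g z := congrArg jetSpaceMatrix hj
  funext x
  simp only [sffVec, hc, hw, augMinor, augmented, hm]

/-- The linear relation between the jets propagates along holomorphic continuation. -/
theorem sffVec_eq_of_eqOn_ball {g : EuclideanSpace ℂ (Fin n) → EuclideanSpace ℂ (Fin k)} {ρ : ℝ}
    (hr : 0 < r) (hfg : EqOn f g (ball 0 r)) (hg : DifferentiableOn ℂ g (ball 0 ρ))
    (hL : ∀ z ∈ ball (0 : EuclideanSpace ℂ (Fin n)) r, sffVec f z = L (polVec Λ f z)) :
    ∀ z ∈ ball (0 : EuclideanSpace ℂ (Fin n)) ρ, sffVec g z = L (polVec Λ g z) := by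
  intro z hz
  refine sub_eq_zero.1 (eqOn_zero_of_eqOn_zero_ball hr
    (f := fun z => sffVec g z - L (polVec Λ g z)) ?_ (fun z hz => ?_) z hz)
  · exact (differentiableOn_pi.2 (differentiableOn_sffVec isOpen_ball hg)).sub
      (L.toContinuousLinearMap.differentiable.comp_differentiableOn
        (differentiableOn_pi.2 (differentiableOn_polVec Λ isOpen_ball hg)))
  · have h := hfg.eventuallyEq_of_mem (isOpen_ball.mem_nhds hz)
    simp only [← sffVec_eq_of_eventuallyEq h, ← polVec_eq_of_eventuallyEq h, hL z hz, sub_self]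

/-- The radius of convergence of a solution can be increased by a fixed amount. -/
theorem exists_taylorBound_add (hr : 0 < r) (hΛ : 0 ≤ Λ) (hf : DifferentiableOn ℂ f (ball 0 r))
    (hf0 : f 0 = 0) (hDf0 : fderiv ℂ f 0 = 0)
    (hL : ∀ z ∈ ball (0 : EuclideanSpace ℂ (Fin n)) r, sffVec f z = L (polVec Λ f z))
    (hL' : ∀ v, ∑ i, ‖L v i‖ ^ 2 ≤ ∑ i, ‖v i‖ ^ 2) {R : ℝ} (hR : R < extRadius n Λ) :
    ∃ δ > 0, ∀ ρ, 0 < ρ → ρ ≤ R → TaylorBound f ρ → TaylorBound f (ρ + δ) := by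
  -- The radial estimate at radius `R` bounds the jet on every ball of radius `ρ ≤ R`, so the gain
  -- `δ` depends on `R` but not on `ρ`.
  set M : ℝ := (1 - (extRadius n Λ)⁻¹ * R) ^ (-(2 / (3 * (n : ℝ) + 2))) with hM
  obtain ⟨C, hC0, hC⟩ := exists_norm_jetField_le Λ L (M + 1)
  have hD : 0 < Real.exp 1 * C + 1 := by positivity
  refine ⟨(Real.exp 1 * C + 1)⁻¹, inv_pos.2 hD, fun ρ hρ hρR hT => ?_⟩
  set δ := (Real.exp 1 * C + 1)⁻¹ with hδ
  have hδ0 : 0 < δ := inv_pos.2 hD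
  let g : EuclideanSpace ℂ (Fin n) → EuclideanSpace ℂ (Fin k) := fun z => ∑' N, taylorTerm f N z
  have hg : DifferentiableOn ℂ g (ball 0 ρ) := hT.differentiableOn hρ
  have hfg : EqOn f g (ball 0 r) := fun z hz => (hasSum_taylorTerm hf hz).tsum_eq.symm
  have hgL := sffVec_eq_of_eqOn_ball hr hfg hg hL
  have h0 : f =ᶠ[𝓝 0] g := hfg.eventuallyEq_of_mem (ball_mem_nhds 0 hr)
  have hg0 : g 0 = 0 := h0.eq_of_nhds ▸ hf0
  have hDg0 : fderiv ℂ g 0 = 0 := (h0.fderiv_eq (𝕜 := ℂ)).symm.trans hDf0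
  have hrΛ := extRadius_pos n hΛ
  have hjet : ∀ z ∈ ball (0 : EuclideanSpace ℂ (Fin n)) ρ, jetNormSq g z ≤ M := by
    intro z hz
    have hzR : ‖z‖ < R := (mem_ball_zero_iff.1 hz).trans_le hρR
    refine (jetNormSq_le hΛ hg hg0 hDg0 (fun x hx => hessNormSq_le_of_linear isOpen_ball hg hx hΛ
      hL' (hgL x hx)) hz (hzR.trans hR)).trans ?_
    refine Real.rpow_le_rpow_of_nonpos ?_ ?_ (neg_nonpos.2 (by positivity))
    · rw [sub_pos, inv_mul_lt_one₀ hrΛ]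
      exact hR
    · have := mul_le_mul_of_nonneg_left hzR.le (inv_pos.2 hrΛ).le
      linarith
  refine TaylorBound.of_norm_iteratedDeriv_le (B := M + 1) hr hf fun N ζ hζ => ?_
  have hmem : ∀ t ∈ ball (0 : ℂ) ρ, t • ζ ∈ ball (0 : EuclideanSpace ℂ (Fin n)) ρ := by
    intro t ht
    rw [mem_ball_zero_iff] at ht ⊢
    rw [norm_smul]
    nlinarith [norm_nonneg t, norm_nonneg ζ]
  have hline : (fun t : ℂ => f (t • ζ)) =ᶠ[𝓝 0] fun t => g (t • ζ) := by
    have : Tendsto (fun t : ℂ => t • ζ) (𝓝 0) (𝓝 0) := by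
      have hc : Continuous fun t : ℂ => t • ζ := by fun_prop
      simpa using hc.tendsto 0
    exact this.eventually h0
  rw [hline.iteratedDeriv_eq N]
  have hray : Differentiable ℂ fun t : ℂ => t • ζ := differentiable_id.smul_const ζ
  refine norm_iteratedDeriv_mul_add_pow_le hρ hδ0 (hg.comp hray.differentiableOn hmem)
    (fun j t ht => ?_) N
  have hM0 : 0 ≤ M := by
    have := (one_le_jetNormSq g _).trans (hjet _ (hmem t ht))
    linarith
  have h := norm_iteratedDeriv_le_of_ode (contDiff_jetField Λ L ζ)
    -- The projection of the jet to the value of the map.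
    (ℓ := (ContinuousLinearMap.fst ℂ _ _).comp (ContinuousLinearMap.snd ℂ _ _))
    (fun w => (norm_fst_le _).trans (norm_snd_le w)) hC0 (hC ζ hζ)
    (fun t ht => hasDerivAt_jet isOpen_ball hg hgL (hmem t ht))
    (fun t ht => norm_jet_le g (hjet _ (hmem t ht))) j ht
  calc _ ≤ (M + 1) * j.factorial * (Real.exp 1 * C) ^ j * δ ^ j :=
        mul_le_mul_of_nonneg_right h (by positivity)
    _ = (M + 1) * j.factorial * (Real.exp 1 * C * δ) ^ j := by rw [mul_pow _ δ]; ring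
    _ ≤ (M + 1) * j.factorial * 1 := by
        refine mul_le_mul_of_nonneg_left (pow_le_one₀ (by positivity) ?_) (by positivity)
        rw [hδ, ← div_eq_mul_inv, div_le_one hD]
        linarith
    _ = _ := mul_one _

theorem taylorBound_of_lt_extRadius (hr : 0 < r) (hΛ : 0 ≤ Λ)
    (hf : DifferentiableOn ℂ f (ball 0 r)) (hf0 : f 0 = 0) (hDf0 : fderiv ℂ f 0 = 0)
    (hL : ∀ z ∈ ball (0 : EuclideanSpace ℂ (Fin n)) r, sffVec f z = L (polVec Λ f z))
    (hL' : ∀ v, ∑ i, ‖L v i‖ ^ 2 ≤ ∑ i, ‖v i‖ ^ 2) {R : ℝ} (hR0 : 0 < R)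
    (hR : R < extRadius n Λ) : TaylorBound f R := by
  obtain ⟨δ, hδ, hstep⟩ := exists_taylorBound_add hr hΛ hf hf0 hDf0 hL hL' hR
  -- Truncating at `R` keeps each radius in the range where the uniform gain applies.
  have key : ∀ j : ℕ, TaylorBound f (min (r / 2 + j * δ) R) := by
    intro j
    induction j with
    | zero => exact (exists_taylorBound hr hf).mono (by positivity) (by simp)
    | succ j ih =>
      refine (hstep _ (by positivity) (min_le_right _ _) ih).mono (by positivity) ?_
      rw [← min_add_add_right]
      push_cast
      exact min_le_min (by linarith) (by linarith)
  obtain ⟨j, hj⟩ := exists_nat_gt (R / δ)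
  have h := key j
  rw [div_lt_iff₀ hδ] at hj
  rwa [min_eq_right (by linarith)] at h

/-- The Taylor series is holomorphic on each smaller concentric ball, which suffices because
differentiability is local. No uniform bound up to radius `r_Λ` is needed. -/
theorem exists_extension (hr : 0 < r) (hΛ : 0 ≤ Λ)
    (hf : DifferentiableOn ℂ f (ball 0 r)) (hf0 : f 0 = 0) (hDf0 : fderiv ℂ f 0 = 0)
    (hL : ∀ z ∈ ball (0 : EuclideanSpace ℂ (Fin n)) r, sffVec f z = L (polVec Λ f z))
    (hL' : ∀ v, ∑ i, ‖L v i‖ ^ 2 ≤ ∑ i, ‖v i‖ ^ 2) :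
    ∃ F : EuclideanSpace ℂ (Fin n) → EuclideanSpace ℂ (Fin k),
      DifferentiableOn ℂ F (ball 0 (extRadius n Λ)) ∧ EqOn F f (ball 0 r) := by
  refine ⟨fun z => ∑' N, taylorTerm f N z, fun z hz => ?_,
    fun z hz => (hasSum_taylorTerm hf hz).tsum_eq⟩
  obtain ⟨R, hzR, hR⟩ := exists_between (mem_ball_zero_iff.1 hz)
  have hR0 : 0 < R := (norm_nonneg z).trans_lt hzR
  exact (((taylorBound_of_lt_extRadius hr hΛ hf hf0 hDf0 hL hL' hR0 hR).differentiableOn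
    hR0).differentiableAt (isOpen_ball.mem_nhds (mem_ball_zero_iff.2 hzR))).differentiableWithinAt

end Extension

end KahlerGraph

end

/-! ### The estimate and the extension. -/

theorem lemma4p2 (n k : ℕ) (hn : 1 ≤ n) (hk : 1 ≤ k) (r Λ : ℝ) (hr : 0 < r) (hΛ : 0 ≤ Λ)
    (f : EuclideanSpace ℂ (Fin n) → EuclideanSpace ℂ (Fin k))
    (hf : DifferentiableOn ℂ f (Metric.ball 0 r))
    (hf0 : f 0 = 0) (hDf0 : fderiv ℂ f 0 = 0)
    (A : Matrix (Fin (n + k + 1)) (Fin (n + k + 1)) ℂ) (hA : A.IsHermitian)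
    (hAΛ : ((Λ : ℂ) • (1 : Matrix (Fin (n + k + 1)) (Fin (n + k + 1)) ℂ) - A).PosSemidef)
    (heq : ∀ z ∈ Metric.ball (0 : EuclideanSpace ℂ (Fin n)) r,
      (n : ℂ) * (n + 1)
          - 1 / 4 * KahlerGraph.scalarCurvature (KahlerGraph.graphMetric f) z
        = dotProduct (star (KahlerGraph.graphVec f z))
            (Matrix.mulVec A (KahlerGraph.graphVec f z))
          / ((1 + ‖z‖ ^ 2 + ‖f z‖ ^ 2 : ℝ) : ℂ)) :
    (∀ z ∈ Metric.ball (0 : EuclideanSpace ℂ (Fin n)) r, ‖z‖ < KahlerGraph.extRadius n Λ →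
      1 + ‖z‖ ^ 2 + ‖f z‖ ^ 2 + KahlerGraph.gradNormSq f z
        ≤ (1 - (KahlerGraph.extRadius n Λ)⁻¹ * ‖z‖) ^ (-(2 / (3 * (n : ℝ) + 2))))
    ∧ (r < KahlerGraph.extRadius n Λ →
      ∃ F : EuclideanSpace ℂ (Fin n) → EuclideanSpace ℂ (Fin k),
        DifferentiableOn ℂ F (Metric.ball 0 (KahlerGraph.extRadius n Λ)) ∧
        Set.EqOn F f (Metric.ball 0 r)) := by
  obtain ⟨L, hL, hL'⟩ := KahlerGraph.exists_linear_sffVec hΛ hf hAΛ heq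
  refine ⟨fun z hz hzΛ => ?_, fun _ =>
    KahlerGraph.exists_extension hr hΛ hf hf0 hDf0 hL hL'⟩
  exact KahlerGraph.jetNormSq_le hΛ hf hf0 hDf0 (fun x hx =>
    KahlerGraph.hessNormSq_le_of_linear Metric.isOpen_ball hf hx hΛ hL' (hL x hx)) hz hzΛ
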